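/- **Corollary (description of $\mathcal{MI}_1$).** Let $\mathfrak H$ be the upper half plane, $q=e^{2\pi i z}$ and $\mathbb L=\log|q|=-2\pi\,\mathrm{Im}\,z$. For $r,s\in\mathbb Z$ let $\mathcal M_{r,s}$ be the space of real analytic functions $f:\mathfrak H\to\mathbb C$ with $f(\gamma z)=(cz+d)^r(c\bar z+d)^s f(z)$ for all $\gamma=\begin{pmatrix}a&b\\c&d\end{pmatrix}\in \mathrm{SL}_2(\mathbb Z)$ which admit an expansion $f=\sum_{k=-N}^{N}\mathbb L^k\sum_{m,n\ge0}a^{(k)}_{m,n}q^m\bar q^n$ for some $N$, and let $P^p\mathcal M_{r,s}$ be the subspace of those $f$ with $a^{(k)}_{m,n}=0$ for all $k<p$. On the bigraded algebra $\mathcal M=\bigoplus_{r,s}\mathcal M_{r,s}$ let $\partial$ and $\overline\partial$ be the operators acting on $\mathcal M_{r,s}$ by $(z-\bar z)\frac{\partial}{\partial z}+r$ and $(\bar z-z)\frac{\partial}{\partial\bar z}+s$, of bidegrees $(1,-1)$ and $(-1,1)$. Let $M$ (resp. $\overline M$) be the ring of holomorphic (resp. antiholomorphic) modular forms of level one; holomorphic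 forms of weight $n$ have bidegree $(n,0)$, their conjugates $(0,n)$, and $\mathbb L$ has bidegree $(-1,-1)$. Let $\mathcal{MI}\subset\bigoplus_{r,s\ge0}P^{-r-s}\mathcal M_{r,s}$ be the largest subspace with an increasing (length) filtration $(\mathcal{MI}_k)_{k\in\mathbb Z}$ such that $\mathcal{MI}_k=0$ for $k<0$ and, for every $k$ and every $F\in\mathcal{MI}_k$, $$\partial F\in \mathcal{MI}_k+M[\mathbb L]\times\mathcal{MI}_{k-1},\qquad \overline\partial F\in \mathcal{MI}_k+\overline M[\mathbb L]\times\mathcal{MI}_{k-1}$$ (here $A\times B$ denotes the linear span of products). For integers $r,s\ge0$ with $w=r+s\geq 2$ let $\mathcal E_{r,s}$ be the real analytic Eisenstein series $$\mathcal E_{r,s}(z)=\frac{w!}{(2\pi i)^{w+2}}\,\frac12\sum_{(m,n)\in\mathbb Z^2\setminus(0,0)}\frac{\mathbb L}{(mz+n)^{r+1}(m\bar z+n)^{s+1}},$$ of weights $(r,s)$; it vanishes if and only if $r+s$ is odd. Then $\mathcal{MI}_0=\mathbb C[\mathbb L^{-1}]$ and $$\mathcal{MI}_1=\mathcal{MI}_0\;\oplus\;\Big(\mathcal{MI}_0\otimes_{\mathbb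 C}\bigoplus_{r,s\ge0,\;r+s\ge2}\mathbb C\,\mathcal E_{r,s}\Big).$$ That is: the multiplication map from $\mathcal{MI}_0\otimes_{\mathbb C}\bigoplus_{r,s}\mathbb C\,\mathcal E_{r,s}$ (external direct sum) to $\mathcal M$ is injective, its image meets $\mathcal{MI}_0$ only in $0$, and $\mathcal{MI}_1$ is the sum of $\mathcal{MI}_0$ and this image. -/

import Mathlib

open scoped UpperHalfPlane MatrixGroups TensorProduct DirectSum ComplexConjugate

noncomputable section

namespace ModIter

/-! ### Functions on the upper half plane -/

/-- The function `𝕃 = log |q| = -2 π y`. -/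
def ell (z : ℍ) : ℂ := ((-2 * Real.pi * z.im : ℝ) : ℂ)

/-- `q = exp (2 π i z)`. -/
def q (z : ℍ) : ℂ := Complex.exp (2 * Real.pi * Complex.I * z)

/-- A function on `ℍ`, regarded as a function of a complex variable
(only its restriction to the open set `0 < im w` matters). -/
def toC (f : ℍ → ℂ) : ℂ → ℂ := fun w => f (UpperHalfPlane.ofComplex w)

/-- The Wirtinger derivative `∂f/∂z = (∂f/∂x - i ∂f/∂y) / 2`. -/
def dz (f : ℍ → ℂ) (z : ℍ) : ℂ :=
  (fderiv ℝ (toC f) (z : ℂ) 1 - Complex.I * fderiv ℝ (toC f) (z : ℂ) Complex.I) / 2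

/-- The Wirtinger derivative `∂f/∂z̄ = (∂f/∂x + i ∂f/∂y) / 2`. -/
def dzbar (f : ℍ → ℂ) (z : ℍ) : ℂ :=
  (fderiv ℝ (toC f) (z : ℂ) 1 + Complex.I * fderiv ℝ (toC f) (z : ℂ) Complex.I) / 2

/-- `∂_r = (z - z̄) ∂/∂z + r`. -/
def maass (r : ℤ) (f : ℍ → ℂ) (z : ℍ) : ℂ := ((z : ℂ) - conj (z : ℂ)) * dz f z + r * f z

/-- `∂̄_s = (z̄ - z) ∂/∂z̄ + s`. -/
def maassBar (s : ℤ) (f : ℍ → ℂ) (z : ℍ) : ℂ := (conj (z : ℂ) - (z : ℂ)) * dzbar f z + s * f z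

/-- Real analytic functions on `ℍ` which are modular of weights `(r, s)`:
`f (γ z) = (c z + d) ^ r (c z̄ + d) ^ s f z` for all `γ ∈ SL₂(ℤ)`. -/
def modularFns (r s : ℤ) : Submodule ℂ (ℍ → ℂ) where
  carrier := {f | AnalyticOnNhd ℝ (toC f) {w : ℂ | 0 < w.im} ∧
    ∀ (γ : SL(2, ℤ)) (z : ℍ),
      f (γ • z) = ((γ 1 0 : ℂ) * z + γ 1 1) ^ r * ((γ 1 0 : ℂ) * conj (z : ℂ) + γ 1 1) ^ s * f z}
  zero_mem' := ⟨by
    have : toC 0 = fun _ => (0 : ℂ) := rfl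
    rw [this]; exact analyticOnNhd_const, by simp⟩
  add_mem' := by
    rintro f g ⟨hf, hf'⟩ ⟨hg, hg'⟩
    exact ⟨hf.add hg, fun γ z => by simp only [Pi.add_apply, hf', hg']; ring⟩
  smul_mem' := by
    rintro c f ⟨hf, hf'⟩
    exact ⟨analyticOnNhd_const.mul hf,
      fun γ z => by simp only [Pi.smul_apply, smul_eq_mul, hf']; ring⟩

/-- Functions with an expansion in `𝕃 ^ p ℂ[[q, q̄]][𝕃]`: finite sums, over integers `k ≥ p`, of
functions `𝕃 ^ k ∑_{m, n ≥ 0} a_{m, n} q ^ m q̄ ^ n` (the double series converging on `ℍ`). -/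
def expansions (p : ℤ) : Submodule ℂ (ℍ → ℂ) :=
  Submodule.span ℂ {f | ∃ k : ℤ, p ≤ k ∧ ∃ a : ℕ × ℕ → ℂ, ∀ z : ℍ,
    HasSum (fun mn : ℕ × ℕ => ell z ^ k * (a mn * q z ^ mn.1 * conj (q z) ^ mn.2)) (f z)}

/-- `P ^ p 𝓜_{r,s}`: real analytic functions, modular of weights `(r, s)`, with an expansion in
`ℂ[[q, q̄]][𝕃, 𝕃⁻¹]` all of whose terms have exponent of `𝕃` at least `p`. -/
def PM (p r s : ℤ) : Submodule ℂ (ℍ → ℂ) := modularFns r s ⊓ expansions p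

/-! ### The bigraded algebra -/

/-- Finite formal sums `∑ f_{r,s}` of functions on `ℍ` labelled by pairs of weights `(r, s) ∈ ℤ²`,
with the bigraded product. It contains `⨁ 𝓜_{r,s}`; the component of `F` of weights `p` is
`F.coeff p`. -/
abbrev Bigraded : Type := AddMonoidAlgebra (ℍ → ℂ) (ℤ × ℤ)

/-- The function `f` placed in weights `(r, s)`. -/
abbrev single (r s : ℤ) (f : ℍ → ℂ) : Bigraded := AddMonoidAlgebra.single (r, s) f

/-- The operator `∂` of bidegree `(1, -1)`, acting by `∂_r` in weights `(r, s)`. -/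
def del (F : Bigraded) : Bigraded :=
  F.coeff.sum fun p f => single (p.1 + 1) (p.2 - 1) (maass p.1 f)

/-- The operator `∂̄` of bidegree `(-1, 1)`, acting by `∂̄_s` in weights `(r, s)`. -/
def delBar (F : Bigraded) : Bigraded :=
  F.coeff.sum fun p f => single (p.1 - 1) (p.2 + 1) (maassBar p.2 f)

/-- `⨁_{r, s ≥ 0} P ^ (-r-s) 𝓜_{r,s}`. -/
def quadrant : Submodule ℂ Bigraded where
  carrier := {F | ∀ r s : ℤ, F.coeff (r, s) ∈ PM (-r - s) r s ∧
    (¬ (0 ≤ r ∧ 0 ≤ s) → F.coeff (r, s) = 0)}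
  zero_mem' := fun r s => ⟨by simp, by simp⟩
  add_mem' := fun {F G} hF hG r s =>
    ⟨by simpa using add_mem (hF r s).1 (hG r s).1,
      fun h => by simp [(hF r s).2 h, (hG r s).2 h]⟩
  smul_mem' := fun c F hF r s =>
    ⟨by simpa using Submodule.smul_mem _ c (hF r s).1, fun h => by simp [(hF r s).2 h]⟩

/-- `𝕃`, of weights `(-1, -1)`. -/
def Ell : Bigraded := single (-1) (-1) ell

/-- `𝕃⁻¹`, of weights `(1, 1)`. -/
def EllInv : Bigraded := single 1 1 (fun z => (ell z)⁻¹)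

/-- `M[𝕃]`, where `M` is the ring of holomorphic modular forms of level one
(a form of weight `n` having weights `(n, 0)`). -/
def holEll : Subalgebra ℂ Bigraded :=
  Algebra.adjoin ℂ (insert Ell {F | ∃ (n : ℤ) (f : ModularForm 𝒮ℒ n), F = single n 0 f})

/-- `M̄[𝕃]`, where `M̄` is the ring of antiholomorphic modular forms of level one. -/
def antiholEll : Subalgebra ℂ Bigraded :=
  Algebra.adjoin ℂ (insert Ell
    {F | ∃ (n : ℤ) (f : ModularForm 𝒮ℒ n), F = single 0 n (fun z => conj (f z))})

/-! ### Modular iterated integrals -/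

/-- The condition defining the class of modular iterated primitives, on an increasing filtration
`V_k` of a subspace `⋃ V_k` of `⨁_{r, s ≥ 0} P ^ (-r-s) 𝓜_{r,s}`. -/
structure IsAdmissible (V : ℤ → Submodule ℂ Bigraded) : Prop where
  mono : Monotone V
  le_quadrant : ∀ k, V k ≤ quadrant
  eq_bot : ∀ k < 0, V k = ⊥
  del_mem : ∀ k, ∀ F ∈ V k, del F ∈ V k ⊔ Subalgebra.toSubmodule holEll * V (k - 1)
  delBar_mem : ∀ k, ∀ F ∈ V k, delBar F ∈ V k ⊔ Subalgebra.toSubmodule antiholEll * V (k - 1)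

/-- The length filtration `𝓜𝓘_k` of the class of modular iterated primitives: the largest
admissible filtration, i.e. the sum of all admissible ones. -/
def MI (k : ℤ) : Submodule ℂ Bigraded := ⨆ V : {V // IsAdmissible V}, V.1 k

/-! ### Real analytic Eisenstein series -/

/-- `𝓔_{r,s}(z) = w! / (2πi)^(w+2) · 1/2 · ∑ 𝕃 / ((m z + n)^(r+1) (m z̄ + n)^(s+1))`, where
`w = r + s` and the sum is over `(m, n) ∈ ℤ² ∖ (0, 0)`. -/
def eisFn (r s : ℕ) (z : ℍ) : ℂ :=
  (r + s).factorial / (2 * Real.pi * Complex.I) ^ (r + s + 2) * (1 / 2) *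
    ∑' p : {p : ℤ × ℤ // p ≠ 0},
      ell z / (((p.1.1 : ℂ) * z + p.1.2) ^ (r + 1) * ((p.1.1 : ℂ) * conj (z : ℂ) + p.1.2) ^ (s + 1))

/-- `𝓔_{r,s}` in weights `(r, s)`. -/
def eis (r s : ℕ) : Bigraded := single r s (eisFn r s)

/-- The pairs `r, s ≥ 0` with `r + s ≥ 2`. -/
abbrev EisIndex : Type := {p : ℕ × ℕ // 2 ≤ p.1 + p.2}

/-- The external direct sum `⨁_{r, s ≥ 0, r + s ≥ 2} ℂ 𝓔_{r,s}` of the subspaces `ℂ 𝓔_{r,s}`. -/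
abbrev EisSum : Type := ⨁ p : EisIndex, (Submodule.span ℂ {eis p.1.1 p.1.2} : Submodule ℂ Bigraded)

/-- The multiplication map `𝓜𝓘_0 ⊗ ⨁ ℂ 𝓔_{r,s} → ⨁ 𝓜_{r,s}`. -/
def eisMul : (MI 0 ⊗[ℂ] EisSum) →ₗ[ℂ] Bigraded :=
  TensorProduct.lift ((LinearMap.mul ℂ Bigraded).compl₁₂ (MI 0).subtype
    (DirectSum.coeLinearMap fun p : EisIndex => Submodule.span ℂ {eis p.1.1 p.1.2}))

/-! ### The sum of all admissible filtrations is admissible -/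

theorem toC_differentiableAt {r s : ℤ} {f : ℍ → ℂ} (hf : f ∈ modularFns r s) (z : ℍ) :
    DifferentiableAt ℝ (toC f) (z : ℂ) :=
  (hf.1 _ z.im_pos).differentiableAt

theorem maass_add {r s : ℤ} {f g : ℍ → ℂ} (hf : f ∈ modularFns r s) (hg : g ∈ modularFns r s)
    (k : ℤ) : maass k (f + g) = maass k f + maass k g := by
  have h : toC (f + g) = toC f + toC g := rfl
  ext z
  simp only [maass, dz, Pi.add_apply, h,
    fderiv_add (toC_differentiableAt hf z) (toC_differentiableAt hg z),
    add_apply]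
  ring

theorem maassBar_add {r s : ℤ} {f g : ℍ → ℂ} (hf : f ∈ modularFns r s) (hg : g ∈ modularFns r s)
    (k : ℤ) : maassBar k (f + g) = maassBar k f + maassBar k g := by
  have h : toC (f + g) = toC f + toC g := rfl
  ext z
  simp only [maassBar, dzbar, Pi.add_apply, h,
    fderiv_add (toC_differentiableAt hf z) (toC_differentiableAt hg z),
    add_apply]
  ring

theorem toC_zero : toC 0 = 0 := rfl

theorem maass_zero (k : ℤ) : maass k 0 = 0 := by
  ext z; simp [maass, dz, toC_zero]

theorem maassBar_zero (k : ℤ) : maassBar k 0 = 0 := by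
  ext z; simp [maassBar, dzbar, toC_zero]

theorem del_add {F G : Bigraded} (hF : F ∈ quadrant) (hG : G ∈ quadrant) :
    del (F + G) = del F + del G := by
  classical
  have e : ∀ H : Bigraded, H.coeff.support ⊆ F.coeff.support ∪ G.coeff.support →
      del H = ∑ p ∈ F.coeff.support ∪ G.coeff.support,
        single (p.1 + 1) (p.2 - 1) (maass p.1 (H.coeff p)) := fun H hH =>
    Finsupp.sum_of_support_subset _ hH _ fun p _ => by rw [maass_zero]; simp
  rw [e (F + G) (by rw [AddMonoidAlgebra.coeff_add]; exact Finsupp.support_add),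
    e F Finset.subset_union_left, e G Finset.subset_union_right, ← Finset.sum_add_distrib]
  refine Finset.sum_congr rfl fun p _ => ?_
  rw [AddMonoidAlgebra.coeff_add, Finsupp.add_apply,
    maass_add (hF p.1 p.2).1.1 (hG p.1 p.2).1.1]
  simp

theorem delBar_add {F G : Bigraded} (hF : F ∈ quadrant) (hG : G ∈ quadrant) :
    delBar (F + G) = delBar F + delBar G := by
  classical
  have e : ∀ H : Bigraded, H.coeff.support ⊆ F.coeff.support ∪ G.coeff.support →
      delBar H = ∑ p ∈ F.coeff.support ∪ G.coeff.support,
        single (p.1 - 1) (p.2 + 1) (maassBar p.2 (H.coeff p)) := fun H hH =>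
    Finsupp.sum_of_support_subset _ hH _ fun p _ => by rw [maassBar_zero]; simp
  rw [e (F + G) (by rw [AddMonoidAlgebra.coeff_add]; exact Finsupp.support_add),
    e F Finset.subset_union_left, e G Finset.subset_union_right, ← Finset.sum_add_distrib]
  refine Finset.sum_congr rfl fun p _ => ?_
  rw [AddMonoidAlgebra.coeff_add, Finsupp.add_apply,
    maassBar_add (hF p.1 p.2).1.1 (hG p.1 p.2).1.1]
  simp

/-- The filtration `𝓜𝓘_k` is itself admissible; it is therefore the largest admissible one. -/
theorem isAdmissible_MI : IsAdmissible MI where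
  mono k l h := iSup_mono fun V => V.2.mono h
  le_quadrant k := iSup_le fun V => V.2.le_quadrant k
  eq_bot k hk := by simp only [MI, iSup_eq_bot]; exact fun V => V.2.eq_bot k hk
  del_mem k F hF := by
    refine (Submodule.iSup_induction (fun V : {V // IsAdmissible V} => V.1 k)
      (motive := fun F => F ∈ quadrant ∧
        del F ∈ MI k ⊔ Subalgebra.toSubmodule holEll * MI (k - 1)) hF ?_ ?_ ?_).2
    · intro V F hF
      exact ⟨V.2.le_quadrant k hF, sup_le_sup (le_iSup (fun V : {V // IsAdmissible V} => V.1 k) V)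
        (mul_le_mul' le_rfl
          (le_iSup (fun V : {V // IsAdmissible V} => V.1 (k - 1)) V))
        (V.2.del_mem k F hF)⟩
    · exact ⟨zero_mem _, by simp [del]⟩
    · rintro F G ⟨hF, hF'⟩ ⟨hG, hG'⟩
      exact ⟨add_mem hF hG, by rw [del_add hF hG]; exact add_mem hF' hG'⟩
  delBar_mem k F hF := by
    refine (Submodule.iSup_induction (fun V : {V // IsAdmissible V} => V.1 k)
      (motive := fun F => F ∈ quadrant ∧
        delBar F ∈ MI k ⊔ Subalgebra.toSubmodule antiholEll * MI (k - 1)) hF ?_ ?_ ?_).2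
    · intro V F hF
      exact ⟨V.2.le_quadrant k hF, sup_le_sup (le_iSup (fun V : {V // IsAdmissible V} => V.1 k) V)
        (mul_le_mul' le_rfl
          (le_iSup (fun V : {V // IsAdmissible V} => V.1 (k - 1)) V))
        (V.2.delBar_mem k F hF)⟩
    · exact ⟨zero_mem _, by simp [delBar]⟩
    · rintro F G ⟨hF, hF'⟩ ⟨hG, hG'⟩
      exact ⟨add_mem hF hG, by rw [delBar_add hF hG]; exact add_mem hF' hG'⟩

end ModIter

end

open scoped UpperHalfPlane MatrixGroups TensorProduct DirectSum ComplexConjugate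

noncomputable section

namespace ModIter

open UpperHalfPlane Filter Topology

/-! ### Wirtinger calculus -/

/-! The theorem combines a uniqueness statement for modular primitives with explicit primitives, the
Eisenstein series. Powers of `𝕃` behave as constants for `∂` and `∂̄` (`maass_ell_zpow_mul`), so
primitives in weights `(r, s)` reduce to weights `(r - s, 0)`.

Let `f` be the component of weights `(r, s)`, `s ≤ r`, of an element of `MI 1`. Once `MI 0 = ℂ[𝕃⁻¹]`
is known, counting weights gives `∂f = f' + 𝕃^(1-s) g`, with `f'` a component of weights `(r + 1, s
- 1)` and `g` holomorphic modular of weight `r - s + 2`. Induct on `s`. If `s = 0`, then `f' = 0`;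
otherwise `f'` is a combination of functions `𝕃^(-n) 𝓔_{a,b}` and has a primitive of the same kind,
because `∂𝓔_{a,b+1} = (a + 1) 𝓔_{a+1,b}`. After subtracting it, `∂f = 𝕃^(1-s) g`. If `r = s`, then
`g` has weight two, so it vanishes and `f` is a multiple of `𝕃^(-s)`. If `r > s`, a multiple of
`𝕃^(-s) 𝓔_{r-s,0}` removes the constant term of `g`, and what remains of `f` is zero. The case `r <
s` follows by complex conjugation, and `MI 0` is treated likewise, without `g`.

The decisive point is `eq_zero_of_maass_eq`: a form vanishing at the cusp has no nonzero modular
primitive `ψ`. Put `u = 𝕃^w ψ`, so that `∂u/∂z = iπ 𝕃^w g`. The horocycle means of `u` are constant,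
since those of `g` vanish, and the expansion of `u` keeps it at bounded distance from its mean;
hence `u` is bounded at the cusp. The invariant function `|u|² / y^w` therefore attains its maximum,
and an elliptic equation for `u` forces `u` to vanish there (`im_eq_zero_of_isLocalMax`).

In the other direction, `eisFn_mem_PM` gives the expansion of the Eisenstein series, so that their
span is admissible. Linear independence follows from orders of growth along the imaginary axis. -/

theorem toC_coe (f : ℍ → ℂ) (z : ℍ) : toC f (z : ℂ) = f z := by
  simp [toC]

theorem toC_of_im_pos (f : ℍ → ℂ) {w : ℂ} (hw : 0 < w.im) : toC f w = f ⟨w, hw⟩ := by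
  simp [toC, ofComplex_apply_of_im_pos hw]

theorem isOpen_im_pos : IsOpen {w : ℂ | 0 < w.im} :=
  isOpen_lt continuous_const Complex.continuous_im

theorem toC_eventuallyEq {f : ℍ → ℂ} {F : ℂ → ℂ} (h : ∀ z : ℍ, f z = F z) (z : ℍ) :
    toC f =ᶠ[𝓝 (z : ℂ)] F := by
  filter_upwards [isOpen_im_pos.mem_nhds z.im_pos] with w hw
  rw [toC_of_im_pos f hw, h]

theorem ell_ne_zero (z : ℍ) : ell z ≠ 0 := by
  have := z.im_pos.ne'
  simp [ell, Real.pi_ne_zero, this]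

theorem conj_ell (z : ℍ) : conj (ell z) = ell z := by
  simp only [ell, Complex.conj_ofReal]

theorem sub_conj_eq (z : ℍ) : (z : ℂ) - conj (z : ℂ) = ell z / (Complex.I * Real.pi) := by
  have hpi : (Real.pi : ℂ) ≠ 0 := by exact_mod_cast Real.pi_ne_zero
  rw [Complex.sub_conj, eq_div_iff (mul_ne_zero Complex.I_ne_zero hpi), ell]
  push_cast
  rw [show (z : ℂ).im = z.im from rfl]
  linear_combination 2 * (z.im : ℂ) * Real.pi * Complex.I_sq

theorem hasFDerivAt_ell (z : ℍ) :
    HasFDerivAt (toC ell) ((((-2 * Real.pi : ℝ) : ℂ)) •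
      (Complex.ofRealCLM.comp Complex.imCLM)) (z : ℂ) := by
  have : HasFDerivAt (𝕜 := ℝ) (fun w : ℂ => ((-2 * Real.pi : ℝ) : ℂ) * (w.im : ℂ))
      ((((-2 * Real.pi : ℝ) : ℂ)) • (Complex.ofRealCLM.comp Complex.imCLM)) (z : ℂ) := by
    exact ((Complex.ofRealCLM.comp Complex.imCLM).hasFDerivAt (x := (z : ℂ))).const_mul _
  exact this.congr_of_eventuallyEq (toC_eventuallyEq (fun z => by simp [ell]) z)

theorem dz_mul {f g : ℍ → ℂ} {z : ℍ} (hf : DifferentiableAt ℝ (toC f) (z : ℂ))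
    (hg : DifferentiableAt ℝ (toC g) (z : ℂ)) :
    dz (fun z => f z * g z) z = f z * dz g z + dz f z * g z := by
  have h : toC (fun z => f z * g z) = toC f * toC g := rfl
  simp only [dz, h, fderiv_mul hf hg, toC_coe]
  simp
  ring

theorem toC_ell_ne_zero (w : ℂ) : toC ell w ≠ 0 := ell_ne_zero _

theorem analyticOnNhd_toC_ell : AnalyticOnNhd ℝ (toC ell) {w : ℂ | 0 < w.im} := by
  have : AnalyticOnNhd ℝ (fun w : ℂ => ((-2 * Real.pi : ℝ) : ℂ) * (w.im : ℂ)) {w : ℂ | 0 < w.im} :=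
    fun w _ => analyticAt_const.mul
      (ContinuousLinearMap.analyticAt (Complex.ofRealCLM.comp Complex.imCLM) w)
  exact this.congr isOpen_im_pos fun w hw => by
    rw [toC_of_im_pos _ hw]; simp [ell]

theorem analyticOnNhd_toC_ell_zpow (k : ℤ) :
    AnalyticOnNhd ℝ (toC fun z => ell z ^ k) {w : ℂ | 0 < w.im} :=
  fun w hw => (analyticOnNhd_toC_ell w hw).fun_zpow (toC_ell_ne_zero w)

theorem dz_ell_zpow (k : ℤ) (z : ℍ) :
    dz (fun z => ell z ^ k) z = k * ell z ^ (k - 1) * (Complex.I * Real.pi) := by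
  have h : HasFDerivAt (toC fun z => ell z ^ k) _ (z : ℂ) :=
    (hasDerivAt_zpow k (toC ell z) (Or.inl (toC_ell_ne_zero _))).comp_hasFDerivAt_of_eq
      (z : ℂ) (hasFDerivAt_ell z) rfl
  rw [dz, h.fderiv]
  simp [toC_coe]
  ring

/-- As `z - z̄ = 𝕃 / (iπ)` and `∂𝕃/∂z = iπ`, the operator `(z - z̄) ∂/∂z` multiplies `𝕃 ^ k` by `k`,
which compensates the shift of weight. -/
theorem maass_ell_zpow_mul {r k : ℤ} {f : ℍ → ℂ}
    (hf : ∀ z : ℍ, DifferentiableAt ℝ (toC f) (z : ℂ)) :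
    maass (r - k) (fun z => ell z ^ k * f z) = fun z => ell z ^ k * maass r f z := by
  ext z
  have hpi : (Real.pi : ℂ) ≠ 0 := by exact_mod_cast Real.pi_ne_zero
  simp only [maass]
  rw [dz_mul ((analyticOnNhd_toC_ell_zpow k) z z.im_pos).differentiableAt (hf z), dz_ell_zpow,
    sub_conj_eq, zpow_sub_one₀ (ell_ne_zero z)]
  have := ell_ne_zero z
  field_simp
  push_cast
  ring

/-- Through this identity, facts about `∂̄` are deduced from those about `∂`. -/
theorem dzbar_eq_conj (f : ℍ → ℂ) (z : ℍ) : dzbar f z = conj (dz (fun z => conj (f z)) z) := by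
  have h : toC (fun z => conj (f z)) = Complex.conjCLE ∘ toC f := by
    ext w; simp [toC]
  have h2 : fderiv ℝ (toC (fun z => conj (f z))) (z : ℂ)
      = (Complex.conjCLE : ℂ →L[ℝ] ℂ).comp (fderiv ℝ (toC f) z) := by
    rw [h]; exact ContinuousLinearEquiv.comp_fderiv _
  simp only [dz, dzbar, h2]
  simp [Complex.conj_ofNat]

theorem maassBar_eq_conj (s : ℤ) (f : ℍ → ℂ) (z : ℍ) :
    maassBar s f z = conj (maass s (fun z => conj (f z)) z) := by
  simp [maassBar, maass, dzbar_eq_conj]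

theorem maass_smul (r : ℤ) (c : ℂ) (f : ℍ → ℂ) : maass r (c • f) = c • maass r f := by
  have h : toC (c • f) = c • toC f := rfl
  ext z
  simp [maass, dz, h, fderiv_const_smul_field]
  ring

/-! ### Operations on the spaces of modular functions with an expansion -/

theorem expansions_mono {p p' : ℤ} (h : p' ≤ p) : expansions p ≤ expansions p' :=
  Submodule.span_mono fun _ ⟨k, hk, a, ha⟩ => ⟨k, h.trans hk, a, ha⟩

theorem PM_mono {p p' : ℤ} (h : p' ≤ p) (r s : ℤ) : PM p r s ≤ PM p' r s :=
  inf_le_inf_left _ (expansions_mono h)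

theorem ell_zpow_mul_mem_expansions {p : ℤ} (k : ℤ) {f : ℍ → ℂ} (hf : f ∈ expansions p) :
    (fun z => ell z ^ k * f z) ∈ expansions (p + k) := by
  induction hf using Submodule.span_induction with
  | mem f hf =>
    obtain ⟨j, hj, a, ha⟩ := hf
    refine Submodule.subset_span ⟨j + k, by lia, a, fun z => ?_⟩
    convert! (ha z).mul_left (ell z ^ k) using 2 with mn
    rw [zpow_add₀ (ell_ne_zero z)]; ring
  | zero => convert! zero_mem (expansions (p + k)) using 1; ext z; simp
  | add f g _ _ hf hg => simpa [mul_add] using! add_mem hf hg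
  | smul c f _ hf => convert! Submodule.smul_mem _ c hf using 1; ext z; simp; ring

theorem conj_mem_expansions {p : ℤ} {f : ℍ → ℂ} (hf : f ∈ expansions p) :
    (fun z => conj (f z)) ∈ expansions p := by
  induction hf using Submodule.span_induction with
  | mem f hf =>
    obtain ⟨j, hj, a, ha⟩ := hf
    refine Submodule.subset_span ⟨j, hj, fun mn => conj (a mn.swap), fun z => ?_⟩
    have := Complex.hasSum_conj'.mpr (ha z)
    rw [← (Equiv.prodComm ℕ ℕ).hasSum_iff] at this
    convert! this using 2 with mn
    simp [conj_ell]; left; ring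
  | zero => convert! zero_mem (expansions p) using 1; ext z; simp
  | add f g _ _ hf hg => simpa using! add_mem hf hg
  | smul c f _ hf => convert! Submodule.smul_mem _ (conj c) hf using 1; ext z; simp

theorem ell_smul (γ : SL(2, ℤ)) (z : ℍ) :
    ell (γ • z) = ((γ 1 0 : ℂ) * z + γ 1 1) ^ (-1 : ℤ) *
      ((γ 1 0 : ℂ) * conj (z : ℂ) + γ 1 1) ^ (-1 : ℤ) * ell z := by
  have h1 : (γ • z).im = z.im / Complex.normSq (denom γ z) := ModularGroup.im_smul_eq_div_normSq γ z
  have h2 : denom γ z = (γ 1 0 : ℂ) * z + γ 1 1 := by simp [denom]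
  have h3 : ((Complex.normSq (denom γ z) : ℝ) : ℂ) = ((γ 1 0 : ℂ) * z + γ 1 1) *
      ((γ 1 0 : ℂ) * conj (z : ℂ) + γ 1 1) := by
    rw [← Complex.mul_conj, h2]; simp
  rw [ell, h1, ell]
  push_cast
  rw [h3]
  simp only [zpow_neg_one]
  rw [div_eq_mul_inv, mul_inv]
  ring

theorem automorphy_ne_zero (γ : SL(2, ℤ)) (z : ℍ) : (γ 1 0 : ℂ) * z + γ 1 1 ≠ 0 := by
  have := denom_ne_zero γ z
  simpa [denom] using this

theorem automorphy_conj_ne_zero (γ : SL(2, ℤ)) (z : ℍ) :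
    (γ 1 0 : ℂ) * conj (z : ℂ) + γ 1 1 ≠ 0 := by
  have := (map_ne_zero (starRingEnd ℂ)).mpr (automorphy_ne_zero γ z)
  simpa using this

theorem ell_zpow_mul_mem_modularFns {r s : ℤ} (k : ℤ) {f : ℍ → ℂ} (hf : f ∈ modularFns r s) :
    (fun z => ell z ^ k * f z) ∈ modularFns (r - k) (s - k) := by
  refine ⟨(analyticOnNhd_toC_ell_zpow k).mul hf.1, fun γ z => ?_⟩
  change ell (γ • z) ^ k * f (γ • z) = _ * (ell z ^ k * f z)
  rw [hf.2 γ z, ell_smul, zpow_sub₀ (automorphy_ne_zero γ z), zpow_sub₀ (automorphy_conj_ne_zero γ z)]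
  simp only [mul_zpow, zpow_neg, zpow_one, inv_zpow]
  ring

theorem conj_mem_modularFns {r s : ℤ} {f : ℍ → ℂ} (hf : f ∈ modularFns r s) :
    (fun z => conj (f z)) ∈ modularFns s r := by
  refine ⟨fun w hw => (ContinuousLinearMap.analyticAt (Complex.conjCLE : ℂ →L[ℝ] ℂ) _).comp
    (hf.1 w hw), fun γ z => ?_⟩
  change conj (f (γ • z)) = _ * conj (f z)
  rw [hf.2 γ z]
  simp
  left; ring

theorem ell_zpow_mul_mem_PM {p r s : ℤ} (k : ℤ) {f : ℍ → ℂ} (hf : f ∈ PM p r s) :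
    (fun z => ell z ^ k * f z) ∈ PM (p + k) (r - k) (s - k) :=
  ⟨ell_zpow_mul_mem_modularFns k hf.1, ell_zpow_mul_mem_expansions k hf.2⟩

theorem conj_mem_PM {p r s : ℤ} {f : ℍ → ℂ} (hf : f ∈ PM p r s) :
    (fun z => conj (f z)) ∈ PM p s r :=
  ⟨conj_mem_modularFns hf.1, conj_mem_expansions hf.2⟩

theorem one_mem_PM : (1 : ℍ → ℂ) ∈ PM 0 0 0 := by
  refine ⟨⟨analyticOnNhd_const, by simp⟩, Submodule.subset_span ⟨0, le_rfl,
    Pi.single 0 1, fun z => ?_⟩⟩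
  have := hasSum_single (f := fun mn : ℕ × ℕ => ell z ^ (0 : ℤ) *
    ((Pi.single 0 1 : ℕ × ℕ → ℂ) mn * q z ^ mn.1 * conj (q z) ^ mn.2)) 0
    (fun b hb => by simp [hb])
  simpa using! this

theorem ell_zpow_mem_PM (k : ℤ) : (fun z => ell z ^ k) ∈ PM k (-k) (-k) := by
  simpa using! ell_zpow_mul_mem_PM k one_mem_PM

/-- The matrix `-1` fixes every point and has automorphy factor `(-1)^(r+s)`. -/
theorem eq_zero_of_odd {r s : ℤ} {f : ℍ → ℂ} (hf : f ∈ modularFns r s) (h : Odd (r + s)) :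
    f = 0 := by
  ext z
  have := hf.2 (-1) z
  simp at this
  have h2 : ((-1 : ℂ) ^ r * (-1) ^ s) = -1 := by
    rw [← zpow_add₀ (by norm_num)]; exact h.neg_one_zpow
  rw [h2] at this
  simp only [Pi.zero_apply]
  linear_combination this / 2

end ModIter
end

open scoped UpperHalfPlane MatrixGroups TensorProduct DirectSum ComplexConjugate

noncomputable section

namespace ModIter

open UpperHalfPlane Filter Topology

/-! ### Growth at the cusp -/

theorem norm_q (z : ℍ) : ‖q z‖ = Real.exp (-2 * Real.pi * z.im) := by
  rw [q, Complex.norm_exp]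
  congr 1
  simp

theorem norm_ell (z : ℍ) : ‖ell z‖ = 2 * Real.pi * z.im := by
  have := z.im_pos
  have := Real.pi_pos
  rw [ell, Complex.norm_real, Real.norm_eq_abs, abs_of_neg] <;> nlinarith [mul_pos this z.im_pos]

/-- The bound `t^n / n! ≤ e^t` with `t = 2πy` turns the product into `n! e^(2π)`, where `n = N +
|k|`. -/
theorem pow_mul_zpow_mul_exp_le (N : ℕ) (k : ℤ) : ∃ C, 0 ≤ C ∧ ∀ y : ℝ, 1 ≤ y →
    y ^ N * (2 * Real.pi * y) ^ k * Real.exp (-2 * Real.pi * (y - 1)) ≤ C := by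
  refine ⟨(N + k.natAbs).factorial * Real.exp (2 * Real.pi), by positivity, fun y hy => ?_⟩
  set t := 2 * Real.pi * y with ht
  have hpi := Real.two_le_pi
  have hyt : y ≤ t := by nlinarith
  have h1 : 1 ≤ t := hy.trans hyt
  have h2 : t ^ k ≤ t ^ k.natAbs := by
    rw [← zpow_natCast]; exact zpow_le_zpow_right₀ h1 Int.le_natAbs
  have h3 := Real.pow_div_factorial_le_exp (x := t) (by linarith) (N + k.natAbs)
  rw [div_le_iff₀ (by positivity)] at h3
  calc y ^ N * t ^ k * Real.exp (-2 * Real.pi * (y - 1))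
      ≤ t ^ N * t ^ k.natAbs * Real.exp (-2 * Real.pi * (y - 1)) := by gcongr
    _ = t ^ (N + k.natAbs) * Real.exp (-2 * Real.pi * (y - 1)) := by rw [pow_add]
    _ ≤ (Real.exp t * (N + k.natAbs).factorial) * Real.exp (-2 * Real.pi * (y - 1)) := by gcongr
    _ = (N + k.natAbs).factorial * (Real.exp t * Real.exp (-2 * Real.pi * (y - 1))) := by ring
    _ = _ := by rw [← Real.exp_add]; congr 2; rw [ht]; ring

/-- The term `(m, n) = (0, 0)` depends only on the height and cancels between points of one
horocycle. Apart from the power of `𝕃`, every other term is at most `exp(-2π(y - 1))` times its size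
at `i`, which beats any power of `y`. -/
theorem norm_sub_mul_pow_im_le {p : ℤ} {f : ℍ → ℂ} (hf : f ∈ expansions p) (N : ℕ) :
    ∃ C, ∀ z z' : ℍ, z.im = z'.im → 1 ≤ z.im → ‖f z - f z'‖ * z.im ^ N ≤ C := by
  induction hf using Submodule.span_induction with
  | mem f hf =>
    obtain ⟨k, -, a, ha⟩ := hf
    obtain ⟨D, hD0, hD⟩ := pow_mul_zpow_mul_exp_le N k
    set ρ := Real.exp (-2 * Real.pi) with hρ
    -- Absolute convergence at `z = i`, where `|q| = ρ`, dominates the series on all of `im z ≥ 1`.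
    have hs : Summable fun mn : ℕ × ℕ => ‖a mn‖ * ρ ^ (mn.1 + mn.2) := by
      have := (ha I).summable.norm
      have h2 : ‖ell I ^ k‖ ≠ 0 := norm_ne_zero_iff.mpr (zpow_ne_zero _ (ell_ne_zero _))
      rw [← summable_mul_left_iff h2]
      refine this.congr fun mn => ?_
      simp [norm_q, hρ, pow_add, mul_assoc]
    refine ⟨D * (2 * ∑' mn : ℕ × ℕ, ‖a mn‖ * ρ ^ (mn.1 + mn.2)), fun z z' h hz => ?_⟩
    have hq : ∀ z : ℍ, 1 ≤ z.im → ∀ mn : ℕ × ℕ, mn ≠ 0 →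
        ‖a mn * q z ^ mn.1 * conj (q z) ^ mn.2‖ ≤
          Real.exp (-2 * Real.pi * (z.im - 1)) * (‖a mn‖ * ρ ^ (mn.1 + mn.2)) := by
      intro z hz mn hmn
      have h1 : (1 : ℝ) ≤ (mn.1 + mn.2 : ℕ) := by
        norm_cast
        rcases mn with ⟨m, n⟩
        by_contra hcon
        exact hmn (by simp only [Prod.mk_eq_zero]; lia)
      have : ‖a mn * q z ^ mn.1 * conj (q z) ^ mn.2‖ =
          ‖a mn‖ * Real.exp (-2 * Real.pi * z.im * (mn.1 + mn.2 : ℕ)) := by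
        simp only [norm_mul, norm_pow, RCLike.norm_conj, norm_q]
        rw [mul_assoc, ← pow_add, ← Real.exp_nat_mul]; ring_nf
      rw [this, hρ, ← Real.exp_nat_mul, mul_left_comm, ← Real.exp_add]
      gcongr
      have := Real.pi_pos
      nlinarith [mul_nonneg (mul_nonneg this.le (sub_nonneg.mpr h1)) (sub_nonneg.mpr hz)]
    have hE : ell z = ell z' := by rw [ell, ell, h]
    have hsub := (ha z).sub (ha z')
    have hb : ‖f z - f z'‖ ≤ (2 * Real.pi * z.im) ^ k * Real.exp (-2 * Real.pi * (z.im - 1)) *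
        (2 * ∑' mn : ℕ × ℕ, ‖a mn‖ * ρ ^ (mn.1 + mn.2)) := by
      rw [← hsub.tsum_eq]
      refine tsum_of_norm_bounded ((hs.hasSum.mul_left 2).mul_left _) fun mn => ?_
      by_cases hmn : mn = 0
      · subst hmn
        have : 0 ≤ z.im := by linarith
        simp [hE]; positivity
      · rw [hE, ← mul_sub, norm_mul, norm_zpow, norm_ell, ← h, mul_assoc ((2 * Real.pi * z.im) ^ k)]
        have hz0 := z.im_pos
        refine mul_le_mul_of_nonneg_left ?_ (by positivity)
        refine (norm_sub_le _ _).trans ?_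
        have e1 := hq z hz mn hmn
        have e2 := hq z' (h ▸ hz) mn hmn
        rw [← h] at e2
        linarith
    calc ‖f z - f z'‖ * z.im ^ N ≤ _ := mul_le_mul_of_nonneg_right hb (by positivity)
      _ = (z.im ^ N * (2 * Real.pi * z.im) ^ k * Real.exp (-2 * Real.pi * (z.im - 1))) *
        (2 * ∑' mn : ℕ × ℕ, ‖a mn‖ * ρ ^ (mn.1 + mn.2)) := by ring
      _ ≤ _ := mul_le_mul_of_nonneg_right (hD _ hz)
        (mul_nonneg zero_le_two (tsum_nonneg fun _ => by positivity))
  | zero => exact ⟨0, by simp⟩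
  | add f g _ _ hf hg =>
    obtain ⟨C, hC⟩ := hf
    obtain ⟨D, hD⟩ := hg
    refine ⟨C + D, fun z z' h hz => ?_⟩
    have h1 : ‖(f + g) z - (f + g) z'‖ ≤ ‖f z - f z'‖ + ‖g z - g z'‖ := by
      rw [Pi.add_apply, Pi.add_apply, add_sub_add_comm]; exact norm_add_le _ _
    have : 0 ≤ z.im ^ N := by have := z.im_pos; positivity
    nlinarith [hC z z' h hz, hD z z' h hz, mul_le_mul_of_nonneg_right h1 this]
  | smul c f _ hf =>
    obtain ⟨C, hC⟩ := hf
    refine ⟨‖c‖ * C, fun z z' h hz => ?_⟩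
    rw [Pi.smul_apply, Pi.smul_apply, ← smul_sub, norm_smul, mul_assoc]
    gcongr
    exact hC z z' h hz

/-! ### Averages over horocycles -/

-- Green's formula on the rectangle with corners `i` and `1 + yi`: the vertical sides cancel by
-- periodicity, and the area integral of `2i ∂f/∂z̄` vanishes when it is taken along horizontal
-- segments first.
open MeasureTheory in
theorem intervalIntegral_horizontal_eq {f : ℂ → ℂ}
    (hd : ∀ w : ℂ, 0 < w.im → DifferentiableAt ℝ f w)
    (hc : ContinuousOn (fun w => Complex.I * fderiv ℝ f w 1 - fderiv ℝ f w Complex.I)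
      {w : ℂ | 0 < w.im})
    (hper : ∀ w : ℂ, 0 < w.im → f (w + 1) = f w)
    (h0 : ∀ y : ℝ, 0 < y → ∫ x in (0 : ℝ)..1, (Complex.I * fderiv ℝ f (x + y * Complex.I) 1 -
      fderiv ℝ f (x + y * Complex.I) Complex.I) = 0) {y : ℝ} (hy : 1 ≤ y) :
    ∫ x in (0 : ℝ)..1, f (x + y * Complex.I) = ∫ x in (0 : ℝ)..1, f (x + Complex.I) := by
  have hsub : Set.uIcc (Complex.I).re (1 + y * Complex.I : ℂ).re ×ℂ
      Set.uIcc (Complex.I).im (1 + y * Complex.I : ℂ).im ⊆ {w : ℂ | 0 < w.im} := by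
    intro w hw
    have := hw.2
    simp [Set.uIcc_of_le hy] at this
    exact zero_lt_one.trans_le this.1
  have hcpt : IsCompact (Set.uIcc (Complex.I).re (1 + y * Complex.I : ℂ).re ×ℂ
      Set.uIcc (Complex.I).im (1 + y * Complex.I : ℂ).im) :=
    isCompact_uIcc.reProdIm isCompact_uIcc
  have key := Complex.integral_boundary_rect_of_differentiableOn_real f Complex.I
    (1 + y * Complex.I) (fun w hw => (hd w (hsub hw)).differentiableWithinAt)
    ((hc.mono hsub).integrableOn_compact hcpt)
  simp only [Complex.I_re, Complex.add_re, Complex.one_re, Complex.mul_re, Complex.ofReal_re,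
    Complex.ofReal_im, Complex.I_im, Complex.add_im, Complex.one_im, Complex.mul_im, smul_eq_mul,
    mul_zero, mul_one, sub_zero, add_zero, zero_add, Complex.ofReal_one,
    Complex.ofReal_zero, one_mul] at key
  have hside : ∫ t in (1 : ℝ)..y, f (1 + t * Complex.I) = ∫ t in (1 : ℝ)..y, f (t * Complex.I) := by
    refine intervalIntegral.integral_congr fun t ht => ?_
    rw [Set.uIcc_of_le hy] at ht
    have := hper (t * Complex.I) (by simp; linarith [ht.1])
    rw [← this, add_comm]
  have hright : ∫ x in (0 : ℝ)..1, ∫ t in (1 : ℝ)..y, (Complex.I * fderiv ℝ f (x + t * Complex.I) 1 -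
      fderiv ℝ f (x + t * Complex.I) Complex.I) = 0 := by
    have hcont : ContinuousOn (Function.uncurry fun x t : ℝ =>
        Complex.I * fderiv ℝ f (x + t * Complex.I) 1 - fderiv ℝ f (x + t * Complex.I) Complex.I)
        (Set.Icc 0 1 ×ˢ Set.Icc 1 y) := by
      refine hc.comp (f := fun p : ℝ × ℝ => (p.1 + p.2 * Complex.I : ℂ)) (by fun_prop) ?_
      rintro ⟨x, t⟩ ⟨-, ht⟩
      simp; linarith [ht.1]
    have hint := hcont.integrableOn_compact (μ := volume.prod volume)
      (isCompact_Icc.prod isCompact_Icc)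
    rw [intervalIntegral_intervalIntegral_swap]
    · rw [intervalIntegral.integral_congr (g := fun _ => (0 : ℂ))]
      · simp
      · intro t ht
        rw [Set.uIcc_of_le hy] at ht
        exact h0 t (by linarith [ht.1])
    · rw [Set.uIoc_of_le zero_le_one, Set.uIoc_of_le hy]
      exact hint.mono_set (Set.prod_mono Set.Ioc_subset_Icc_self Set.Ioc_subset_Icc_self)
  rw [hside, hright] at key
  linear_combination -key

end ModIter
end

open scoped UpperHalfPlane MatrixGroups TensorProduct DirectSum ComplexConjugate

noncomputable section

namespace ModIter

open UpperHalfPlane Filter Topology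

/-! ### Boundedness at the cusp of primitives of forms without constant term -/

theorem toC_add_one {r s : ℤ} {f : ℍ → ℂ} (hf : f ∈ modularFns r s) {w : ℂ} (hw : 0 < w.im) :
    toC f (w + 1) = toC f w := by
  have hw' : 0 < (w + 1).im := by simpa using hw
  rw [toC_of_im_pos f hw, toC_of_im_pos f hw']
  have h := hf.2 ModularGroup.T ⟨w, hw⟩
  have h2 : ModularGroup.T • (⟨w, hw⟩ : ℍ) = ⟨w + 1, hw'⟩ := by
    rw [modular_T_smul]
    ext
    simp [add_comm]
  rw [h2] at h
  simpa [ModularGroup.coe_T] using h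

theorem fderiv_conj_comp (f : ℂ → ℂ) (w v : ℂ) :
    fderiv ℝ (fun w => conj (f w)) w v = conj (fderiv ℝ f w v) := by
  have : fderiv ℝ (fun w => conj (f w)) w
      = (Complex.conjCLE : ℂ →L[ℝ] ℂ).comp (fderiv ℝ f w) :=
    ContinuousLinearEquiv.comp_fderiv Complex.conjCLE
  rw [this]; simp

/-- Multiplication by `𝕃 ^ w` brings the first weight to zero, where the operator is just `(z - z̄)
∂/∂z = 𝕃/(iπ) ∂/∂z`. -/
theorem dz_ell_zpow_mul {w : ℤ} {ψ g : ℍ → ℂ} (hψ : ∀ z : ℍ, DifferentiableAt ℝ (toC ψ) (z : ℂ))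
    (h : maass w ψ = fun z => ell z * g z) (z : ℍ) :
    dz (fun z => ell z ^ w * ψ z) z = Complex.I * Real.pi * (ell z ^ w * g z) := by
  have h1 := congrFun (maass_ell_zpow_mul (r := w) (k := w) hψ) z
  rw [h] at h1
  simp only [maass, sub_self, Int.cast_zero, zero_mul, add_zero, sub_conj_eq] at h1
  have hpi : (Real.pi : ℂ) ≠ 0 := by exact_mod_cast Real.pi_ne_zero
  have := ell_ne_zero z
  field_simp at h1
  linear_combination h1

theorem intervalIntegral_modularForm_eq_zero {k : ℤ} (g : ModularForm 𝒮ℒ k)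
    (hg : (qExpansion 1 g).coeff 0 = 0) {y : ℝ} (hy : 0 < y) :
    ∫ x in (0 : ℝ)..1, toC g (x + y * Complex.I) = 0 := by
  have h := ModularFormClass.qExpansion_coeff_eq_intervalIntegral g one_pos
    one_mem_strictPeriods_SL 0 hy
  rw [hg] at h
  simp only [pow_zero, div_one, one_mul, Complex.ofReal_one] at h
  rw [h]
  refine intervalIntegral.integral_congr fun x _ => ?_
  exact toC_of_im_pos _ _

/-- Averaging `∂u/∂z = iπ 𝕃^w g` over a horocycle gives zero, so the mean of `u = 𝕃^w ψ` does not
depend on the height; and `u` stays at bounded distance from its mean. This excludes the positive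
powers of `𝕃` that the expansion alone would allow. -/
theorem exists_norm_ell_pow_mul_le {p : ℤ} {w : ℕ} {ψ : ℍ → ℂ} (hψ : ψ ∈ PM p w 0) {k : ℤ}
    (g : ModularForm 𝒮ℒ k) (hg : (qExpansion 1 g).coeff 0 = 0)
    (h : maass w ψ = fun z => ell z * g z) :
    ∃ C, ∀ z : ℍ, 1 ≤ z.im → ‖ell z ^ w * ψ z‖ ≤ C := by
  set u : ℍ → ℂ := fun z => ell z ^ (w : ℤ) * ψ z with hu
  have huPM := ell_zpow_mul_mem_PM w hψ
  rw [← hu] at huPM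
  have hdz : ∀ z, dz u z = Complex.I * Real.pi * (ell z ^ (w : ℤ) * g z) :=
    dz_ell_zpow_mul (toC_differentiableAt hψ.1) h
  -- Green's formula involves `∂/∂z̄`, while `∂u/∂z` is the known derivative; hence the passage to
  -- the conjugate of `u`.
  have hcomb : ∀ v : ℂ, 0 < v.im → Complex.I * fderiv ℝ (fun v => conj (toC u v)) v 1 -
      fderiv ℝ (fun v => conj (toC u v)) v Complex.I =
      2 * Real.pi * conj (toC ell v ^ w * toC g v) := by
    intro v hv
    have := hdz ⟨v, hv⟩
    simp only [dz] at this
    rw [fderiv_conj_comp, fderiv_conj_comp, toC_of_im_pos _ hv, toC_of_im_pos _ hv]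
    rw [div_eq_iff two_ne_zero] at this
    have h2 := congrArg conj this
    simp only [map_sub, map_mul, Complex.conj_I, Complex.conj_ofReal, map_ofNat, zpow_natCast] at h2
    rw [map_mul]
    linear_combination (exp := 1) Complex.I * h2 + ((starRingEnd ℂ)
      ((fderiv ℝ (toC u) v) Complex.I) + 2 * Real.pi * ((starRingEnd ℂ) (ell ⟨v, hv⟩ ^ w) *
      (starRingEnd ℂ) (g ⟨v, hv⟩))) * (-Complex.I_sq)
  have hdiff : ∀ v : ℂ, 0 < v.im → DifferentiableAt ℝ (toC u) v :=
    fun v hv => (huPM.1.1 v hv).differentiableAt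
  have hcst := fun (y : ℝ) (hy : 1 ≤ y) => intervalIntegral_horizontal_eq
    (f := fun v => conj (toC u v)) (y := y)
    (fun v hv => (Complex.conjCLE.differentiableAt).comp v (hdiff v hv)) (by
      have : ContinuousOn (fderiv ℝ (toC u)) {v : ℂ | 0 < v.im} := huPM.1.1.fderiv.continuousOn
      simp only [fderiv_conj_comp]
      have hc := Complex.continuous_conj
      have h1 : ContinuousOn (fun v => fderiv ℝ (toC u) v 1) {v : ℂ | 0 < v.im} :=
        this.clm_apply continuousOn_const
      have h2 : ContinuousOn (fun v => fderiv ℝ (toC u) v Complex.I) {v : ℂ | 0 < v.im} :=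
        this.clm_apply continuousOn_const
      exact (continuousOn_const.mul (hc.comp_continuousOn h1)).sub (hc.comp_continuousOn h2))
    (fun v hv => by rw [toC_add_one huPM.1 hv]) (fun y hy => by
      have h1 : ∀ x : ℝ, 0 < (x + y * Complex.I : ℂ).im := fun x => by simpa using hy
      rw [intervalIntegral.integral_congr (g := fun x : ℝ => 2 * Real.pi *
        conj (((-2 * Real.pi * y : ℝ) : ℂ) ^ w) * conj (toC g (x + y * Complex.I)))]
      · rw [intervalIntegral.integral_const_mul, intervalIntegral.integral_of_le zero_le_one,
          integral_conj, ← intervalIntegral.integral_of_le zero_le_one,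
          intervalIntegral_modularForm_eq_zero g hg hy]
        simp
      · intro x _
        simp only
        have hell : toC ell (x + y * Complex.I) = ((-2 * Real.pi * y : ℝ) : ℂ) := by
          rw [toC_of_im_pos ell (h1 x), ell, ← coe_im]
          simp
        rw [hcomb _ (h1 x), hell, map_mul]; ring) hy
  obtain ⟨C, hC⟩ := norm_sub_mul_pow_im_le huPM.2 0
  refine ⟨‖∫ x in (0 : ℝ)..1, conj (toC u (x + Complex.I))‖ + C, fun z hz => ?_⟩
  have hbd : ‖(∫ x in (0 : ℝ)..1, conj (toC u (x + z.im * Complex.I))) - conj (u z)‖ ≤ C := by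
    have h1 : ∀ x : ℝ, 0 < (x + z.im * Complex.I : ℂ).im := fun x => by simpa using z.im_pos
    have : (∫ x in (0 : ℝ)..1, conj (toC u (x + z.im * Complex.I))) - conj (u z) =
        ∫ x in (0 : ℝ)..1, (conj (toC u (x + z.im * Complex.I)) - conj (u z)) := by
      rw [intervalIntegral.integral_sub _ (by simp)]
      · simp
      · refine Continuous.intervalIntegrable ?_ _ _
        refine Complex.continuous_conj.comp (continuous_iff_continuousAt.mpr fun x => ?_)
        exact ContinuousAt.comp (f := fun x : ℝ => (x + z.im * Complex.I : ℂ))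
          (hdiff _ (h1 x)).continuousAt (by fun_prop)
    rw [this]
    have hle := intervalIntegral.norm_integral_le_of_norm_le_const (a := 0) (b := 1) (C := C)
      (f := fun x : ℝ => conj (toC u (x + z.im * Complex.I)) - conj (u z)) (fun x _ => by
        rw [← map_sub, RCLike.norm_conj, norm_sub_rev, toC_of_im_pos _ (h1 x)]
        simpa using hC z ⟨_, h1 x⟩ (by rw [← coe_im ⟨_, h1 x⟩]; simp) hz)
    simpa using hle
  rw [hcst _ hz] at hbd
  have h3 : ‖ell z ^ w * ψ z‖ = ‖conj (u z)‖ := by simp [hu]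
  rw [h3]
  have := norm_sub_norm_le (conj (u z)) (∫ x in (0 : ℝ)..1, conj (toC u (x + Complex.I)))
  rw [norm_sub_rev] at hbd
  linarith

end ModIter
end

open scoped UpperHalfPlane MatrixGroups TensorProduct DirectSum ComplexConjugate

noncomputable section

namespace ModIter

open UpperHalfPlane Filter Topology

/-! ### A maximum principle -/

/-- Were `c` positive, the point would also be a local minimum; `F` would be locally constant and
its second derivative zero. -/
theorem deriv_eq_zero_and_second_deriv_nonpos {F F' : ℝ → ℝ} {c : ℝ}
    (hF : ∀ᶠ t in 𝓝 (0 : ℝ), HasDerivAt F (F' t) t) (hF' : HasDerivAt F' c 0)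
    (hmax : IsLocalMax F 0) : F' 0 = 0 ∧ c ≤ 0 := by
  have h0 : F' 0 = 0 := hmax.hasDerivAt_eq_zero hF.self_of_nhds
  refine ⟨h0, ?_⟩
  by_contra! hc
  have hd : deriv F =ᶠ[𝓝 0] F' := hF.mono fun t ht => ht.deriv
  have hdd : deriv (deriv F) 0 = c := by rw [hd.deriv_eq, hF'.deriv]
  have hmin : IsLocalMin F 0 := isLocalMin_of_deriv_deriv_pos (by rw [hdd]; exact hc)
    (by rw [hd.self_of_nhds, h0]) hF.self_of_nhds.continuousAt
  have hconst : F =ᶠ[𝓝 0] fun _ => F 0 := by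
    filter_upwards [hmax, hmin] with t h1 h2 using le_antisymm h1 h2
  have h1 : deriv F =ᶠ[𝓝 0] fun _ => 0 := by
    simpa using! hconst.deriv
  have : deriv (deriv F) 0 = 0 := by rw [h1.deriv_eq]; simp
  linarith

/-- With `M` the value of the quotient at `z`, the function `|U|² - M y^n` also has a local maximum
there. Put `c = n/y`. The first-order conditions and the equation for `U` turn the trace of its
Hessian into `½|2U_x - icU|² + ½|2U_y - cU|² + (c/y)|U|²`, which must be nonpositive; so `U z = 0`.
-/
theorem im_eq_zero_of_isLocalMax {U : ℂ → ℂ} {n : ℕ} {z : ℂ} (hn : 1 ≤ n)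
    (hz : 0 < z.im) (hU : AnalyticAt ℝ U z)
    (hΔ : fderiv ℝ (fderiv ℝ U) z 1 1 + fderiv ℝ (fderiv ℝ U) z Complex.I Complex.I =
      (n / z.im : ℝ) * (Complex.I * fderiv ℝ U z 1 + fderiv ℝ U z Complex.I))
    (hmax : IsLocalMax (fun w => ‖U w‖ ^ 2 / w.im ^ n) z) : U z = 0 := by
  set M := ‖U z‖ ^ 2 / z.im ^ n with hM
  have hK : IsLocalMax (fun w => ‖U w‖ ^ 2 - M * w.im ^ n) z := by
    filter_upwards [hmax, (isOpen_lt continuous_const Complex.continuous_im).mem_nhds hz]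
      with w hw (hw' : 0 < w.im)
    rw [div_le_iff₀ (by positivity)] at hw
    rw [hM, div_mul_cancel₀ _ (by positivity), sub_self]
    linarith
  have hev : ∀ᶠ w in 𝓝 z, AnalyticAt ℝ U w := hU.eventually_analyticAt
  have hline : ∀ (v : ℂ), Tendsto (fun t : ℝ => z + t * v) (𝓝 0) (𝓝 z) := fun v => by
    have : Continuous fun t : ℝ => z + t * v := by fun_prop
    simpa using this.tendsto 0
  have hlineD : ∀ (v : ℂ) (t : ℝ), HasDerivAt (fun t : ℝ => z + t * v) v t := fun v t => by
    simpa using ((hasDerivAt_id t).ofReal_comp.mul_const v).const_add z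
  have key : ∀ v : ℂ,
      2 * inner ℝ (U z) (fderiv ℝ U z v) - M * (n * z.im ^ (n - 1) * v.im) = 0 ∧
      2 * (inner ℝ (U z) (fderiv ℝ (fderiv ℝ U) z v v) +
        inner ℝ (fderiv ℝ U z v) (fderiv ℝ U z v)) -
        M * (n * ((n - 1 : ℕ) * z.im ^ (n - 1 - 1) * v.im) * v.im) ≤ 0 := by
    intro v
    have h1 : ∀ᶠ t : ℝ in 𝓝 0, HasDerivAt
        (fun t : ℝ => ‖U (z + t * v)‖ ^ 2 - M * (z + t * v).im ^ n)
        (2 * inner ℝ (U (z + t * v)) (fderiv ℝ U (z + t * v) v) -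
          M * (n * (z + t * v).im ^ (n - 1) * v.im)) t := by
      filter_upwards [(hline v).eventually hev] with t ht
      have hU1 := (ht.differentiableAt.hasFDerivAt.comp_hasDerivAt t (hlineD v t)).norm_sq
      have h2 : HasDerivAt (fun t : ℝ => (z + t * v).im) v.im t :=
        Complex.imCLM.hasFDerivAt.comp_hasDerivAt t (hlineD v t)
      exact hU1.sub ((h2.fun_pow n).const_mul M)
    have h2 : HasDerivAt (fun t : ℝ => 2 * inner ℝ (U (z + t * v)) (fderiv ℝ U (z + t * v) v) -
          M * (n * (z + t * v).im ^ (n - 1) * v.im))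
        (2 * (inner ℝ (U z) (fderiv ℝ (fderiv ℝ U) z v v) +
        inner ℝ (fderiv ℝ U z v) (fderiv ℝ U z v)) -
        M * (n * ((n - 1 : ℕ) * z.im ^ (n - 1 - 1) * v.im) * v.im)) 0 := by
      have hU0 : HasDerivAt (fun t : ℝ => U (z + t * v)) (fderiv ℝ U z v) 0 :=
        hU.differentiableAt.hasFDerivAt.comp_hasDerivAt_of_eq 0 (hlineD v 0) (by simp)
      have hU1 : HasDerivAt (fun t : ℝ => fderiv ℝ U (z + t * v) v)
          (fderiv ℝ (fderiv ℝ U) z v v) 0 := by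
        have := hU.fderiv.differentiableAt.hasFDerivAt.comp_hasDerivAt_of_eq 0 (hlineD v 0)
          (by simp)
        simpa using! this.clm_apply (hasDerivAt_const (0 : ℝ) v)
      have h2 : HasDerivAt (fun t : ℝ => (z + t * v).im) v.im 0 :=
        Complex.imCLM.hasFDerivAt.comp_hasDerivAt 0 (hlineD v 0)
      have h3 := ((hU0.inner ℝ hU1).const_mul 2).sub
        ((((h2.fun_pow (n - 1)).const_mul (n : ℝ)).mul_const v.im).const_mul M)
      simpa using! h3
    have h3 : IsLocalMax (fun t : ℝ => ‖U (z + t * v)‖ ^ 2 - M * (z + t * v).im ^ n) 0 := by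
      have h4 := (hline v).eventually hK
      filter_upwards [h4] with t ht
      simpa using ht
    simpa using deriv_eq_zero_and_second_deriv_nonpos h1 h2 h3
  obtain ⟨hx1, hx2⟩ := key 1
  obtain ⟨hy1, hy2⟩ := key Complex.I
  set y := z.im with hy
  set c : ℝ := n / y with hc
  have hc0 : 0 < c := by positivity
  have e1 : M * (n * y ^ (n - 1)) = c * ‖U z‖ ^ 2 := by
    obtain ⟨m, rfl⟩ : ∃ m, n = m + 1 := ⟨n - 1, by lia⟩
    rw [hM, hc, Nat.add_sub_cancel]
    field_simp
    ring
  have e2 : M * (n * ((n - 1 : ℕ) * y ^ (n - 1 - 1))) = (c ^ 2 - c / y) * ‖U z‖ ^ 2 := by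
    obtain ⟨m, rfl⟩ : ∃ m, n = m + 1 := ⟨n - 1, by lia⟩
    -- For `n = 1` the exponent `n - 1 - 1` truncates to `0`, but its coefficient `n - 1` vanishes.
    rcases m with _ | m
    · rw [hM, hc]; simp; left; field_simp; ring
    · rw [hM, hc, Nat.add_sub_cancel, Nat.add_sub_cancel, pow_succ, pow_succ]
      field_simp
      push_cast
      ring
  have hΔre := congrArg Complex.re hΔ
  have hΔim := congrArg Complex.im hΔ
  have nsq : ‖U z‖ ^ 2 = (U z).re ^ 2 + (U z).im ^ 2 := by
    rw [← Complex.normSq_eq_norm_sq, Complex.normSq_apply]; ring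
  simp only [Complex.one_im, Complex.I_im, mul_one, mul_zero, sub_zero, e1, e2, nsq,
    Complex.inner, Complex.mul_re, Complex.conj_re, Complex.conj_im] at hx1 hx2 hy1 hy2
  simp only [Complex.add_re, Complex.add_im, Complex.mul_re, Complex.mul_im, Complex.I_re,
    Complex.I_im, Complex.ofReal_re, Complex.ofReal_im, zero_mul, one_mul, zero_sub, sub_zero,
    zero_add, add_zero] at hΔre hΔim
  generalize (U z).re = a at *
  generalize (U z).im = b at *
  generalize (fderiv ℝ U z 1).re = ax at *
  generalize (fderiv ℝ U z 1).im = bx at *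
  generalize (fderiv ℝ U z Complex.I).re = ay at *
  generalize (fderiv ℝ U z Complex.I).im = bY at *
  generalize (fderiv ℝ (fderiv ℝ U) z 1 1).re = axx at *
  generalize (fderiv ℝ (fderiv ℝ U) z 1 1).im = bxx at *
  generalize (fderiv ℝ (fderiv ℝ U) z Complex.I Complex.I).re = ayy at *
  generalize (fderiv ℝ (fderiv ℝ U) z Complex.I Complex.I).im = byy at *
  have hfin : c / y * (a ^ 2 + b ^ 2) ≤ 0 := by
    -- The four squares are those of the real and imaginary parts of `2U_x - icU` and `2U_y - cU`.
    have s1 := sq_nonneg (2 * ax + c * b)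
    have s2 := sq_nonneg (2 * bx - c * a)
    have s3 := sq_nonneg (2 * ay - c * a)
    have s4 := sq_nonneg (2 * bY - c * b)
    have d1 : a * (axx + ayy) = a * (c * (-bx + ay)) := by rw [hΔre]
    have d2 : b * (bxx + byy) = b * (c * (ax + bY)) := by rw [hΔim]
    have d3 : c * (2 * (ay * a + bY * b)) = c * (c * (a ^ 2 + b ^ 2)) := by
      congr 1; linarith
    nlinarith
  have hpos : 0 < c / y := by positivity
  have : a ^ 2 + b ^ 2 ≤ 0 := by
    by_contra! h
    nlinarith [mul_pos hpos h]
  rw [this.antisymm (by positivity)] at nsq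
  simpa using nsq

end ModIter
end

open scoped UpperHalfPlane MatrixGroups TensorProduct DirectSum ComplexConjugate

noncomputable section

namespace ModIter

open UpperHalfPlane Filter Topology

/-! ### Forms vanishing at the cusp have no nonzero primitives -/

theorem differentiableAt_toC_modularForm {k : ℤ} (g : ModularForm 𝒮ℒ k) (z : ℍ) :
    DifferentiableAt ℂ (toC g) (z : ℂ) :=
  (UpperHalfPlane.mdifferentiable_iff.mp (ModularFormClass.holo g)).differentiableAt
    (isOpen_im_pos.mem_nhds z.im_pos)

theorem dzbar_eq_zero {f : ℍ → ℂ} {z : ℍ} (hf : DifferentiableAt ℂ (toC f) (z : ℂ)) :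
    dzbar f z = 0 := by
  have h : fderiv ℝ (toC f) (z : ℂ) = (fderiv ℂ (toC f) (z : ℂ)).restrictScalars ℝ :=
    (hf.hasFDerivAt.restrictScalars ℝ).fderiv
  have h2 : fderiv ℂ (toC f) (z : ℂ) Complex.I = Complex.I * fderiv ℂ (toC f) (z : ℂ) 1 := by
    rw [← smul_eq_mul, ← map_smul]; simp
  rw [dzbar, h]
  simp only [ContinuousLinearMap.coe_restrictScalars', h2]
  linear_combination (fderiv ℂ (toC f) (z : ℂ) 1) / 2 * Complex.I_sq

theorem differentiableAt_toC_conj {f : ℍ → ℂ} {z : ℍ} (hf : DifferentiableAt ℝ (toC f) (z : ℂ)) :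
    DifferentiableAt ℝ (toC fun z => conj (f z)) (z : ℂ) :=
  Complex.conjCLE.differentiableAt.comp (z : ℂ) hf

theorem dzbar_ell_pow_mul {n : ℕ} {g : ℍ → ℂ} {z : ℍ}
    (hg : DifferentiableAt ℂ (toC g) (z : ℂ)) :
    dzbar (fun z => ell z ^ n * g z) z =
      -(n * ell z ^ ((n : ℤ) - 1) * (Complex.I * Real.pi)) * g z := by
  rw [dzbar_eq_conj]
  have h1 : (fun z => conj (ell z ^ n * g z)) = fun z => ell z ^ (n : ℤ) * conj (g z) := by
    ext z; simp [conj_ell]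
  have h2 : dz (fun z => conj (g z)) z = 0 := by
    have := dzbar_eq_conj g z
    rw [dzbar_eq_zero hg] at this
    exact (map_eq_zero _).mp this.symm
  rw [h1, dz_mul ((analyticOnNhd_toC_ell_zpow n) z z.im_pos).differentiableAt
    (differentiableAt_toC_conj (hg.restrictScalars ℝ)), h2, dz_ell_zpow]
  simp [conj_ell]

/-- Apply `4 ∂/∂z̄` to the first-order equation. As `g` is holomorphic, only `𝕃 ^ n` is
differentiated, and the result is again a multiple of `𝕃 ^ (n-1) g`, hence of `𝕃⁻¹ ∂u/∂z`. This
eliminates `g`. -/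
theorem laplacian_eq {u g : ℍ → ℂ} {n : ℕ}
    (hu : AnalyticOnNhd ℝ (toC u) {w : ℂ | 0 < w.im})
    (hg : ∀ z : ℍ, DifferentiableAt ℂ (toC g) (z : ℂ))
    (h : ∀ z, dz u z = Complex.I * Real.pi * (ell z ^ n * g z)) (z : ℍ) :
    fderiv ℝ (fderiv ℝ (toC u)) z 1 1 + fderiv ℝ (fderiv ℝ (toC u)) z Complex.I Complex.I =
      (n / z.im : ℝ) * (Complex.I * fderiv ℝ (toC u) z 1 + fderiv ℝ (toC u) z Complex.I) := by
  set U := toC u with hU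
  set v : ℍ → ℂ := fun z => ell z ^ n * g z with hv
  have hUz := hu z z.im_pos
  have hsymm : fderiv ℝ (fderiv ℝ U) (z : ℂ) 1 Complex.I =
      fderiv ℝ (fderiv ℝ U) (z : ℂ) Complex.I 1 :=
    (hUz.contDiffAt (n := 2)).isSymmSndFDerivAt (by simp) 1 Complex.I
  have hD : HasFDerivAt (fderiv ℝ U) (fderiv ℝ (fderiv ℝ U) (z : ℂ)) (z : ℂ) :=
    hUz.fderiv.differentiableAt.hasFDerivAt
  have heq : (fun w => fderiv ℝ U w 1 - Complex.I * fderiv ℝ U w Complex.I) =ᶠ[𝓝 (z : ℂ)]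
      fun w => (2 * Complex.I * Real.pi) * toC v w := by
    filter_upwards [isOpen_im_pos.mem_nhds z.im_pos] with w hw
    have := h ⟨w, hw⟩
    rw [dz, div_eq_iff two_ne_zero] at this
    rw [toC_of_im_pos v hw]
    linear_combination this
  have h1 : HasFDerivAt (fun w => fderiv ℝ U w 1 - Complex.I * fderiv ℝ U w Complex.I)
      ((fderiv ℝ (fderiv ℝ U) (z : ℂ)).flip 1 -
        Complex.I • (fderiv ℝ (fderiv ℝ U) (z : ℂ)).flip Complex.I) (z : ℂ) := by
    have e1 := hD.clm_apply (hasFDerivAt_const (1 : ℂ) (z : ℂ))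
    have e2 := (hD.clm_apply (hasFDerivAt_const Complex.I (z : ℂ))).const_mul Complex.I
    simpa using! e1.sub e2
  have hvd : DifferentiableAt ℝ (toC v) (z : ℂ) := by
    have : DifferentiableAt ℝ (toC fun z => ell z ^ (n : ℤ) * g z) (z : ℂ) :=
      ((analyticOnNhd_toC_ell_zpow n) z z.im_pos).differentiableAt.mul
        ((hg z).restrictScalars ℝ)
    simpa using! this
  have h2 := (hvd.hasFDerivAt.const_mul (2 * Complex.I * Real.pi)).congr_of_eventuallyEq heq
  have h3 := h1.unique h2
  have hx := congrArg (fun L => L 1) h3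
  have hy := congrArg (fun L => L Complex.I) h3
  simp at hx hy
  have hbar := dzbar_ell_pow_mul (n := n) (hg z)
  rw [← hv, dzbar, div_eq_iff two_ne_zero] at hbar
  have hz := heq.self_of_nhds
  simp only [toC_coe] at hz
  have hy0 : (z.im : ℂ) ≠ 0 := by exact_mod_cast z.im_pos.ne'
  have hpi : (Real.pi : ℂ) ≠ 0 := by exact_mod_cast Real.pi_ne_zero
  have hell : ell z ^ n = ell z ^ ((n : ℤ) - 1) * (-2 * Real.pi * z.im) := by
    rw [zpow_sub_one₀ (ell_ne_zero z), zpow_natCast, mul_assoc]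
    have : (-2 * Real.pi * z.im : ℂ) = ell z := by simp [ell]
    rw [this, inv_mul_cancel₀ (ell_ne_zero z), mul_one]
  have hlap : fderiv ℝ (fderiv ℝ U) (z : ℂ) 1 1 + fderiv ℝ (fderiv ℝ U) (z : ℂ) Complex.I Complex.I =
      2 * Complex.I * Real.pi * (-(n * ell z ^ ((n : ℤ) - 1) * (Complex.I * Real.pi)) * g z * 2) := by
    rw [← hbar]
    linear_combination hx + Complex.I * hy + Complex.I * hsymm +
      fderiv ℝ (fderiv ℝ U) (z : ℂ) Complex.I Complex.I * Complex.I_sq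
  rw [hlap]
  have hrhs : Complex.I * fderiv ℝ U z 1 + fderiv ℝ U z Complex.I =
      Complex.I * (2 * Complex.I * Real.pi * v z) := by
    rw [← hz]
    linear_combination fderiv ℝ U z Complex.I * Complex.I_sq
  rw [hrhs, hv]
  simp only [hell]
  push_cast
  field_simp

/-- Numerator and denominator are both multiplied by `|cz + d|^(-2w)`. -/
theorem norm_sq_div_smul {w : ℕ} {u : ℍ → ℂ} (hu : u ∈ modularFns 0 (-w)) (γ : SL(2, ℤ)) (z : ℍ) :
    ‖u (γ • z)‖ ^ 2 / ‖ell (γ • z)‖ ^ w = ‖u z‖ ^ 2 / ‖ell z‖ ^ w := by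
  rw [hu.2 γ z, ell_smul]
  have hc : ‖(γ 1 0 : ℂ) * conj (z : ℂ) + γ 1 1‖ = ‖(γ 1 0 : ℂ) * z + γ 1 1‖ := by
    rw [← RCLike.norm_conj]; simp
  have h0 : ‖(γ 1 0 : ℂ) * z + γ 1 1‖ ≠ 0 := norm_ne_zero_iff.mpr (automorphy_ne_zero γ z)
  have h1 : ‖ell z‖ ≠ 0 := norm_ne_zero_iff.mpr (ell_ne_zero z)
  simp only [norm_mul, norm_inv, norm_pow, hc, zpow_zero, one_mul, zpow_neg, zpow_natCast,
    zpow_one]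
  field_simp
  rw [div_pow]
  field_simp
  rw [← pow_mul, ← pow_mul, mul_comm w 2]

/-- The function `H = |u|² / y^w` is invariant and tends to zero at the cusp, because `u` is bounded
there and `w ≥ 1`. If `u` were nonzero, `H` would have a positive global maximum, against the
maximum principle. -/
theorem eq_zero_of_maass_eq {p : ℤ} {w : ℕ} (hw : 1 ≤ w) {ψ : ℍ → ℂ} (hψ : ψ ∈ PM p w 0) {k : ℤ}
    (g : ModularForm 𝒮ℒ k) (hg : (qExpansion 1 g).coeff 0 = 0)
    (h : maass w ψ = fun z => ell z * g z) : ψ = 0 := by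
  obtain ⟨C, hC⟩ := exists_norm_ell_pow_mul_le hψ g hg h
  set u : ℍ → ℂ := fun z => ell z ^ w * ψ z with hu
  have huM : u ∈ modularFns 0 (-w) := by
    have := ell_zpow_mul_mem_modularFns w hψ.1
    simpa using! this
  have hdz : ∀ z, dz u z = Complex.I * Real.pi * (ell z ^ w * g z) := by
    have := dz_ell_zpow_mul (toC_differentiableAt hψ.1) h
    simpa using! this
  have hΔ := laplacian_eq huM.1 (differentiableAt_toC_modularForm g) hdz
  set H : ℍ → ℝ := fun z => ‖u z‖ ^ 2 / z.im ^ w with hH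
  have hHinv : ∀ (γ : SL(2, ℤ)) z, H (γ • z) = H z := by
    have hHe : ∀ z, H z = (2 * Real.pi) ^ w * (‖u z‖ ^ 2 / ‖ell z‖ ^ w) := fun z => by
      have := z.im_pos
      have := Real.pi_pos
      rw [norm_ell, hH, mul_pow _ z.im]; field_simp
    intro γ z
    rw [hHe, hHe, norm_sq_div_smul huM]
  suffices hu0 : ∀ z, u z = 0 by
    ext z
    simpa [hu, ell_ne_zero] using hu0 z
  by_contra! hcon
  obtain ⟨z₀, hz₀⟩ := hcon
  have hHpos : 0 < H z₀ := by
    have := z₀.im_pos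
    have := norm_pos_iff.mpr hz₀
    simp only [hH]; positivity
  obtain ⟨Y, hY1, hY⟩ : ∃ Y : ℝ, 1 ≤ Y ∧ ∀ z : ℍ, Y < z.im → H z < H z₀ := by
    -- Above this height, `|u|² ≤ C²` and `y ≤ y^w` give `H < H z₀`.
    refine ⟨max 1 (C ^ 2 / H z₀), le_max_left _ _, fun z hz => ?_⟩
    rw [max_lt_iff, div_lt_iff₀ hHpos] at hz
    have h1 := hC z hz.1.le
    have h2 := z.im_pos
    simp only [hH] at hz ⊢
    rw [div_lt_iff₀ (by positivity)]
    have h3 : ‖u z‖ ^ 2 ≤ C ^ 2 := by gcongr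
    have h4 : z.im ≤ z.im ^ w := le_self_pow₀ hz.1.le (by lia)
    nlinarith [mul_le_mul_of_nonneg_left h4 hHpos.le]
  -- A compact rectangle containing the part of the fundamental domain below height `Y`, since `im ≥
  -- √3/2` on that domain.
  set K : Set ℂ := Set.Icc (-(1/2) : ℝ) (1/2) ×ℂ Set.Icc (1/2 : ℝ) Y with hK
  have hKpos : ∀ x ∈ K, 0 < x.im := fun x hx => by have := hx.2.1; simp at this; linarith
  have hfd : ∀ z : ℍ, H z < H z₀ ∨ ∃ z' : ℍ, (z' : ℂ) ∈ K ∧ H z' = H z := by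
    intro z
    obtain ⟨γ, hγ⟩ := ModularGroup.exists_smul_mem_fd z
    rcases lt_or_ge Y (γ • z).im with h1 | h1
    · left; rw [← hHinv γ]; exact hY _ h1
    · refine Or.inr ⟨γ • z, ⟨?_, ?_, h1⟩, hHinv γ z⟩
      · exact abs_le.mp hγ.2
      · have h3 := ModularGroup.three_le_four_mul_im_sq_of_mem_fd hγ
        have h4 := (γ • z).im_pos
        change 1 / 2 ≤ (γ • z).im
        nlinarith
  have hcont : ContinuousOn (fun x : ℂ => ‖toC u x‖ ^ 2 / x.im ^ w) K := by
    refine ContinuousOn.div ?_ (by fun_prop) fun x hx => (pow_pos (hKpos x hx) w).ne'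
    exact ((huM.1.continuousOn.mono hKpos).norm).pow 2
  have hHc : ∀ z : ℍ, ‖toC u z‖ ^ 2 / (z : ℂ).im ^ w = H z := fun z => by
    rw [toC_coe]; rfl
  have hne : K.Nonempty := by
    rcases hfd z₀ with h1 | ⟨z', h1, -⟩
    · exact absurd h1 (lt_irrefl _)
    · exact ⟨z', h1⟩
  obtain ⟨x₁, hx₁, hmax⟩ := (isCompact_Icc.reProdIm isCompact_Icc : IsCompact K).exists_isMaxOn
    hne hcont
  set z₁ : ℍ := ⟨x₁, hKpos x₁ hx₁⟩ with hz₁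
  have hmaxK : ∀ z : ℍ, (z : ℂ) ∈ K → H z ≤ H z₁ := fun z hz => by
    rw [← hHc, ← hHc]
    exact hmax hz
  have hle₀ : H z₀ ≤ H z₁ := by
    rcases hfd z₀ with h1 | ⟨z', h1, h2⟩
    · exact absurd h1 (lt_irrefl _)
    · rw [← h2]; exact hmaxK z' h1
  have hglobal : ∀ z, H z ≤ H z₁ := fun z => by
    rcases hfd z with h1 | ⟨z', h1, h2⟩
    · exact h1.le.trans hle₀
    · rw [← h2]; exact hmaxK z' h1
  have hzero : toC u z₁ = 0 := by
    refine im_eq_zero_of_isLocalMax hw z₁.im_pos (huM.1 _ z₁.im_pos) (hΔ z₁) ?_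
    filter_upwards [isOpen_im_pos.mem_nhds z₁.im_pos] with x hx
    rw [hHc, show x = ((⟨x, hx⟩ : ℍ) : ℂ) from rfl, hHc]
    exact hglobal _
  rw [toC_coe] at hzero
  have : H z₁ = 0 := by simp [hH, hzero]
  linarith

end ModIter
end

open scoped UpperHalfPlane MatrixGroups TensorProduct DirectSum ComplexConjugate

noncomputable section

namespace ModIter

open UpperHalfPlane Filter Topology
open scoped ModularForm

/-! ### Weights (0, 0) and holomorphic forms of level one -/

theorem exists_modularForm_weight_zero {f : ℍ → ℂ} (hf : f ∈ modularFns 0 0)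
    (hd : ∀ z : ℍ, DifferentiableAt ℂ (toC f) (z : ℂ)) (hb : IsBoundedAtImInfty f) :
    ∃ g : ModularForm 𝒮ℒ 0, ⇑g = f := by
  have hslash : ∀ γ : SL(2, ℤ), f ∣[(0 : ℤ)] γ = f := fun γ => by
    ext z
    rw [ModularForm.slash_action_eq'_iff]
    simpa using hf.2 γ z
  refine ⟨{ toFun := f
            slash_action_eq' := ?_
            holo' := ?_
            bdd_at_cusps' := ?_ }, rfl⟩
  · rintro _ ⟨γ, rfl⟩
    exact hslash γ
  · exact UpperHalfPlane.mdifferentiable_iff.mpr fun w hw =>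
      (hd ⟨w, hw⟩).differentiableWithinAt
  · intro c hc
    rw [Subgroup.IsArithmetic.isCusp_iff_isCusp_SL2Z] at hc
    rw [OnePoint.isBoundedAt_iff_forall_SL2Z hc]
    intro γ _
    rwa [hslash]

/-- Here `∂ψ/∂z = 0`, so the conjugate of `ψ` is holomorphic; the horocycle estimate with `g = 0`
bounds it at the cusp. It is thus a level one form of weight zero. -/
theorem exists_eq_const {p : ℤ} {ψ : ℍ → ℂ} (hψ : ψ ∈ PM p 0 0) (h : maass 0 ψ = 0) :
    ∃ c : ℂ, ψ = fun _ => c := by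
  have hd := toC_differentiableAt hψ.1
  have h' : maass ((0 : ℕ) : ℤ) ψ = fun z => ell z * (0 : ModularForm 𝒮ℒ 0) z := by
    ext z; simp [h]
  obtain ⟨C, hC⟩ := exists_norm_ell_pow_mul_le (w := 0) hψ 0 (by
    rw [FunLike.coe_zero, qExpansion_zero]; simp) h'
  simp only [pow_zero, one_mul] at hC
  have hdz : ∀ z, dz ψ z = 0 := fun z => by
    have := dz_ell_zpow_mul (w := 0) (g := 0) hd (by rw [h]; ext z; simp) z
    simpa using this
  have hcd : ∀ z : ℍ, DifferentiableAt ℂ (toC fun z => conj (ψ z)) (z : ℂ) := fun z => by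
    rw [differentiableAt_complex_iff_differentiableAt_real]
    refine ⟨differentiableAt_toC_conj (hd z), ?_⟩
    have h1 : dzbar (fun z => conj (ψ z)) z = 0 := by
      rw [dzbar_eq_conj]; simp [hdz]
    rw [dzbar, div_eq_zero_iff] at h1
    have h2 := h1.resolve_right two_ne_zero
    rw [smul_eq_mul]
    linear_combination -Complex.I * h2 +
      fderiv ℝ (toC fun z => conj (ψ z)) (z : ℂ) Complex.I * Complex.I_sq
  obtain ⟨g, hg⟩ := exists_modularForm_weight_zero (conj_mem_modularFns hψ.1) hcd
    (isBoundedAtImInfty_iff.mpr ⟨C, 1, fun z hz => by simpa using hC z hz⟩)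
  obtain ⟨c, hc⟩ := ModularFormClass.levelOne_weight_zero_const g
  refine ⟨conj c, funext fun z => ?_⟩
  have h1 := congrFun (hg.symm.trans hc) z
  simp only [Function.const_apply] at h1
  rw [← h1]; simp

/-- The space of holomorphic modular forms of weight `k` and level one, as functions on `ℍ`. -/
def holForms (k : ℤ) : Submodule ℂ (ℍ → ℂ) where
  carrier := {f | ∃ g : ModularForm 𝒮ℒ k, ⇑g = f}
  zero_mem' := ⟨0, rfl⟩
  add_mem' := by rintro _ _ ⟨f, rfl⟩ ⟨g, rfl⟩; exact ⟨f + g, rfl⟩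
  smul_mem' := by rintro c _ ⟨f, rfl⟩; exact ⟨c • f, rfl⟩

theorem mul_mem_holForms {k l : ℤ} {f g : ℍ → ℂ} (hf : f ∈ holForms k) (hg : g ∈ holForms l) :
    f * g ∈ holForms (k + l) := by
  obtain ⟨f, rfl⟩ := hf
  obtain ⟨g, rfl⟩ := hg
  exact ⟨f.mul g, rfl⟩

theorem one_mem_holForms : (1 : ℍ → ℂ) ∈ holForms 0 := ⟨1, rfl⟩

theorem holForms_two : holForms 2 = ⊥ := by
  rw [eq_bot_iff]
  rintro _ ⟨g, rfl⟩
  rw [rank_zero_iff.mp ModularForm.levelOne_weight_two_rank_zero |>.elim g 0]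
  rfl

/-- A modular form of even weight at least `4` is the sum of a multiple of the Eisenstein series and
of a form vanishing at the cusp. -/
theorem exists_sub_smul_E {k : ℕ} (hk : 3 ≤ k) (hk2 : Even k) (f : ModularForm 𝒮ℒ k) :
    ∃ c : ℂ, (qExpansion 1 (f - c • ModularForm.E hk : ModularForm 𝒮ℒ k)).coeff 0 = 0 :=
  ⟨_, (ModularForm.isCuspForm_iff_coeffZero_eq_zero _).mp
    (ModularForm.sub_smul_isCuspForm f _ (EisensteinSeries.E_qExpansion_coeff_zero hk hk2))⟩

/-! ### Uniqueness of primitives -/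

/-- Multiplication by `𝕃 ^ s` moves the problem to weights `(r - s, 0)`, where `eq_zero_of_maass_eq`
applies. -/
theorem eq_zero_of_maass_eq_zpow_mul {p r s : ℤ} (hrs : s < r) {φ : ℍ → ℂ} (hφ : φ ∈ PM p r s)
    {k : ℤ} (g : ModularForm 𝒮ℒ k) (hg : (qExpansion 1 g).coeff 0 = 0)
    (h : maass r φ = fun z => ell z ^ (1 - s) * g z) : φ = 0 := by
  obtain ⟨w, hw⟩ := Int.eq_ofNat_of_zero_le (show 0 ≤ r - s by lia)
  have h1 := ell_zpow_mul_mem_PM s hφ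
  have h2 := maass_ell_zpow_mul (r := r) (k := s) (toC_differentiableAt hφ.1)
  rw [sub_self] at h1
  rw [hw] at h1 h2
  have h3 := eq_zero_of_maass_eq (by lia) h1 g hg (by
    rw [h2, h]
    ext z
    rw [← mul_assoc, ← zpow_add₀ (ell_ne_zero z)]
    simp)
  ext z
  have := congrFun h3 z
  simpa [zpow_ne_zero _ (ell_ne_zero z)] using this

theorem eq_zero_of_maass_eq_zero {p r s : ℤ} (hrs : s < r) {φ : ℍ → ℂ} (hφ : φ ∈ PM p r s)
    (h : maass r φ = 0) : φ = 0 :=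
  eq_zero_of_maass_eq_zpow_mul hrs hφ (0 : ModularForm 𝒮ℒ 0)
    (by rw [FunLike.coe_zero, qExpansion_zero]; simp) (by rw [h]; ext z; simp)

theorem eq_smul_of_maass_eq_zero {p r : ℤ} {φ : ℍ → ℂ} (hφ : φ ∈ PM p r r)
    (h : maass r φ = 0) : ∃ c : ℂ, φ = c • fun z => ell z ^ (-r) := by
  have h1 := ell_zpow_mul_mem_PM r hφ
  have h2 := maass_ell_zpow_mul (r := r) (k := r) (toC_differentiableAt hφ.1)
  rw [sub_self] at h1 h2
  obtain ⟨c, hc⟩ := exists_eq_const h1 (by rw [h2, h]; ext z; simp)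
  refine ⟨c, funext fun z => ?_⟩
  have := congrFun hc z
  simp only [Pi.smul_apply, smul_eq_mul] at this ⊢
  rw [← this, mul_comm (ell z ^ r), mul_assoc, ← zpow_add₀ (ell_ne_zero z)]
  simp

end ModIter
end

open scoped UpperHalfPlane MatrixGroups TensorProduct DirectSum ComplexConjugate

noncomputable section

namespace ModIter

open UpperHalfPlane Filter Topology EisensteinSeries

/-! ### Lattice sums -/

/-- The summand `(m z + n) ^ (-a) (m z̄ + n) ^ (-b)` indexed by `v = (m, n)`. -/
def latticeTerm (a b : ℕ) (v : Fin 2 → ℤ) (w : ℂ) : ℂ :=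
  (v 0 * w + v 1) ^ (-a : ℤ) * (v 0 * conj w + v 1) ^ (-b : ℤ)

/-- The lattice sum `∑ (m z + n) ^ (-a) (m z̄ + n) ^ (-b)` over `(m, n) ∈ ℤ²`. -/
def latticeSum (a b : ℕ) (z : ℍ) : ℂ := ∑' v : Fin 2 → ℤ, latticeTerm a b v z

theorem linear_ne_zero {v : Fin 2 → ℤ} (hv : v ≠ 0) {w : ℂ} (hw : 0 < w.im) :
    (v 0 * w + v 1 : ℂ) ≠ 0 := by
  have := UpperHalfPlane.linear_ne_zero (cd := fun i => (v i : ℝ)) ⟨w, hw⟩ (by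
    intro h; apply hv; ext i; simpa using congrFun h i)
  simpa using this

theorem conj_linear (v : Fin 2 → ℤ) (w : ℂ) :
    (v 0 * conj w + v 1 : ℂ) = conj (v 0 * w + v 1 : ℂ) := by simp

theorem norm_latticeTerm (a b : ℕ) (v : Fin 2 → ℤ) (w : ℂ) :
    ‖latticeTerm a b v w‖ = ‖(v 0 * w + v 1 : ℂ)‖ ^ (-a : ℤ) * ‖(v 0 * w + v 1 : ℂ)‖ ^ (-b : ℤ) := by
  rw [latticeTerm, norm_mul, norm_zpow, norm_zpow, conj_linear, RCLike.norm_conj]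

theorem norm_zpow_le_of_mem_verticalStrip {A B : ℝ} (hB : 0 < B) {z : ℍ}
    (hz : z ∈ verticalStrip A B) (k : ℕ) (v : Fin 2 → ℤ) :
    ‖(v 0 * (z : ℂ) + v 1 : ℂ)‖ ^ (-k : ℤ) ≤ r ⟨⟨A, B⟩, hB⟩ ^ (-k : ℤ) * ‖v‖ ^ (-k : ℤ) := by
  have := summand_bound_of_mem_verticalStrip (k := k) (Nat.cast_nonneg k) v hB hz
  have e : ∀ x : ℝ, x ^ (-k : ℝ) = x ^ (-k : ℤ) := fun x => by
    rw [← Real.rpow_intCast]; push_cast; rfl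
  rwa [e, e, e] at this

theorem summable_norm_zpow {k : ℕ} (hk : 3 ≤ k) : Summable fun v : Fin 2 → ℤ => ‖v‖ ^ (-k : ℤ) := by
  have := summable_one_div_norm_rpow (k := k) (by exact_mod_cast hk)
  refine this.congr fun v => ?_
  rw [← Real.rpow_intCast]; push_cast; rfl

theorem zpow_neg_mul_zpow_neg {x : ℝ} {a b : ℕ} (h : 1 ≤ a + b) (hx : 0 ≤ x) :
    x ^ (-a : ℤ) * x ^ (-b : ℤ) ≤ x ^ (-(a + b : ℕ) : ℤ) := by
  rcases hx.eq_or_lt with rfl | hx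
  · rcases Nat.eq_zero_or_pos a with rfl | ha
    · simp
    · rw [zero_zpow _ (by lia : (-a : ℤ) ≠ 0), zero_mul, zero_zpow _ (by lia)]
  · rw [← zpow_add₀ hx.ne']
    push_cast
    rw [neg_add]

theorem norm_latticeTerm_le {a b : ℕ} (h : 1 ≤ a + b) {A B : ℝ} (hB : 0 < B) {z : ℍ}
    (hz : z ∈ verticalStrip A B) (v : Fin 2 → ℤ) :
    ‖latticeTerm a b v z‖ ≤
      r ⟨⟨A, B⟩, hB⟩ ^ (-(a + b : ℕ) : ℤ) * ‖v‖ ^ (-(a + b : ℕ) : ℤ) := by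
  rw [norm_latticeTerm]
  exact (zpow_neg_mul_zpow_neg h (norm_nonneg _)).trans
    (norm_zpow_le_of_mem_verticalStrip hB hz _ v)

theorem summable_norm_latticeTerm {a b : ℕ} (h : 3 ≤ a + b) (z : ℍ) :
    Summable fun v : Fin 2 → ℤ => ‖latticeTerm a b v z‖ :=
  ((summable_norm_zpow h).mul_left _).of_nonneg_of_le (fun _ => norm_nonneg _)
    (norm_latticeTerm_le (by lia) z.im_pos (A := |z.re|) ⟨le_rfl, le_rfl⟩)

theorem summable_latticeTerm {a b : ℕ} (h : 3 ≤ a + b) (z : ℍ) :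
    Summable fun v : Fin 2 → ℤ => latticeTerm a b v z :=
  (summable_norm_latticeTerm h z).of_norm

open Matrix in
/-- Right multiplication of row vectors by an element of `SL₂(ℤ)`. -/
def vecMulEquiv (γ : SL(2, ℤ)) : (Fin 2 → ℤ) ≃ (Fin 2 → ℤ) where
  toFun v := v ᵥ* γ.1
  invFun v := v ᵥ* (γ⁻¹).1
  left_inv v := by
    have h : γ.1 * (γ⁻¹).1 = 1 := congrArg Subtype.val (mul_inv_cancel γ)
    exact (vecMul_vecMul _ _ _).trans (by rw [h, vecMul_one])
  right_inv v := by
    have h : (γ⁻¹).1 * γ.1 = 1 := congrArg Subtype.val (inv_mul_cancel γ)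
    exact (vecMul_vecMul _ _ _).trans (by rw [h, vecMul_one])

theorem latticeTerm_eq_eisSummand (a b : ℕ) (v : Fin 2 → ℤ) (z : ℍ) :
    latticeTerm a b v z = eisSummand a v z * conj (eisSummand b v z) := by
  simp [latticeTerm, eisSummand]

theorem latticeSum_smul (a b : ℕ) (γ : SL(2, ℤ)) (z : ℍ) :
    latticeSum a b (γ • z) = ((γ 1 0 : ℂ) * z + γ 1 1) ^ (a : ℤ) *
      ((γ 1 0 : ℂ) * conj (z : ℂ) + γ 1 1) ^ (b : ℤ) * latticeSum a b z := by
  have hd : denom γ z = (γ 1 0 : ℂ) * z + γ 1 1 := by simp [denom]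
  have hd' : conj (denom γ z) = (γ 1 0 : ℂ) * conj (z : ℂ) + γ 1 1 := by rw [hd]; simp
  rw [latticeSum, latticeSum, ← hd, ← hd', ← (vecMulEquiv γ).tsum_eq (fun v => latticeTerm a b v z),
    ← tsum_mul_left]
  refine tsum_congr fun v => ?_
  rw [latticeTerm_eq_eisSummand, latticeTerm_eq_eisSummand, eisSummand_SL2_apply,
    eisSummand_SL2_apply, map_mul, map_zpow₀]
  simp only [vecMulEquiv, Equiv.coe_fn_mk]
  ring

theorem conj_latticeSum (a b : ℕ) (z : ℍ) : conj (latticeSum a b z) = latticeSum b a z := by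
  rw [latticeSum, Complex.conj_tsum, latticeSum]
  refine tsum_congr fun v => ?_
  simp [latticeTerm, mul_comm]

/-! ### Differentiation of lattice sums -/

/-- The real derivative of `latticeTerm a b v` at `w`. -/
def latticeTermDeriv (a b : ℕ) (v : Fin 2 → ℤ) (w : ℂ) : ℂ →L[ℝ] ℂ :=
  (-a * v 0 * latticeTerm (a + 1) b v w) • (1 : ℂ →L[ℝ] ℂ) +
    (-b * v 0 * latticeTerm a (b + 1) v w) • (Complex.conjCLE : ℂ →L[ℝ] ℂ)

theorem hasFDerivAt_latticeTerm (a b : ℕ) (v : Fin 2 → ℤ) {w : ℂ} (hw : 0 < w.im) :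
    HasFDerivAt (latticeTerm a b v) (latticeTermDeriv a b v w) w := by
  by_cases hv : v = 0
  · subst hv
    have h1 : latticeTerm a b 0 = fun _ => (0 : ℂ) ^ (-a : ℤ) * 0 ^ (-b : ℤ) := by
      ext; simp [latticeTerm]
    have h2 : latticeTermDeriv a b 0 w = 0 := by ext x; simp [latticeTermDeriv]
    rw [h1, h2]
    exact hasFDerivAt_const _ _
  · have hA := linear_ne_zero hv hw
    have hB : (v 0 * conj w + v 1 : ℂ) ≠ 0 := by
      rw [conj_linear]; exact (map_ne_zero _).mpr hA
    have e1 : HasFDerivAt (fun w : ℂ => (v 0 * w + v 1 : ℂ)) ((v 0 : ℂ) • (1 : ℂ →L[ℝ] ℂ)) w :=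
      ((hasFDerivAt_id w).const_mul _).add_const _
    have e2 : HasFDerivAt (fun w : ℂ => (v 0 * conj w + v 1 : ℂ))
        ((v 0 : ℂ) • (Complex.conjCLE : ℂ →L[ℝ] ℂ)) w :=
      ((Complex.conjCLE.hasFDerivAt (x := w)).const_mul _).add_const _
    have f1 := (hasDerivAt_zpow (-a : ℤ) _ (Or.inl hA)).comp_hasFDerivAt w e1
    have f2 := (hasDerivAt_zpow (-b : ℤ) _ (Or.inl hB)).comp_hasFDerivAt w e2
    refine (f1.mul f2).congr_fderiv ?_
    ext x
    simp only [latticeTermDeriv, latticeTerm, add_apply, smul_apply,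
      smul_eq_mul, Function.comp_apply]
    push_cast
    rw [show -((a : ℤ) + 1) = -(a : ℤ) - 1 by ring, show -((b : ℤ) + 1) = -(b : ℤ) - 1 by ring]
    ring

theorem norm_latticeTermDeriv_le (a b : ℕ) {A B : ℝ} (hB : 0 < B) {z : ℍ}
    (hz : z ∈ verticalStrip A B) (v : Fin 2 → ℤ) :
    ‖latticeTermDeriv a b v z‖ ≤
      ((a + b) * r ⟨⟨A, B⟩, hB⟩ ^ (-(a + b + 1 : ℕ) : ℤ)) * ‖v‖ ^ (-(a + b : ℕ) : ℤ) := by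
  have h1 := norm_latticeTerm_le (a := a + 1) (b := b) (by lia) hB hz v
  have h2 := norm_latticeTerm_le (a := a) (b := b + 1) (by lia) hB hz v
  rw [show a + 1 + b = a + b + 1 by ring] at h1
  rw [show a + (b + 1) = a + b + 1 by ring] at h2
  have h3 : ‖(v 0 : ℂ)‖ ≤ ‖v‖ := by
    have := norm_le_pi_norm v 0
    rwa [Complex.norm_intCast, ← Int.norm_eq_abs]
  have h4 : ‖v‖ * ‖v‖ ^ (-(a + b + 1 : ℕ) : ℤ) ≤ ‖v‖ ^ (-(a + b : ℕ) : ℤ) := by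
    rcases (norm_nonneg v).eq_or_lt with h0 | h0
    · rw [← h0]; simp only [zero_mul]; positivity
    · rw [← zpow_one_add₀ h0.ne']; push_cast; ring_nf; rfl
  set R := r ⟨⟨A, B⟩, hB⟩ ^ (-(a + b + 1 : ℕ) : ℤ) with hR
  have hR0 : 0 ≤ R := zpow_nonneg (r_pos _).le _
  have hcoef : ∀ (c : ℕ) (x : ℂ), ‖x‖ ≤ R * ‖v‖ ^ (-(a + b + 1 : ℕ) : ℤ) →
      ‖-c * v 0 * x‖ ≤ c * (R * ‖v‖ ^ (-(a + b : ℕ) : ℤ)) := fun c x hx => by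
    rw [norm_mul, norm_mul, norm_neg, Complex.norm_natCast, mul_assoc]
    refine mul_le_mul_of_nonneg_left ?_ (Nat.cast_nonneg c)
    calc ‖(v 0 : ℂ)‖ * ‖x‖ ≤ ‖v‖ * (R * ‖v‖ ^ (-(a + b + 1 : ℕ) : ℤ)) := by gcongr
      _ = R * (‖v‖ * ‖v‖ ^ (-(a + b + 1 : ℕ) : ℤ)) := by ring
      _ ≤ _ := by gcongr
  have e1 : ‖(1 : ℂ →L[ℝ] ℂ)‖ ≤ 1 := ContinuousLinearMap.norm_id_le
  have e2 : ‖(Complex.conjCLE : ℂ →L[ℝ] ℂ)‖ ≤ 1 := by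
    refine ContinuousLinearMap.opNorm_le_bound _ zero_le_one fun x => ?_
    simp
  refine (norm_add_le _ _).trans ?_
  rw [norm_smul, norm_smul]
  have g1 := mul_le_mul (hcoef a _ h1) e1 (norm_nonneg _) (by positivity)
  have g2 := mul_le_mul (hcoef b _ h2) e2 (norm_nonneg _) (by positivity)
  linarith

/-- Near `z` the differentiated terms are bounded by a multiple of `‖v‖^(-(a+b))`: differentiation
raises the exponent by one, and the factor `m` that it produces loses this gain. -/
theorem hasFDerivAt_latticeSum {a b : ℕ} (h : 3 ≤ a + b) (z : ℍ) :
    HasFDerivAt (toC (latticeSum a b)) (∑' v, latticeTermDeriv a b v z) (z : ℂ) ∧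
      Summable fun v => latticeTermDeriv a b v z := by
  set A := |z.re| + 1
  set B := z.im / 2
  have hB : 0 < B := half_pos z.im_pos
  set s : Set ℂ := {w | |w.re| < A} ∩ {w | B < w.im} with hs
  have hso : IsOpen s := (isOpen_lt (by fun_prop) continuous_const).inter
    (isOpen_lt continuous_const Complex.continuous_im)
  have hsc : Convex ℝ s := by
    have : {w : ℂ | |w.re| < A} = Complex.reLm ⁻¹' (Set.Ioo (-A) A) := by ext; simp [abs_lt]
    rw [hs, this]
    exact ((convex_Ioo _ _).linear_preimage _).inter (convex_halfSpace_im_gt _)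
  have hzs : (z : ℂ) ∈ s := ⟨by simp [A], by
    change z.im / 2 < z.im; linarith [z.im_pos]⟩
  have hmem : ∀ w ∈ s, ∃ hw : 0 < w.im, (⟨w, hw⟩ : ℍ) ∈ verticalStrip A B := fun w hw =>
    ⟨hB.trans hw.2, le_of_lt hw.1, le_of_lt hw.2⟩
  have hbd : ∀ v, ∀ w ∈ s, ‖latticeTermDeriv a b v w‖ ≤ ((a + b) *
      r ⟨⟨A, B⟩, hB⟩ ^ (-(a + b + 1 : ℕ) : ℤ)) * ‖v‖ ^ (-(a + b : ℕ) : ℤ) := fun v w hw => by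
    obtain ⟨hw0, hw1⟩ := hmem w hw
    exact norm_latticeTermDeriv_le a b hB hw1 v
  have hsum := (summable_norm_zpow h).mul_left ((a + b) * r ⟨⟨A, B⟩, hB⟩ ^ (-(a + b + 1 : ℕ) : ℤ))
  refine ⟨?_, hsum.of_norm_bounded fun v => hbd v _ hzs⟩
  have := hasFDerivAt_tsum_of_isPreconnected hsum hso hsc.isPreconnected
    (fun v w hw => hasFDerivAt_latticeTerm a b v (hmem w hw).1) hbd hzs
    (summable_latticeTerm h z) hzs
  exact this.congr_of_eventuallyEq
    (toC_eventuallyEq (F := fun w => ∑' v, latticeTerm a b v w) (fun _ => rfl) z)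

theorem dz_latticeSum {a b : ℕ} (h : 3 ≤ a + b) (z : ℍ) :
    HasSum (fun v : Fin 2 → ℤ => -a * v 0 * latticeTerm (a + 1) b v z) (dz (latticeSum a b) z) := by
  obtain ⟨h1, h2⟩ := hasFDerivAt_latticeSum h z
  have e := fun x : ℂ => (ContinuousLinearMap.apply ℝ ℂ x).hasSum h2.hasSum
  have := ((e 1).sub ((e Complex.I).mul_left Complex.I)).div_const 2
  simp only [ContinuousLinearMap.apply_apply] at this
  rw [dz, h1.fderiv]
  convert! this using 2 with v
  simp [latticeTermDeriv]
  linear_combination (1 / 2) * ((a * v 0 * latticeTerm (a + 1) b v z) -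
    (b * v 0 * latticeTerm a (b + 1) v z)) * (-Complex.I_sq)

/-- Put `A = mz + n` and `B = mz̄ + n`. Since `(z - z̄) m = A - B`, each term of the sum is
multiplied by `a - a(A - B)/A = aB/A`. -/
theorem maass_latticeSum {a b : ℕ} (h : 3 ≤ a + b + 1) (ha : 1 ≤ a) (z : ℍ) :
    maass a (latticeSum a (b + 1)) z = a * latticeSum (a + 1) b z := by
  have h1 := ((dz_latticeSum (a := a) (b := b + 1) (by lia) z).mul_left ((z : ℂ) - conj (z : ℂ))).add
    ((summable_latticeTerm (a := a) (b := b + 1) (by lia) z).hasSum.mul_left (a : ℂ))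
  have h2 := (summable_latticeTerm (a := a + 1) (b := b) (by lia) z).hasSum.mul_left (a : ℂ)
  rw [maass, Int.cast_natCast]
  refine h1.unique ?_
  convert! h2 using 2 with v
  by_cases hv : v = 0
  · subst hv
    have e : (0 : ℂ) ^ (-1 + -(a : ℤ)) = 0 := zero_zpow _ (by lia)
    simp [latticeTerm, show a ≠ 0 by lia, e]
  · have hA := linear_ne_zero hv z.im_pos
    have hB : (v 0 * conj (z : ℂ) + v 1 : ℂ) ≠ 0 := by
      rw [conj_linear]; exact (map_ne_zero _).mpr hA
    have hAB : ((z : ℂ) - conj (z : ℂ)) * v 0 =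
        (v 0 * z + v 1 : ℂ) - (v 0 * conj (z : ℂ) + v 1) := by ring
    simp only [latticeTerm, zpow_neg, zpow_natCast, pow_succ]
    rw [mul_assoc (-(a : ℂ)), mul_left_comm ((z : ℂ) - conj (z : ℂ)), ← mul_assoc _ (v 0 : ℂ), hAB]
    generalize (v 0 * z + v 1 : ℂ) = A at *
    generalize (v 0 * conj (z : ℂ) + v 1 : ℂ) = B at *
    field_simp
    ring

/-! ### The real analytic Eisenstein series -/

theorem eisFn_eq (r s : ℕ) (z : ℍ) :
    eisFn r s z = (r + s).factorial / (2 * Real.pi * Complex.I) ^ (r + s + 2) * (1 / 2) *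
      (ell z * latticeSum (r + 1) (s + 1) z) := by
  rw [eisFn]
  congr 1
  rw [latticeSum, ← tsum_mul_left, ← (finTwoArrowEquiv ℤ).symm.tsum_eq]
  -- The lattice sum may include the origin, which contributes zero because `0 ^ (-k) = 0` for `k ≥
  -- 1`.
  rw [← tsum_subtype_eq_of_support_subset (s := {p : ℤ × ℤ | p ≠ 0})]
  · refine tsum_congr fun p => ?_
    simp only [latticeTerm, finTwoArrowEquiv_symm_apply, Matrix.cons_val_zero, Matrix.cons_val_one,
      zpow_neg, zpow_natCast, div_eq_mul_inv, mul_inv]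
  · intro p hp
    contrapose! hp
    replace hp : p = 0 := by simpa using! hp
    have e : (0 : ℂ) ^ (-1 + -(r : ℤ)) = 0 := zero_zpow _ (by lia)
    simp [hp, latticeTerm, e]

theorem maass_eisFn (r s : ℕ) (h : 2 ≤ r + s) (z : ℍ) :
    maass r (eisFn r s) z = (r + s).factorial / (2 * Real.pi * Complex.I) ^ (r + s + 2) * (1 / 2) *
      ((r + 1) * (ell z * latticeSum (r + 2) s z)) := by
  have e : eisFn r s = ((r + s).factorial / (2 * Real.pi * Complex.I) ^ (r + s + 2) * (1 / 2) : ℂ) •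
      fun z => ell z ^ (1 : ℤ) * latticeSum (r + 1) (s + 1) z := by
    ext z; rw [eisFn_eq]; simp
  have h1 := maass_ell_zpow_mul (r := (r + 1 : ℕ)) (k := 1) (f := latticeSum (r + 1) (s + 1))
    fun z => (hasFDerivAt_latticeSum (by lia) z).1.differentiableAt
  rw [show ((r + 1 : ℕ) : ℤ) - 1 = r by simp] at h1
  rw [e, maass_smul, h1]
  simp only [Pi.smul_apply, smul_eq_mul, zpow_one]
  rw [maass_latticeSum (by lia) (by lia)]
  push_cast
  ring_nf

/-- The series of fixed `r + s` form a ladder under `∂`, their normalisation depending only on `r +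
s`. Read backwards, the ladder supplies primitives of Eisenstein series. -/
theorem maass_eisFn_succ (r s : ℕ) (h : 2 ≤ r + (s + 1)) :
    maass r (eisFn r (s + 1)) = ((r + 1 : ℕ) : ℂ) • eisFn (r + 1) s := by
  ext z
  rw [maass_eisFn _ _ h]
  simp only [Pi.smul_apply, smul_eq_mul, eisFn_eq]
  rw [show r + 1 + s = r + (s + 1) by ring]
  push_cast
  ring

theorem latticeSum_zero_right {k : ℕ} (hk : 3 ≤ k) (z : ℍ) :
    latticeSum k 0 z = 2 * riemannZeta k * ModularForm.E hk z := by
  have h1 : latticeSum k 0 z = ∑' v : Fin 2 → ℤ, eisSummand k v z := by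
    simp [latticeSum, latticeTerm, eisSummand]
  rw [h1, tsum_eisSummand_eq_riemannZeta_mul_eisensteinSeries hk]
  have h2 : ModularForm.E hk z = 1 / 2 * eisensteinSeries (N := 1) 0 k z := rfl
  rw [h2]; ring

/-- At the end of the ladder the lattice sum is holomorphic, equal to `2ζ(r+2)` times the normalised
Eisenstein series. As `c ≠ 0`, multiples of `𝓔_{r,0}` can cancel any constant term. -/
theorem maass_eisFn_zero {r : ℕ} (h : 2 ≤ r) : ∃ c : ℂ, c ≠ 0 ∧
    maass r (eisFn r 0) = fun z =>
      ell z * (c • ModularForm.E (show 3 ≤ r + 2 by lia) : ModularForm 𝒮ℒ (r + 2 : ℕ)) z := by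
  have hpi : (Real.pi : ℂ) ≠ 0 := by exact_mod_cast Real.pi_ne_zero
  refine ⟨r.factorial / (2 * Real.pi * Complex.I) ^ (r + 2) * (1 / 2) * (r + 1) *
    (2 * riemannZeta (r + 2 : ℕ)), ?_, ?_⟩
  · have h1 : riemannZeta (r + 2 : ℕ) ≠ 0 := riemannZeta_ne_zero_of_one_lt_re (by
      rw [Complex.natCast_re]; exact_mod_cast (by lia : 1 < r + 2))
    have h2 : (r.factorial : ℂ) ≠ 0 := by exact_mod_cast r.factorial_ne_zero
    have h3 : (r + 1 : ℂ) ≠ 0 := by exact_mod_cast r.succ_ne_zero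
    push_cast at h1
    simp [h1, h2, h3, hpi]
  · ext z
    rw [maass_eisFn r 0 (by lia), latticeSum_zero_right (show 3 ≤ r + 2 by lia), FunLike.coe_smul]
    simp only [add_zero, Pi.smul_apply, smul_eq_mul]
    ring

/-- Conjugation exchanges the two exponents, `𝕃` is real, and the sign comes from `(2πi)^(r+s+2)`.
-/
theorem conj_eisFn (r s : ℕ) (z : ℍ) : conj (eisFn r s z) = (-1) ^ (r + s) * eisFn s r z := by
  rw [eisFn_eq, eisFn_eq]
  simp only [map_mul, map_div₀, map_pow, Complex.conj_I, Complex.conj_ofReal, conj_ell,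
    conj_latticeSum, map_natCast, map_ofNat, map_one]
  rw [show 2 * (Real.pi : ℂ) * -Complex.I = -1 * (2 * Real.pi * Complex.I) by ring, mul_pow,
    add_comm s r, pow_add (-1 : ℂ)]
  rcases neg_one_pow_eq_or ℂ (r + s) with h | h <;> rw [h] <;> simp; ring

end ModIter
end

open scoped UpperHalfPlane MatrixGroups TensorProduct DirectSum ComplexConjugate

noncomputable section

namespace ModIter

open UpperHalfPlane Filter Topology EisensteinSeries

/-! ### Behaviour of the Eisenstein series at the cusp -/

/-- The points `(n + 1) i`, which tend to the cusp. -/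
def cuspSeq (n : ℕ) : ℍ := ⟨(n + 1) * Complex.I, by simp; positivity⟩

theorem coe_cuspSeq (n : ℕ) : (cuspSeq n : ℂ) = (n + 1) * Complex.I := rfl

theorem ell_cuspSeq (n : ℕ) : ell (cuspSeq n) = ((-2 * Real.pi * (n + 1) : ℝ) : ℂ) := by
  rw [ell, ← coe_im, coe_cuspSeq]
  simp

theorem normSq_linear_cuspSeq (v : Fin 2 → ℤ) (n : ℕ) :
    ‖(v 0 * (cuspSeq n : ℂ) + v 1 : ℂ)‖ ^ 2 = (v 0 * (n + 1 : ℝ)) ^ 2 + (v 1 : ℝ) ^ 2 := by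
  rw [← Complex.normSq_eq_norm_sq, Complex.normSq_apply, coe_cuspSeq]
  simp
  ring

/-- Along `(n + 1)i` no linear form decreases in modulus, so the terms at `n = 0` dominate. Terms
outside the row `v 0 = 0` tend to zero, and those of that row are constant. -/
theorem tendsto_latticeSum {a b : ℕ} (h : 3 ≤ a + b) :
    Tendsto (fun n => latticeSum a b (cuspSeq n)) atTop
      (𝓝 (∑' v : Fin 2 → ℤ, if v 0 = 0 then latticeTerm a b v (cuspSeq 0) else 0)) := by
  have hsum := summable_norm_latticeTerm h (cuspSeq 0)
  have hle : ∀ (v : Fin 2 → ℤ) (n : ℕ),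
      ‖latticeTerm a b v (cuspSeq n)‖ ≤ ‖latticeTerm a b v (cuspSeq 0)‖ := fun v n => by
    by_cases hv : v = 0
    · subst hv; simp [latticeTerm]
    have h0 : 0 < ‖(v 0 * (cuspSeq 0 : ℂ) + v 1 : ℂ)‖ :=
      norm_pos_iff.mpr (linear_ne_zero hv (cuspSeq 0).im_pos)
    have h1 : ‖(v 0 * (cuspSeq 0 : ℂ) + v 1 : ℂ)‖ ≤ ‖(v 0 * (cuspSeq n : ℂ) + v 1 : ℂ)‖ := by
      rw [← sq_le_sq₀ h0.le (norm_nonneg _), normSq_linear_cuspSeq, normSq_linear_cuspSeq]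
      have : (1 : ℝ) ≤ n + 1 := by simp
      simp only [mul_pow]
      gcongr
      simp
    rw [norm_latticeTerm, norm_latticeTerm]
    simp only [zpow_neg, zpow_natCast]
    gcongr
  refine tendsto_tsum_of_dominated_convergence hsum (fun v => ?_) (Eventually.of_forall
    fun n v => hle v n)
  split_ifs with hv
  · have : ∀ n, latticeTerm a b v (cuspSeq n) = latticeTerm a b v (cuspSeq 0) := fun n => by
      simp [latticeTerm, hv]
    simp only [this]
    exact tendsto_const_nhds
  · rw [tendsto_zero_iff_norm_tendsto_zero]
    have h1 : Tendsto (fun n : ℕ => ‖(v 0 * (cuspSeq n : ℂ) + v 1 : ℂ)‖) atTop atTop := by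
      refine tendsto_atTop_mono (fun n => ?_) tendsto_natCast_atTop_atTop
      have hv1 : (1 : ℝ) ≤ (v 0 : ℝ) ^ 2 := by
        have : 1 ≤ v 0 ^ 2 := by have := sq_pos_of_ne_zero hv; lia
        exact_mod_cast this
      rw [← sq_le_sq₀ (Nat.cast_nonneg n) (norm_nonneg _), normSq_linear_cuspSeq]
      nlinarith [sq_nonneg (v 1 : ℝ), sq_nonneg (n + 1 : ℝ), (Nat.cast_nonneg n : (0 : ℝ) ≤ n)]
    have h2 : Tendsto (fun x : ℝ => x ^ (-(a + b : ℕ) : ℤ)) atTop (𝓝 0) := by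
      simp only [zpow_neg, zpow_natCast]
      exact (tendsto_pow_atTop (by lia)).inv_tendsto_atTop
    refine (h2.comp h1).congr fun n => ?_
    have h0 : ‖(v 0 * (cuspSeq n : ℂ) + v 1 : ℂ)‖ ≠ 0 :=
      norm_ne_zero_iff.mpr (linear_ne_zero (fun h => hv (by simp [h])) (cuspSeq n).im_pos)
    rw [norm_latticeTerm, Function.comp_apply, ← zpow_add₀ h0]
    push_cast
    rw [neg_add]

/-- The surviving terms are even negative powers of integers: nonnegative, and positive at `(0, 1)`.
-/
theorem tsum_latticeTerm_ne_zero {a b : ℕ} (h : 3 ≤ a + b) (hab : Even (a + b)) :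
    ∑' v : Fin 2 → ℤ, (if v 0 = 0 then latticeTerm a b v (cuspSeq 0) else 0) ≠ 0 := by
  set F : (Fin 2 → ℤ) → ℝ := fun v => if v 0 = 0 then ((v 1 : ℝ) ^ a)⁻¹ * ((v 1 : ℝ) ^ b)⁻¹ else 0
    with hF
  have e : ∀ v : Fin 2 → ℤ, (if v 0 = 0 then latticeTerm a b v (cuspSeq 0) else 0) = (F v : ℂ) := by
    intro v
    simp only [hF]
    split_ifs with hv
    · simp [latticeTerm, hv]
    · simp
  have hnn : ∀ v, 0 ≤ F v := fun v => by
    simp only [hF]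
    split_ifs with hv
    · rw [← mul_inv, ← pow_add]
      exact inv_nonneg.mpr (hab.pow_nonneg _)
    · exact le_rfl
  have hs : Summable F := by
    refine (summable_norm_latticeTerm h (cuspSeq 0)).of_nonneg_of_le hnn fun v => ?_
    by_cases hv : v 0 = 0
    · have := e v
      rw [if_pos hv] at this
      rw [this, Complex.norm_real]
      exact Real.le_norm_self _
    · simp [hF, hv]
  rw [tsum_congr e, ← Complex.ofReal_tsum]
  have := hs.tsum_pos hnn ![0, 1] (by simp [hF])
  exact_mod_cast this.ne'

theorem exists_tendsto_eisFn {r s : ℕ} (h : 2 ≤ r + s) (hrs : Even (r + s)) :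
    ∃ c : ℂ, c ≠ 0 ∧
      Tendsto (fun n => eisFn r s (cuspSeq n) / ell (cuspSeq n)) atTop (𝓝 c) := by
  have hpi : (Real.pi : ℂ) ≠ 0 := by exact_mod_cast Real.pi_ne_zero
  have h1 : Even (r + 1 + (s + 1)) := by
    rw [show r + 1 + (s + 1) = r + s + 2 by ring]; exact hrs.add even_two
  refine ⟨_, ?_, ((tendsto_latticeSum (a := r + 1) (b := s + 1) (by lia)).const_mul
    ((r + s).factorial / (2 * Real.pi * Complex.I) ^ (r + s + 2) * (1 / 2))).congr fun n => ?_⟩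
  · have h2 : ((r + s).factorial : ℂ) ≠ 0 := by exact_mod_cast (r + s).factorial_ne_zero
    refine mul_ne_zero ?_ (tsum_latticeTerm_ne_zero (by lia) h1)
    simp [h2, hpi]
  · rw [eisFn_eq]
    have := ell_ne_zero (cuspSeq n)
    field_simp

theorem eisFn_ne_zero {r s : ℕ} (h : 2 ≤ r + s) (hrs : Even (r + s)) : eisFn r s ≠ 0 := by
  obtain ⟨c, hc, ht⟩ := exists_tendsto_eisFn h hrs
  intro h0
  simp only [h0, Pi.zero_apply, zero_div] at ht
  exact hc (tendsto_nhds_unique ht tendsto_const_nhds)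

theorem eisFn_smul (r s : ℕ) (γ : SL(2, ℤ)) (z : ℍ) :
    eisFn r s (γ • z) = ((γ 1 0 : ℂ) * z + γ 1 1) ^ (r : ℤ) *
      ((γ 1 0 : ℂ) * conj (z : ℂ) + γ 1 1) ^ (s : ℤ) * eisFn r s z := by
  rw [eisFn_eq, eisFn_eq, latticeSum_smul, ell_smul]
  have h1 := automorphy_ne_zero γ z
  have h2 := automorphy_conj_ne_zero γ z
  simp only [zpow_neg, zpow_one, zpow_natCast, pow_succ]
  field_simp

theorem eisFn_eq_zero_of_odd {r s : ℕ} (h : Odd (r + s)) : eisFn r s = 0 := by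
  ext z
  have h1 := eisFn_smul r s (-1) z
  simp at h1
  rw [← pow_add, h.neg_one_pow] at h1
  simp only [Pi.zero_apply]
  linear_combination h1 / 2

theorem eis_ne_zero_iff {r s : ℕ} (h : 2 ≤ r + s) : eis r s ≠ 0 ↔ Even (r + s) := by
  refine ⟨fun h0 => ?_, fun he h0 => eisFn_ne_zero h he ?_⟩
  · by_contra hodd
    rw [Nat.not_even_iff_odd] at hodd
    exact h0 (by rw [eis, eisFn_eq_zero_of_odd hodd]; simp)
  · simpa [eis] using h0

/-- Functions of different orders of growth are linearly independent: here
`𝕃 ^ (-n) 𝓔_{r,s}` of order `𝕃 ^ (1 - n)`. -/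
theorem eq_zero_of_sum_zpow_mul_eq_zero {ι : Type*} (S : Finset ι) (e : ι → ℤ)
    (he : Set.InjOn e S) (F : ι → ℍ → ℂ)
    (hF : ∀ i ∈ S, ∃ c : ℂ, c ≠ 0 ∧
      Tendsto (fun n => F i (cuspSeq n) * ell (cuspSeq n) ^ (-e i)) atTop (𝓝 c))
    (a : ι → ℂ) (h : ∀ z, ∑ i ∈ S, a i * F i z = 0) : ∀ i ∈ S, a i = 0 := by
  classical
  by_contra! hcon
  have hne : (S.filter fun i => a i ≠ 0).Nonempty := by
    obtain ⟨i, hi, hi0⟩ := hcon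
    exact ⟨i, by simp [hi, hi0]⟩
  -- Among the indices with nonzero coefficient, `j` has maximal order; after division by `𝕃 ^ e j`
  -- only its term survives in the limit.
  obtain ⟨j, hj, hmax⟩ := (S.filter fun i => a i ≠ 0).exists_max_image e hne
  rw [Finset.mem_filter] at hj
  have hell : Tendsto (fun n => ‖ell (cuspSeq n)‖) atTop atTop := by
    simp only [ell_cuspSeq, Complex.norm_real]
    refine tendsto_atTop_mono (fun n => ?_) tendsto_natCast_atTop_atTop
    rw [Real.norm_eq_abs, abs_mul, abs_mul, abs_neg, abs_of_pos Real.pi_pos, abs_two,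
      abs_of_pos (by positivity)]
    have := Real.two_le_pi
    have hn : (0 : ℝ) ≤ n := Nat.cast_nonneg n
    nlinarith
  have hlim : ∀ i ∈ S, ∃ c : ℂ, (i = j → c ≠ 0) ∧ (i ≠ j → c = 0) ∧
      Tendsto (fun n => a i * F i (cuspSeq n) * ell (cuspSeq n) ^ (-e j)) atTop (𝓝 c) := by
    intro i hi
    by_cases hij : i = j
    · subst hij
      obtain ⟨c, hc, ht⟩ := hF i hi
      exact ⟨a i * c, fun _ => mul_ne_zero hj.2 hc, fun h => absurd rfl h,
        (ht.const_mul (a i)).congr fun n => by ring⟩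
    refine ⟨0, fun h => absurd h hij, fun _ => rfl, ?_⟩
    by_cases ha : a i = 0
    · simp [ha]
    obtain ⟨c, -, ht⟩ := hF i hi
    have hlt : e i < e j := lt_of_le_of_ne (hmax i (by simp [hi, ha]))
      fun h => hij (he hi hj.1 h)
    have h0 : Tendsto (fun n => ell (cuspSeq n) ^ (e i - e j)) atTop (𝓝 0) := by
      rw [tendsto_zero_iff_norm_tendsto_zero]
      simp only [norm_zpow]
      exact (tendsto_zpow_atTop_zero (by lia)).comp hell
    have := (ht.mul h0).const_mul (a i)
    rw [mul_zero, mul_zero] at this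
    refine this.congr fun n => ?_
    rw [mul_assoc (F i _), ← zpow_add₀ (ell_ne_zero _), show -e i + (e i - e j) = -e j by ring]
    ring
  choose! c hc1 hc2 hc3 using hlim
  have ht := tendsto_finsetSum S hc3
  have hz : ∀ n, ∑ i ∈ S, a i * F i (cuspSeq n) * ell (cuspSeq n) ^ (-e j) = 0 := fun n => by
    rw [← Finset.sum_mul, h, zero_mul]
  simp only [hz] at ht
  have h1 := tendsto_nhds_unique ht tendsto_const_nhds
  rw [Finset.sum_eq_single_of_mem j hj.1 fun i hi hij => hc2 i hi hij] at h1
  exact hc1 j hj.1 rfl h1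

end ModIter
end

open scoped UpperHalfPlane MatrixGroups TensorProduct DirectSum ComplexConjugate

noncomputable section

namespace ModIter

open UpperHalfPlane Filter Topology EisensteinSeries

/-! ### Power series in `q` -/

theorem norm_q_lt_one (z : ℍ) : ‖q z‖ < 1 := norm_exp_two_pi_I_lt_one z

/-- Terms are regrouped by their exponent of `q`. The point is that the resulting coefficients do
not depend on `z`. -/
theorem hasSum_fiberwise_q {ι : Type*} (b : ι → ℂ) (φ : ι → ℕ)
    (h : ∀ z, Summable fun i => b i * q z ^ φ i) :
    ∃ A : ℕ → ℂ, ∀ z, HasSum (fun N => A N * q z ^ N) (∑' i, b i * q z ^ φ i) := by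
  refine ⟨fun N => ∑' i : {i // φ i = N}, b i, fun z => ?_⟩
  have h1 := (Equiv.sigmaFiberEquiv φ).hasSum_iff.mpr (h z).hasSum
  refine h1.sigma fun N => ?_
  have h2 : Summable fun i : {i // φ i = N} => b i * q z ^ N :=
    ((h z).subtype {i | φ i = N}).congr fun i => by
      have : φ i.1 = N := i.2
      simp [this]
  rw [← tsum_mul_right]
  convert! h2.hasSum using 2 with i
  simp [i.2]

/-- Convergence at `(im w / 2) i` dominates the series on the half plane above that point, so the
sum is holomorphic there. -/
theorem analyticOnNhd_of_hasSum_q {Φ : ℍ → ℂ} {A : ℕ → ℂ}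
    (h : ∀ z, HasSum (fun N => A N * q z ^ N) (Φ z)) :
    AnalyticOnNhd ℝ (toC Φ) {w : ℂ | 0 < w.im} := by
  set F : ℂ → ℂ := fun w => ∑' N, A N * Complex.exp (2 * Real.pi * Complex.I * w) ^ N with hF
  have hΦ : ∀ z : ℍ, Φ z = F z := fun z => (h z).tsum_eq.symm
  have hd : DifferentiableOn ℂ F {w : ℂ | 0 < w.im} := fun w hw => by
    have hw2 : 0 < w.im / 2 := half_pos hw
    set z0 : ℍ := ⟨(w.im / 2 : ℝ) * Complex.I, by simpa using hw⟩
    have hU : IsOpen {u : ℂ | w.im / 2 < u.im} := isOpen_lt continuous_const Complex.continuous_im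
    have hdU : DifferentiableOn ℂ F {u : ℂ | w.im / 2 < u.im} := by
      refine Complex.differentiableOn_tsum_of_summable_norm (h z0).summable.norm
        (fun N => by fun_prop) hU fun N u hu => ?_
      rw [norm_mul, norm_mul, norm_pow, norm_pow]
      gcongr
      have e1 := norm_q ⟨u, hw2.trans hu⟩
      have e2 := norm_q z0
      rw [q] at e1
      change ‖Complex.exp (2 * Real.pi * Complex.I * u)‖ = _ at e1
      rw [e1, e2]
      apply Real.exp_le_exp.mpr
      have : z0.im = w.im / 2 := by rw [← coe_im]; simp [z0]
      rw [this]
      have hu' : w.im / 2 < u.im := hu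
      change -2 * Real.pi * u.im ≤ _
      nlinarith [Real.pi_pos]
    exact (hdU.differentiableAt (hU.mem_nhds (half_lt_self hw : w.im / 2 < w.im))).differentiableWithinAt
  have ha := (hd.analyticOnNhd isOpen_im_pos).restrictScalars (𝕜 := ℝ)
  exact fun w hw => (ha w hw).congr (toC_eventuallyEq hΦ ⟨w, hw⟩).symm

theorem mem_expansions_zero_of_hasSum_q {Φ : ℍ → ℂ} {A : ℕ → ℂ}
    (h : ∀ z, HasSum (fun N => A N * q z ^ N) (Φ z)) : Φ ∈ expansions 0 := by
  refine Submodule.subset_span ⟨0, le_rfl, fun mn => if mn.2 = 0 then A mn.1 else 0, fun z => ?_⟩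
  have hi : Function.Injective fun N : ℕ => (N, 0) := fun a b h => by simpa using h
  refine (hi.hasSum_iff fun mn hmn => ?_).mp ?_
  · have : mn.2 ≠ 0 := fun h0 => hmn ⟨mn.1, by ext <;> simp [h0]⟩
    simp [this]
  · simpa [Function.comp_def] using h z

/-! ### Summation over dilates -/

/-- The point `m z`. -/
def dilate (m : ℕ+) (z : ℍ) : ℍ := ⟨m * z, by simpa using z.im_pos⟩

theorem coe_dilate (m : ℕ+) (z : ℍ) : (dilate m z : ℂ) = m * z := rfl

theorem ell_dilate (m : ℕ+) (z : ℍ) : ell (dilate m z) = m * ell z := by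
  have : (dilate m z).im = m * z.im := by rw [← coe_im, coe_dilate]; simp
  rw [ell, ell, this]
  push_cast
  ring

theorem q_dilate (m : ℕ+) (z : ℍ) : q (dilate m z) = q z ^ (m : ℕ) := by
  rw [q, q, ← Complex.exp_nat_mul, coe_dilate]
  ring_nf

/-- The sums `∑ m ^ (-j) h (m z)` over `m ≥ 1` with `j + K ≥ 3` exist, are real analytic and
have an expansion of order at least `1 - K`. -/
def DilateSummable (K : ℕ) (h : ℍ → ℂ) : Prop :=
  ∀ j : ℕ, 3 ≤ j + K → ∃ Φ : ℍ → ℂ,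
    (∀ z, HasSum (fun m : ℕ+ => (m : ℂ) ^ (-j : ℤ) * h (dilate m z)) (Φ z)) ∧
    Φ ∈ expansions (1 - K) ∧ AnalyticOnNhd ℝ (toC Φ) {w : ℂ | 0 < w.im}

namespace DilateSummable

variable {K : ℕ} {h h' : ℍ → ℂ}

theorem add (H : DilateSummable K h) (H' : DilateSummable K h') : DilateSummable K (h + h') := by
  intro j hj
  obtain ⟨Φ, h1, h2, h3⟩ := H j hj
  obtain ⟨Φ', h1', h2', h3'⟩ := H' j hj
  refine ⟨Φ + Φ', fun z => ?_, add_mem h2 h2', h3.add h3'⟩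
  simpa [mul_add] using (h1 z).add (h1' z)

theorem smul (c : ℂ) (H : DilateSummable K h) : DilateSummable K (c • h) := by
  intro j hj
  obtain ⟨Φ, h1, h2, h3⟩ := H j hj
  refine ⟨c • Φ, fun z => ?_, Submodule.smul_mem _ c h2, analyticOnNhd_const.mul h3⟩
  simpa [mul_left_comm] using (h1 z).mul_left c

theorem star (H : DilateSummable K h) : DilateSummable K fun z => conj (h z) := by
  intro j hj
  obtain ⟨Φ, h1, h2, h3⟩ := H j hj
  refine ⟨fun z => conj (Φ z), fun z => ?_, conj_mem_expansions h2,
    (Complex.conjCLE : ℂ →L[ℝ] ℂ).comp_analyticOnNhd h3⟩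
  have := (h1 z).map (starRingEnd ℂ) Complex.continuous_conj
  simpa [Function.comp_def] using this

/-- At `mz` the factor `𝕃⁻¹` yields an extra `m⁻¹`. Thus `j` for the product becomes `j + 1` for
`h`, while `K + 1` becomes `K`; this exchange is why the definition quantifies over all `j` with `j
+ K ≥ 3`. -/
theorem ell_inv_mul (H : DilateSummable K h) :
    DilateSummable (K + 1) fun z => ell z ^ (-1 : ℤ) * h z := by
  intro j hj
  obtain ⟨Φ, h1, h2, h3⟩ := H (j + 1) (by lia)
  refine ⟨fun z => ell z ^ (-1 : ℤ) * Φ z, fun z => ?_, ?_, (analyticOnNhd_toC_ell_zpow _).mul h3⟩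
  · convert! (h1 z).mul_left (ell z ^ (-1 : ℤ)) using 2 with m
    have hm : (m : ℂ) ≠ 0 := by exact_mod_cast m.ne_zero
    beta_reduce
    rw [ell_dilate, mul_zpow]
    push_cast
    rw [neg_add, zpow_add₀ hm]
    ring
  · have := ell_zpow_mul_mem_expansions (-1) h2
    rwa [show (1 : ℤ) - K + -1 = 1 - (K + 1 : ℕ) by push_cast; ring] at this

theorem one : DilateSummable 1 1 := by
  intro j hj
  have hs : Summable fun m : ℕ+ => (m : ℂ) ^ (-j : ℤ) := by
    have h1 := (Real.summable_nat_pow_inv.mpr (show 1 < j by lia)).comp_injective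
      PNat.coe_injective
    refine h1.of_norm_bounded fun m => ?_
    simp
  refine ⟨fun _ => ∑' m : ℕ+, (m : ℂ) ^ (-j : ℤ), fun z => by simpa using! hs.hasSum, ?_,
    analyticOnNhd_const⟩
  refine expansions_mono (by simp) (mem_expansions_zero_of_hasSum_q
    (A := fun N => if N = 0 then ∑' m : ℕ+, (m : ℂ) ^ (-j : ℤ) else 0) fun z => ?_)
  convert! hasSum_single (f := fun N : ℕ => (if N = 0 then
    ∑' m : ℕ+, (m : ℂ) ^ (-j : ℤ) else 0) * q z ^ N) 0 fun N hN => by simp [hN] using 1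
  simp

/-- The double series `∑ m^(-j) n^l q^(mn)` converges absolutely for every `j ≥ 0` because `|q| <
1`; it is regrouped by `N = mn`. -/
theorem tsum_pow_mul_q_pow {K : ℕ} (hK : 1 ≤ K) (l : ℕ) :
    DilateSummable K fun z => ∑' n : ℕ+, (n : ℂ) ^ l * q z ^ (n : ℕ) := by
  intro j _
  have hs : ∀ z, Summable fun c : ℕ+ × ℕ+ => ((c.1 : ℂ) ^ (-j : ℤ) * (c.2 : ℂ) ^ l) *
      q z ^ (c.1 * c.2 : ℕ) := fun z => by
    refine (summable_prod_mul_pow l (norm_q_lt_one z)).norm.of_norm_bounded fun c => ?_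
    simp only [norm_mul]
    gcongr
    refine mul_le_of_le_one_left (norm_nonneg _) ?_
    rw [norm_zpow, zpow_neg, zpow_natCast, Complex.norm_natCast]
    exact inv_le_one_of_one_le₀ (one_le_pow₀ (by exact_mod_cast c.1.2))
  obtain ⟨A, hA⟩ := hasSum_fiberwise_q _ _ hs
  refine ⟨_, fun z => ?_, expansions_mono (by lia) (mem_expansions_zero_of_hasSum_q hA),
    analyticOnNhd_of_hasSum_q hA⟩
  have := (hs z).hasSum.prod_fiberwise fun m => ((hs z).prod_factor m).hasSum
  convert! this using 2 with m
  rw [← tsum_mul_left]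
  refine tsum_congr fun n => ?_
  rw [q_dilate, ← pow_mul, mul_assoc]

end DilateSummable

/-! ### Sums over a row of the lattice -/

/-- The sum `∑ (z + n) ^ (-a) (z̄ + n) ^ (-b)` over `n ∈ ℤ`. -/
def rowSum (a b : ℕ) (z : ℍ) : ℂ := ∑' n : ℤ, latticeTerm a b ![1, n] z

theorem summable_rowSum {a b : ℕ} (h : 2 ≤ a + b) (z : ℍ) :
    Summable fun n : ℤ => latticeTerm a b ![1, n] z := by
  have h1 := (linear_right_summable z 1 (k := (a + b : ℕ)) (by exact_mod_cast h)).norm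
  refine h1.of_norm_bounded fun n => ?_
  rw [norm_latticeTerm]
  refine (zpow_neg_mul_zpow_neg (by lia) (norm_nonneg _)).trans_eq ?_
  rw [norm_inv, norm_zpow, zpow_neg]
  simp

theorem conj_rowSum (a b : ℕ) (z : ℍ) : conj (rowSum a b z) = rowSum b a z := by
  rw [rowSum, Complex.conj_tsum, rowSum]
  refine tsum_congr fun v => ?_
  simp [latticeTerm, mul_comm]

/-- Lipschitz's formula. -/
theorem rowSum_zero_right {k : ℕ} (hk : 1 ≤ k) :
    ∃ c : ℂ, rowSum (k + 1) 0 = c • fun z => ∑' n : ℕ+, (n : ℂ) ^ k * q z ^ (n : ℕ) := by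
  refine ⟨(-2 * Real.pi * Complex.I) ^ (k + 1) / k.factorial, ?_⟩
  ext z
  rw [rowSum, Pi.smul_apply, smul_eq_mul]
  refine Eq.trans (tsum_congr fun n => ?_) (qExpansion_identity_pnat hk z)
  simp only [latticeTerm, zpow_neg, zpow_natCast]
  simp

/-- Partial fractions: `z - z̄` is the difference of `z + n` and `z̄ + n`. The condition `a + b ≥ 1`
keeps both resulting series absolutely convergent. -/
theorem rowSum_succ_succ {a b : ℕ} (h : 1 ≤ a + b) (z : ℍ) :
    rowSum (a + 1) (b + 1) z =
      ell z ^ (-1 : ℤ) * (Complex.I * Real.pi * (rowSum a (b + 1) z - rowSum (a + 1) b z)) := by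
  have h1 : ((z : ℂ) - conj (z : ℂ)) * rowSum (a + 1) (b + 1) z =
      rowSum a (b + 1) z - rowSum (a + 1) b z := by
    rw [rowSum, rowSum, rowSum, ← tsum_mul_left,
      ← (summable_rowSum (by lia) z).tsum_sub (summable_rowSum (by lia) z)]
    refine tsum_congr fun n => ?_
    have hA : (z + n : ℂ) ≠ 0 := by
      simpa using linear_ne_zero (v := ![1, n]) (by simp) z.im_pos
    have hB : (conj (z : ℂ) + n : ℂ) ≠ 0 := by
      simpa using (map_ne_zero (starRingEnd ℂ)).mpr hA
    have hAB : (z : ℂ) - conj (z : ℂ) = (z + n) - (conj (z : ℂ) + n) := by ring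
    simp only [latticeTerm, zpow_neg, zpow_natCast, pow_succ, Matrix.cons_val_zero,
      Matrix.cons_val_one, Int.cast_one, one_mul]
    rw [hAB]
    generalize (z + n : ℂ) = A at *
    generalize (conj (z : ℂ) + n : ℂ) = B at *
    field_simp
  have hpi : (Real.pi : ℂ) ≠ 0 := by exact_mod_cast Real.pi_ne_zero
  have he := ell_ne_zero z
  rw [← h1, sub_conj_eq, zpow_neg_one]
  field_simp

/-- Partial fractions now produce series that do not converge absolutely; pairing `n` with `-n` sums
them by the cotangent series. -/
theorem rowSum_one_one (z : ℍ) : rowSum 1 1 z = ell z ^ (-1 : ℤ) * (Complex.I * Real.pi *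
    (conj (Real.pi * Complex.cot (Real.pi * z)) - Real.pi * Complex.cot (Real.pi * z))) := by
  have hpi : (Real.pi : ℂ) ≠ 0 := by exact_mod_cast Real.pi_ne_zero
  have he := ell_ne_zero z
  have hA : ∀ n : ℤ, (z + n : ℂ) ≠ 0 := fun n => by
    simpa using linear_ne_zero (v := ![1, n]) (by simp) z.im_pos
  have h1 : ∀ n : ℤ, ((z : ℂ) - conj (z : ℂ)) * latticeTerm 1 1 ![1, n] z =
      conj (1 / (z + n : ℂ)) - 1 / (z + n) := fun n => by
    have hB : (conj (z : ℂ) + n : ℂ) ≠ 0 := by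
      simpa using (map_ne_zero (starRingEnd ℂ)).mpr (hA n)
    have := hA n
    simp only [latticeTerm, Matrix.cons_val_zero, Matrix.cons_val_one, Int.cast_one, one_mul,
      Nat.cast_one, zpow_neg_one, map_div₀, map_one, map_add, map_intCast]
    field_simp
    ring
  have hs : Summable fun n : ℤ => conj (1 / (z + n : ℂ)) - 1 / (z + n) :=
    ((summable_rowSum (a := 1) (b := 1) le_rfl z).mul_left _).congr h1
  have hcs : Summable fun n : ℕ+ => 1 / ((z : ℂ) - n) + 1 / (z + n) := by
    have := summable_cotTerm (coe_mem_integerComplement z)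
    rw [summable_pnat_iff_summable_succ (f := fun n : ℕ => 1 / ((z : ℂ) - n) + 1 / (z + n))]
    simpa [cotTerm] using this
  have h2 : ((z : ℂ) - conj (z : ℂ)) * rowSum 1 1 z =
      conj (Real.pi * Complex.cot (Real.pi * z)) - Real.pi * Complex.cot (Real.pi * z) := by
    rw [rowSum, ← tsum_mul_left, tsum_congr h1, tsum_int_eq_zero_add_tsum_pnat hs,
      cot_series_rep (coe_mem_integerComplement z), map_add, Complex.conj_tsum]
    have hs1 : Summable fun n : ℕ+ => conj (1 / (z + (n : ℤ) : ℂ)) - 1 / (z + (n : ℤ)) :=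
      hs.comp_injective (i := fun n : ℕ+ => (n : ℤ)) fun m n hmn => by simpa using hmn
    have hs2 : Summable fun n : ℕ+ =>
        conj (1 / (z + (-n : ℤ) : ℂ)) - 1 / (z + (-n : ℤ)) :=
      hs.comp_injective (i := fun n : ℕ+ => (-n : ℤ)) fun m n hmn => by simpa using hmn
    have hcs' : Summable fun n : ℕ+ => conj (1 / ((z : ℂ) - n) + 1 / (z + n)) :=
      hcs.map (starRingEnd ℂ) Complex.continuous_conj
    have e : (∑' n : ℕ+, (conj (1 / (z + (n : ℤ) : ℂ)) - 1 / (z + (n : ℤ)))) +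
        ∑' n : ℕ+, (conj (1 / (z + (-n : ℤ) : ℂ)) - 1 / (z + (-n : ℤ))) =
        ∑' n : ℕ+, conj (1 / ((z : ℂ) - n) + 1 / (z + n)) -
          ∑' n : ℕ+, (1 / ((z : ℂ) - n) + 1 / (z + n)) := by
      rw [← hs1.tsum_add hs2, ← hcs'.tsum_sub hcs]
      refine tsum_congr fun n => ?_
      simp [sub_eq_add_neg]
      ring
    rw [add_assoc, e]
    simp
    ring
  rw [← h2, sub_conj_eq, zpow_neg_one]
  field_simp

/-- Partial fractions lower `a + b` at the cost of one `𝕃⁻¹`, until one of the rows `(a, 0)`, `(0,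
b)` or `(1, 1)` is reached. -/
theorem dilateSummable_rowSum {a b : ℕ} (h : 2 ≤ a + b) :
    DilateSummable (a + b) (rowSum a b) := by
  have hconj : ∀ {a b : ℕ}, DilateSummable (a + b) (rowSum a b) →
      DilateSummable (b + a) (rowSum b a) := fun {a b} H => by
    have := H.star
    simp only [conj_rowSum] at this
    rw [add_comm]
    exact this
  have hzero : ∀ {a : ℕ}, 2 ≤ a → DilateSummable (a + 0) (rowSum a 0) := fun {a} ha => by
    obtain ⟨k, rfl⟩ : ∃ k, a = k + 1 := ⟨a - 1, by lia⟩
    obtain ⟨c, hc⟩ := rowSum_zero_right (k := k) (by lia)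
    rw [hc]
    exact (DilateSummable.tsum_pow_mul_q_pow (by lia) k).smul c
  induction hK : a + b generalizing a b with
  | zero => lia
  | succ K ih =>
    rcases Nat.eq_zero_or_pos b with rfl | hb
    · rw [← hK]; exact hzero (by lia)
    rcases Nat.eq_zero_or_pos a with rfl | ha
    · rw [← hK]; exact hconj (hzero (by lia))
    obtain ⟨a, rfl⟩ : ∃ k, a = k + 1 := ⟨a - 1, by lia⟩
    obtain ⟨b, rfl⟩ : ∃ k, b = k + 1 := ⟨b - 1, by lia⟩
    rcases Nat.eq_zero_or_pos (a + b) with h0 | h0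
    · obtain ⟨rfl, rfl⟩ : a = 0 ∧ b = 0 := by lia
      obtain rfl : K = 1 := by lia
      have hl := DilateSummable.tsum_pow_mul_q_pow (le_refl 1) 0
      -- From `π cot πz = -πi - 2πi ∑ q^n`, the row `(1, 1)` equals `-2π² 𝕃⁻¹ (1 + ∑ q^n + ∑ q̄^n)`.
      have := ((DilateSummable.one.smul (-(2 * Real.pi ^ 2))).add
        ((hl.star.add hl).smul (-(2 * Real.pi ^ 2)))).ell_inv_mul
      convert! this using 1
      ext z
      simp only [pow_zero, one_mul] at this ⊢
      have hq : Summable fun n : ℕ => q z ^ n :=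
        summable_geometric_of_norm_lt_one (norm_q_lt_one z)
      have hcot : Real.pi * Complex.cot (Real.pi * z) = -(Real.pi * Complex.I) -
          2 * Real.pi * Complex.I * ∑' n : ℕ+, q z ^ (n : ℕ) := by
        have e1 : ∑' n : ℕ, q z ^ n = 1 + ∑' n : ℕ+, q z ^ (n : ℕ) := by
          rw [← tsum_zero_pnat_eq_tsum_nat hq, pow_zero]
        rw [pi_mul_cot_pi_q_exp, ← q, e1]
        ring
      rw [rowSum_one_one, hcot]
      set L := ∑' n : ℕ+, q z ^ (n : ℕ) with hLdef
      have hL : conj (-(Real.pi * Complex.I) - 2 * Real.pi * Complex.I * L) =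
          Real.pi * Complex.I + 2 * Real.pi * Complex.I * conj L := by
        simp only [map_sub, map_neg, map_mul, Complex.conj_I, Complex.conj_ofReal, map_ofNat]
        ring
      rw [hL]
      simp only [Pi.add_apply, Pi.smul_apply, Pi.one_apply, smul_eq_mul]
      rw [← hLdef]
      linear_combination (ell z ^ (-1 : ℤ) * Real.pi ^ 2 * (2 + 2 * L + 2 * conj L)) *
        Complex.I_sq
    · have := (((ih (a := a) (b := b + 1) (by lia) (by lia)).add
        ((ih (a := a + 1) (b := b) (by lia) (by lia)).smul (-1))).smul
          (Complex.I * Real.pi)).ell_inv_mul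
      convert! this using 1
      ext z
      rw [rowSum_succ_succ h0]
      simp [sub_eq_add_neg]

/-! ### Expansion of the lattice sums -/

/-- The row `m = 0` is a constant, rows `m` and `-m` agree by parity, and row `m ≥ 1` is the row sum
at `mz`. What remains is a sum over dilates with `j = 0`. -/
theorem exists_latticeSum_eq {a b : ℕ} (h : 3 ≤ a + b) (hab : Even (a + b)) :
    latticeSum a b ∈ expansions (1 - (a + b : ℕ)) ∧
      AnalyticOnNhd ℝ (toC (latticeSum a b)) {w : ℂ | 0 < w.im} := by
  obtain ⟨Φ, h1, h2, h3⟩ := dilateSummable_rowSum (a := a) (b := b) (by lia) 0 (by lia)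
  set c : ℂ := ∑' n : ℤ, (n : ℂ) ^ (-a : ℤ) * (n : ℂ) ^ (-b : ℤ) with hc
  have e : latticeSum a b = (fun _ => c) + (2 : ℂ) • Φ := by
    ext z
    have hs : Summable fun p : ℤ × ℤ => latticeTerm a b ![p.1, p.2] z :=
      (finTwoArrowEquiv ℤ).symm.summable_iff.mpr (summable_latticeTerm h z)
    have hE : (fun m : ℤ => ∑' n : ℤ, latticeTerm a b ![m, n] z).Even := fun m => by
      beta_reduce
      rw [← tsum_comp_neg]
      refine tsum_congr fun n => ?_
      have e1 : ∀ x : ℂ, ((-m : ℤ) : ℂ) * x + ((-n : ℤ) : ℂ) = -1 * (m * x + n) := fun x => by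
        push_cast; ring
      simp only [latticeTerm, Matrix.cons_val_zero, Matrix.cons_val_one, e1, mul_zpow]
      rw [mul_mul_mul_comm, ← zpow_add₀ (by norm_num), Even.neg_one_zpow, one_mul]
      rw [← neg_add, even_neg]; exact_mod_cast hab
    rw [latticeSum, ← (finTwoArrowEquiv ℤ).symm.tsum_eq]
    simp only [finTwoArrowEquiv_symm_apply]
    rw [hs.tsum_prod, tsum_int_eq_zero_add_two_mul_tsum_pnat hE hs.prod, nsmul_eq_mul]
    simp only [Pi.add_apply, Pi.smul_apply, smul_eq_mul]
    congr 1
    · simp [hc, latticeTerm]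
    · rw [← (h1 z).tsum_eq]
      push_cast
      congr 1
      refine tsum_congr fun m => ?_
      rw [rowSum]
      simp [latticeTerm, coe_dilate]
  rw [e]
  refine ⟨add_mem ?_ (Submodule.smul_mem _ _ h2), analyticOnNhd_const.add
    (analyticOnNhd_const.mul h3)⟩
  refine expansions_mono (p := 0) (by lia) (mem_expansions_zero_of_hasSum_q
    (A := fun N => if N = 0 then c else 0) fun z => ?_)
  convert! hasSum_single (f := fun N : ℕ => (if N = 0 then c else 0) * q z ^ N) 0
    fun N hN => by simp [hN] using 1
  simp

/-- The lattice sum has order at least `1 - (r + s + 2)` and the factor `𝕃` adds one: exactly the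
bound imposed in `quadrant`. -/
theorem eisFn_mem_PM {r s : ℕ} (h : 2 ≤ r + s) : eisFn r s ∈ PM (-(r + s : ℕ)) r s := by
  rcases Nat.even_or_odd (r + s) with hrs | hrs
  · obtain ⟨h1, h2⟩ := exists_latticeSum_eq (a := r + 1) (b := s + 1) (by lia)
      (by rw [show r + 1 + (s + 1) = r + s + 2 by ring]; exact hrs.add even_two)
    have e : eisFn r s = ((r + s).factorial / (2 * Real.pi * Complex.I) ^ (r + s + 2) *
        (1 / 2) : ℂ) • fun z => ell z ^ (1 : ℤ) * latticeSum (r + 1) (s + 1) z := by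
      ext z; rw [eisFn_eq]; simp
    refine ⟨⟨?_, fun γ z => eisFn_smul r s γ z⟩, ?_⟩
    · rw [e]
      exact analyticOnNhd_const.mul ((analyticOnNhd_toC_ell_zpow 1).mul h2)
    · rw [e]
      refine Submodule.smul_mem _ _ (expansions_mono ?_ (ell_zpow_mul_mem_expansions 1 h1))
      push_cast
      lia
  · rw [eisFn_eq_zero_of_odd hrs]
    exact zero_mem _

end ModIter
end

open scoped UpperHalfPlane MatrixGroups TensorProduct DirectSum ComplexConjugate

noncomputable section

namespace ModIter

open UpperHalfPlane

/-! ### Classification of primitives of length at most one -/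

/-- The span, in weights `(r, s)`, of the powers of `𝕃⁻¹` and their products with real analytic
Eisenstein series. -/
def eisSpan (r s : ℕ) : Submodule ℂ (ℍ → ℂ) :=
  Submodule.span ℂ ({f | r = s ∧ f = fun z => ell z ^ (-r : ℤ)} ∪
    {f | ∃ n a b : ℕ, r = a + n ∧ s = b + n ∧ 2 ≤ a + b ∧
      f = fun z => ell z ^ (-n : ℤ) * eisFn a b z})

theorem ell_zpow_mul_eisFn_mem_eisSpan (n : ℕ) {a b : ℕ} (h : 2 ≤ a + b) :
    (fun z => ell z ^ (-n : ℤ) * eisFn a b z) ∈ eisSpan (a + n) (b + n) :=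
  Submodule.subset_span (Or.inr ⟨n, a, b, rfl, rfl, h, rfl⟩)

theorem ell_zpow_mem_eisSpan (n : ℕ) : (fun z => ell z ^ (-n : ℤ)) ∈ eisSpan n n :=
  Submodule.subset_span (Or.inl ⟨rfl, rfl⟩)

theorem ell_zpow_mul_eisFn_mem_PM (n : ℕ) {a b : ℕ} (h : 2 ≤ a + b) :
    (fun z => ell z ^ (-n : ℤ) * eisFn a b z) ∈
      PM (-(a + n : ℕ) - (b + n : ℕ)) (a + n : ℕ) (b + n : ℕ) := by
  have := ell_zpow_mul_mem_PM (-n) (eisFn_mem_PM h)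
  simp only [sub_neg_eq_add] at this
  push_cast
  exact PM_mono (by push_cast; lia) _ _ this

theorem ell_zpow_neg_mem_PM (n : ℕ) :
    (fun z => ell z ^ (-n : ℤ)) ∈ PM (-n - n) n n := by
  have := ell_zpow_mem_PM (-n)
  rw [neg_neg] at this
  exact PM_mono (by lia) _ _ this

theorem eisSpan_le_PM (r s : ℕ) : eisSpan r s ≤ PM (-r - s) r s := by
  refine Submodule.span_le.mpr ?_
  rintro f (⟨rfl, rfl⟩ | ⟨n, a, b, rfl, rfl, h, rfl⟩)
  · exact ell_zpow_neg_mem_PM r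
  · exact ell_zpow_mul_eisFn_mem_PM n h

theorem conj_mem_eisSpan {r s : ℕ} {f : ℍ → ℂ} (hf : f ∈ eisSpan r s) :
    (fun z => conj (f z)) ∈ eisSpan s r := by
  induction hf using Submodule.span_induction with
  | mem f hf =>
    rcases hf with ⟨rfl, rfl⟩ | ⟨n, a, b, rfl, rfl, h, rfl⟩
    · simp only [map_zpow₀, conj_ell]
      exact ell_zpow_mem_eisSpan r
    · have := (eisSpan (b + n) (a + n)).smul_mem ((-1) ^ (a + b))
        (ell_zpow_mul_eisFn_mem_eisSpan n (by lia : 2 ≤ b + a))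
      convert! this using 1
      ext z
      simp only [map_mul, map_zpow₀, conj_ell, conj_eisFn, Pi.smul_apply, smul_eq_mul]
      ring
  | zero => simp only [Pi.zero_apply, map_zero]; exact zero_mem (eisSpan s r)
  | add f g _ _ hf hg => simpa using! add_mem hf hg
  | smul c f _ hf => simpa using! (eisSpan s r).smul_mem (conj c) hf

theorem maass_ell_zpow_mul_eisFn (n : ℕ) {a b : ℕ} (h : 2 ≤ a + b) :
    maass (a + n : ℕ) (fun z => ell z ^ (-n : ℤ) * eisFn a b z) =
      fun z => ell z ^ (-n : ℤ) * maass a (eisFn a b) z := by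
  have := maass_ell_zpow_mul (r := a) (k := -n) (f := eisFn a b)
    fun z => toC_differentiableAt (eisFn_mem_PM h).1 z
  rw [sub_neg_eq_add] at this
  exact_mod_cast this

theorem maass_ell_zpow (n : ℕ) : maass n (fun z => ell z ^ (-n : ℤ)) = 0 := by
  have h1 : maass 0 1 = 0 := by
    have : toC 1 = fun _ => (1 : ℂ) := rfl
    ext z
    simp [maass, dz, this]
  have := maass_ell_zpow_mul (r := 0) (k := -n) (f := 1)
    fun z => toC_differentiableAt one_mem_PM.1 z
  simpa [h1, Pi.zero_def] using this

theorem maass_sub {r s : ℤ} {f g : ℍ → ℂ} (hf : f ∈ modularFns r s) (hg : g ∈ modularFns r s)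
    (k : ℤ) : maass k (f - g) = maass k f - maass k g := by
  have h := maass_add hf ((modularFns r s).smul_mem (-1) hg) k
  rw [maass_smul, neg_one_smul, neg_one_smul] at h
  rw [sub_eq_add_neg, h, sub_eq_add_neg]

/-- In weights `(r + 1, s)` with `r > s` there is no pure power of `𝕃`, and every `𝓔_{a,b}` that
occurs has `a ≥ 1`, so one can step back along the ladder. -/
theorem exists_maass_eq_of_mem_eisSpan {r s : ℕ} (hrs : s + 1 ≤ r) {f : ℍ → ℂ}
    (hf : f ∈ eisSpan (r + 1) s) : ∃ φ ∈ eisSpan r (s + 1), maass r φ = f := by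
  induction hf using Submodule.span_induction with
  | mem f hf =>
    rcases hf with ⟨h, -⟩ | ⟨n, a, b, h1, h2, h, rfl⟩
    · lia
    · obtain ⟨a, rfl⟩ : ∃ c, a = c + 1 := ⟨a - 1, by lia⟩
      obtain rfl : r = a + n := by lia
      obtain rfl : s = b + n := by lia
      have h2 : 2 ≤ a + (b + 1) := by lia
      refine ⟨((a + 1 : ℕ) : ℂ)⁻¹ • fun z => ell z ^ (-n : ℤ) * eisFn a (b + 1) z,
        Submodule.smul_mem _ _ ?_, ?_⟩
      · have := ell_zpow_mul_eisFn_mem_eisSpan n h2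
        rwa [show b + 1 + n = b + n + 1 by ring] at this
      · have h3 : ((a + 1 : ℕ) : ℂ) ≠ 0 := by exact_mod_cast a.succ_ne_zero
        rw [maass_smul, maass_ell_zpow_mul_eisFn n h2, maass_eisFn_succ a b h2]
        ext z
        simp only [Pi.smul_apply, smul_eq_mul]
        field_simp
  | zero => exact ⟨0, zero_mem _, maass_zero _⟩
  | add f g _ _ hf hg =>
    obtain ⟨φ, h1, rfl⟩ := hf
    obtain ⟨ψ, h2, rfl⟩ := hg
    exact ⟨φ + ψ, add_mem h1 h2,
      maass_add (eisSpan_le_PM _ _ h1).1 (eisSpan_le_PM _ _ h2).1 _⟩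
  | smul c f _ hf =>
    obtain ⟨φ, h1, rfl⟩ := hf
    exact ⟨c • φ, Submodule.smul_mem _ c h1, maass_smul _ _ _⟩

/-- On the diagonal `g` has weight two and vanishes. Off it, a multiple of `𝕃^(-s) 𝓔_{r-s,0}`
accounts for the constant term of `g`, and the difference is zero by uniqueness of primitives. -/
theorem mem_eisSpan_of_maass_eq_zpow_mul {r s : ℕ} (hrs : s ≤ r) {p : ℤ} {f : ℍ → ℂ}
    (hf : f ∈ PM p r s) {g : ℍ → ℂ} (hg : g ∈ holForms (r - s + 2))
    (h : maass r f = fun z => ell z ^ (1 - s : ℤ) * g z) : f ∈ eisSpan r s := by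
  rcases hrs.eq_or_lt with rfl | hlt
  · rw [show (s - s + 2 : ℤ) = 2 by ring, holForms_two] at hg
    obtain rfl : g = 0 := by simpa using hg
    obtain ⟨c, rfl⟩ := eq_smul_of_maass_eq_zero hf (by rw [h]; ext; simp)
    exact Submodule.smul_mem _ c (ell_zpow_mem_eisSpan s)
  rcases Nat.even_or_odd (r + s) with hev | hodd
  swap
  · rw [eq_zero_of_odd hf.1 (by exact_mod_cast hodd)]
    exact zero_mem _
  obtain ⟨a, rfl⟩ : ∃ a, r = a + s := ⟨r - s, by lia⟩
  have ha : Even a := by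
    rw [add_assoc, ← two_mul] at hev
    exact (Nat.even_add.mp hev).mpr (even_two_mul s)
  have ha2 : 2 ≤ a := by
    obtain ⟨b, rfl⟩ := ha
    lia
  rw [show ((a + s : ℕ) - s + 2 : ℤ) = (a + 2 : ℕ) by push_cast; ring] at hg
  obtain ⟨g, rfl⟩ := hg
  obtain ⟨c, hc⟩ := exists_sub_smul_E (show 3 ≤ a + 2 by lia) (ha.add even_two) g
  obtain ⟨d, hd, hE⟩ := maass_eisFn_zero ha2
  have hmem : (fun z => ell z ^ (-s : ℤ) * eisFn a 0 z) ∈ eisSpan (a + s) s := by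
    simpa using ell_zpow_mul_eisFn_mem_eisSpan s (by lia : 2 ≤ a + 0)
  have hmem' := (eisSpan (a + s) s).smul_mem (c / d) hmem
  have hPM := eisSpan_le_PM _ _ hmem'
  have hz : f - (c / d) • (fun z => ell z ^ (-s : ℤ) * eisFn a 0 z) = 0 := by
    refine eq_zero_of_maass_eq_zpow_mul (p := min p (-(a + s : ℕ) - s)) (by exact_mod_cast hlt)
      (sub_mem (PM_mono (min_le_left _ _) _ _ hf) (PM_mono (min_le_right _ _) _ _ hPM))
      _ hc ?_
    rw [maass_sub hf.1 hPM.1, h, maass_smul, maass_ell_zpow_mul_eisFn s (by lia : 2 ≤ a + 0), hE]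
    ext z
    have e := ell_ne_zero z
    rw [FunLike.coe_sub, FunLike.coe_smul]
    simp only [Pi.sub_apply, Pi.smul_apply, smul_eq_mul, FunLike.coe_smul]
    rw [sub_eq_add_neg (1 : ℤ), zpow_add₀ e, zpow_one]
    field_simp
  rw [sub_eq_zero.mp hz]
  exact hmem'

section

variable {V : ℤ → ℤ → Set (ℍ → ℂ)}

/-- The sets `V r s` stand for the components of the elements of `MI 1`; the abstraction lets the
same argument serve for their conjugates. The induction on `s` starts because weights `(r + 1, -1)`
carry only zero. -/
theorem mem_eisSpan_of_maass_mem_of_le (hV : ∀ r s, ∀ f ∈ V r s, f ∈ PM (-r - s) r s)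
    (hneg : ∀ r s, ∀ f ∈ V r s, s < 0 → f = 0)
    (hd : ∀ r s, ∀ f ∈ V r s, ∃ f' ∈ V (r + 1) (s - 1), ∃ g ∈ holForms (r - s + 2),
      maass r f = f' + fun z => ell z ^ (1 - s) * g z)
    (r s : ℕ) (hrs : s ≤ r) {f : ℍ → ℂ} (hf : f ∈ V r s) : f ∈ eisSpan r s := by
  induction s generalizing r f with
  | zero =>
    obtain ⟨f', h1, g, hg, h2⟩ := hd _ _ f hf
    obtain rfl := hneg _ _ f' h1 (by simp)
    rw [zero_add] at h2
    exact mem_eisSpan_of_maass_eq_zpow_mul hrs (hV _ _ f hf) hg h2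
  | succ s ih =>
    obtain ⟨f', h1, g, hg, h2⟩ := hd _ _ f hf
    have h3 := ih (r + 1) (f := f') (by lia) (by
      rwa [show ((s + 1 : ℕ) : ℤ) - 1 = s by simp] at h1)
    obtain ⟨φ, hφ, rfl⟩ := exists_maass_eq_of_mem_eisSpan hrs h3
    have hφ' := eisSpan_le_PM _ _ hφ
    have := mem_eisSpan_of_maass_eq_zpow_mul hrs (sub_mem (hV _ _ f hf) hφ') hg (by
      rw [maass_sub (hV _ _ f hf).1 hφ'.1, h2, add_sub_cancel_left])
    simpa using add_mem this hφ

/-- For `r < s`, pass to the family of complex conjugates, which exchanges the two operators. -/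
theorem mem_eisSpan_of_maass_mem (hV : ∀ r s, ∀ f ∈ V r s, f ∈ PM (-r - s) r s)
    (hneg : ∀ r s, ∀ f ∈ V r s, ¬ (0 ≤ r ∧ 0 ≤ s) → f = 0)
    (hd : ∀ r s, ∀ f ∈ V r s, ∃ f' ∈ V (r + 1) (s - 1), ∃ g ∈ holForms (r - s + 2),
      maass r f = f' + fun z => ell z ^ (1 - s) * g z)
    (hdbar : ∀ r s, ∀ f ∈ V r s, ∃ f' ∈ V (r - 1) (s + 1), ∃ g ∈ holForms (s - r + 2),
      maassBar s f = f' + fun z => ell z ^ (1 - r) * conj (g z))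
    (r s : ℕ) {f : ℍ → ℂ} (hf : f ∈ V r s) : f ∈ eisSpan r s := by
  rcases le_total s r with h | h
  · exact mem_eisSpan_of_maass_mem_of_le hV (fun r s f hf hs => hneg r s f hf (by lia)) hd r s h hf
  have := mem_eisSpan_of_maass_mem_of_le
    (V := fun r s => {f | (fun z => conj (f z)) ∈ V s r}) (fun r s f hf => ?_)
    (fun r s f hf hs => ?_) (fun r s f hf => ?_) s r h (f := fun z => conj (f z)) (by simpa using hf)
  · simpa using conj_mem_eisSpan this
  · have := conj_mem_PM (hV _ _ _ hf)
    rw [show -s - r = -r - s by ring] at this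
    simpa using this
  · have := hneg _ _ _ hf (by lia)
    ext z
    simpa using congrFun this z
  · obtain ⟨f', hf', g, hg, e⟩ := hdbar _ _ _ hf
    refine ⟨fun z => conj (f' z), by simpa using hf', g, hg, ?_⟩
    ext z
    have := congrFun e z
    rw [maassBar_eq_conj] at this
    simp only [Complex.conj_conj] at this
    have h2 := congrArg conj this
    rw [Complex.conj_conj] at h2
    rw [h2]
    simp [conj_ell]

/-- For `r > s`, iterating `∂` leaves the quadrant, and functions of such weights killed by `∂`
vanish; going back, all of them are zero. On the diagonal `∂f` has such weights, so it vanishes and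
`f` is a multiple of `𝕃^(-r)`. -/
theorem mem_span_zpow_of_maass_mem (hV : ∀ r s, ∀ f ∈ V r s, f ∈ PM (-r - s) r s)
    (hneg : ∀ r s, ∀ f ∈ V r s, ¬ (0 ≤ r ∧ 0 ≤ s) → f = 0)
    (hd : ∀ r s, ∀ f ∈ V r s, maass r f ∈ V (r + 1) (s - 1))
    (hdbar : ∀ r s, ∀ f ∈ V r s, maassBar s f ∈ V (r - 1) (s + 1))
    (r s : ℕ) {f : ℍ → ℂ} (hf : f ∈ V r s) :
    (r ≠ s → f = 0) ∧ ∃ c : ℂ, f = c • fun z => ell z ^ (-r : ℤ) := by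
  have key : ∀ V : ℤ → ℤ → Set (ℍ → ℂ), (∀ r s, ∀ f ∈ V r s, f ∈ PM (-r - s) r s) →
      (∀ r s, ∀ f ∈ V r s, ¬ (0 ≤ r ∧ 0 ≤ s) → f = 0) →
      (∀ r s, ∀ f ∈ V r s, maass r f ∈ V (r + 1) (s - 1)) →
      ∀ s r : ℕ, s < r → ∀ f ∈ V r s, f = 0 := by
    intro V hV hneg hd s
    induction s with
    | zero =>
      intro r hrs f hf
      exact eq_zero_of_maass_eq_zero (by exact_mod_cast hrs) (hV _ _ f hf)
        (hneg _ _ _ (hd _ _ f hf) (by simp))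
    | succ s ih =>
      intro r hrs f hf
      refine eq_zero_of_maass_eq_zero (by exact_mod_cast hrs) (hV _ _ f hf) ?_
      refine ih (r + 1) (by lia) _ ?_
      have := hd _ _ f hf
      rwa [show ((s + 1 : ℕ) : ℤ) - 1 = s by simp] at this
  rcases lt_trichotomy s r with h | rfl | h
  · have := key V hV hneg hd s r h f hf
    exact ⟨fun _ => this, 0, by simpa using this⟩
  · refine ⟨fun h => absurd rfl h, eq_smul_of_maass_eq_zero (hV _ _ f hf) ?_⟩
    rcases Nat.eq_zero_or_pos s with rfl | hs
    · exact hneg _ _ _ (hd _ _ f hf) (by simp)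
    · refine key V hV hneg hd (s - 1) (s + 1) (by lia) _ ?_
      have := hd _ _ f hf
      rwa [show (s : ℤ) - 1 = (s - 1 : ℕ) by lia] at this
  · have := key (fun r s => {f | (fun z => conj (f z)) ∈ V s r}) (fun r s f hf => ?_)
      (fun r s f hf hs => ?_) (fun r s f hf => ?_) r s h (fun z => conj (f z)) (by simpa using hf)
    · have : f = 0 := by ext z; simpa using congrFun this z
      exact ⟨fun _ => this, 0, by simpa using this⟩
    · have := conj_mem_PM (hV _ _ _ hf)
      rw [show -s - r = -r - s by ring] at this
      simpa using this
    · have := hneg _ _ _ hf (by lia)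
      ext z
      simpa using congrFun this z
    · have := hdbar _ _ _ hf
      have e : (fun z => conj (maass r f z)) = maassBar r fun z => conj (f z) := by
        ext z
        rw [maassBar_eq_conj]
        simp
      rw [Set.mem_ofPred_eq, e]
      exact this

end

end ModIter
end

open scoped UpperHalfPlane MatrixGroups TensorProduct DirectSum ComplexConjugate

noncomputable section

namespace ModIter

open UpperHalfPlane

/-! ### Components of elements of the bigraded algebra -/

theorem coeff_del (F : Bigraded) (r s : ℤ) :
    (del F).coeff (r + 1, s - 1) = maass r (F.coeff (r, s)) := by
  classical
  rw [del, AddMonoidAlgebra.coeff_finsuppSum, Finsupp.sum_apply, Finsupp.sum,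
    Finset.sum_eq_single (r, s)]
  · simp
  · rintro ⟨a, b⟩ - h
    rw [AddMonoidAlgebra.coeff_single, Finsupp.single_eq_of_ne]
    contrapose! h
    simp only [Prod.mk.injEq] at h ⊢
    lia
  · intro h
    rw [Finsupp.notMem_support_iff.mp h]
    simp [maass_zero]

theorem coeff_delBar (F : Bigraded) (r s : ℤ) :
    (delBar F).coeff (r - 1, s + 1) = maassBar s (F.coeff (r, s)) := by
  classical
  rw [delBar, AddMonoidAlgebra.coeff_finsuppSum, Finsupp.sum_apply, Finsupp.sum,
    Finset.sum_eq_single (r, s)]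
  · simp
  · rintro ⟨a, b⟩ - h
    rw [AddMonoidAlgebra.coeff_single, Finsupp.single_eq_of_ne]
    contrapose! h
    simp only [Prod.mk.injEq] at h ⊢
    lia
  · intro h
    rw [Finsupp.notMem_support_iff.mp h]
    simp [maassBar_zero]

theorem del_single (r s : ℤ) (f : ℍ → ℂ) :
    del (single r s f) = single (r + 1) (s - 1) (maass r f) := by
  rw [del, AddMonoidAlgebra.coeff_single, Finsupp.sum_single_index]
  simp [maass_zero]

theorem delBar_single (r s : ℤ) (f : ℍ → ℂ) :
    delBar (single r s f) = single (r - 1) (s + 1) (maassBar s f) := by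
  rw [delBar, AddMonoidAlgebra.coeff_single, Finsupp.sum_single_index]
  simp [maassBar_zero]

theorem maassBar_smul (r : ℤ) (c : ℂ) (f : ℍ → ℂ) : maassBar r (c • f) = c • maassBar r f := by
  ext z
  have e : (fun z => conj ((c • f) z)) = conj c • fun z => conj (f z) := by ext; simp
  rw [maassBar_eq_conj, e, maass_smul, Pi.smul_apply, Pi.smul_apply, maassBar_eq_conj]
  simp

theorem del_smul (c : ℂ) (F : Bigraded) : del (c • F) = c • del F := by
  ext p : 2
  obtain ⟨r, s⟩ := p
  have := coeff_del (c • F) (r - 1) (s + 1)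
  have h := coeff_del F (r - 1) (s + 1)
  simp only [sub_add_cancel, add_sub_cancel_right] at this h
  rw [this, AddMonoidAlgebra.coeff_smul, AddMonoidAlgebra.coeff_smul, Finsupp.smul_apply,
    Finsupp.smul_apply, maass_smul, h]

theorem delBar_smul (c : ℂ) (F : Bigraded) : delBar (c • F) = c • delBar F := by
  ext p : 2
  obtain ⟨r, s⟩ := p
  have := coeff_delBar (c • F) (r + 1) (s - 1)
  have h := coeff_delBar F (r + 1) (s - 1)
  simp only [sub_add_cancel, add_sub_cancel_right] at this h
  rw [this, AddMonoidAlgebra.coeff_smul, AddMonoidAlgebra.coeff_smul, Finsupp.smul_apply,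
    Finsupp.smul_apply, maassBar_smul, h]

/-- If the generators of an algebra are homogeneous with components in a multiplicative family of
subspaces, so are the components of its elements. -/
theorem coeff_mem_of_mem_adjoin {P : ℤ → ℤ → Submodule ℂ (ℍ → ℂ)} (hone : 1 ∈ P 0 0)
    (hmul : ∀ {a b c d : ℤ} {f g : ℍ → ℂ}, f ∈ P a b → g ∈ P c d → f * g ∈ P (a + c) (b + d))
    {S : Set Bigraded} (hS : ∀ F ∈ S, ∃ a b, ∃ f ∈ P a b, F = single a b f) {F : Bigraded}
    (hF : F ∈ Algebra.adjoin ℂ S) (a b : ℤ) : F.coeff (a, b) ∈ P a b := by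
  rw [← Subalgebra.mem_toSubmodule, Algebra.adjoin_eq_span] at hF
  induction hF using Submodule.span_induction with
  | mem F hF =>
    have : ∃ a b, ∃ f ∈ P a b, F = single a b f := by
      induction hF using Submonoid.closure_induction with
      | mem F hF => exact hS F hF
      | one => exact ⟨0, 0, 1, hone, rfl⟩
      | mul F G _ _ hF hG =>
        obtain ⟨a, b, f, hf, rfl⟩ := hF
        obtain ⟨c, d, g, hg, rfl⟩ := hG
        exact ⟨a + c, b + d, f * g, hmul hf hg, by
          rw [AddMonoidAlgebra.single_mul_single, Prod.mk_add_mk]⟩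
    obtain ⟨c, d, f, hf, rfl⟩ := this
    rw [AddMonoidAlgebra.coeff_single]
    by_cases h : (c, d) = (a, b)
    · rw [h, Finsupp.single_eq_same]
      simp only [Prod.mk.injEq] at h
      rwa [← h.1, ← h.2]
    · rw [Finsupp.single_eq_of_ne (Ne.symm h)]
      exact zero_mem _
  | zero => exact zero_mem _
  | add F G _ _ hF hG => exact add_mem hF hG
  | smul c F _ hF => exact Submodule.smul_mem _ c hF

/-- The functions `𝕃 ^ (-b) g` of weights `(a, b)` with `g` a holomorphic modular form. -/
def holPart (a b : ℤ) : Submodule ℂ (ℍ → ℂ) :=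
  (holForms (a - b)).map (LinearMap.mulLeft ℂ (fun z => ell z ^ (-b)))

theorem mem_holPart {a b : ℤ} {f : ℍ → ℂ} :
    f ∈ holPart a b ↔ ∃ g ∈ holForms (a - b), f = fun z => ell z ^ (-b) * g z := by
  simp only [holPart, Submodule.mem_map, LinearMap.mulLeft_apply, eq_comm (b := f)]
  rfl

theorem one_mem_holPart : 1 ∈ holPart 0 0 :=
  mem_holPart.mpr ⟨1, by simpa using one_mem_holForms, by ext; simp⟩

theorem mul_mem_holPart {a b c d : ℤ} {f g : ℍ → ℂ} (hf : f ∈ holPart a b)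
    (hg : g ∈ holPart c d) : f * g ∈ holPart (a + c) (b + d) := by
  obtain ⟨f, h1, rfl⟩ := mem_holPart.mp hf
  obtain ⟨g, h2, rfl⟩ := mem_holPart.mp hg
  refine mem_holPart.mpr ⟨f * g, ?_, ?_⟩
  · have := mul_mem_holForms h1 h2
    rwa [show a - b + (c - d) = a + c - (b + d) by ring] at this
  · ext z
    simp only [Pi.mul_apply]
    rw [neg_add, zpow_add₀ (ell_ne_zero z)]
    ring

/-- The complex conjugates of the elements of `holPart b a`. -/
def antiholPart (a b : ℤ) : Submodule ℂ (ℍ → ℂ) where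
  carrier := {f | (fun z => conj (f z)) ∈ holPart b a}
  zero_mem' := by simp only [Set.mem_ofPred_eq, Pi.zero_apply, map_zero]; exact zero_mem (holPart b a)
  add_mem' hf hg := by simpa using! add_mem hf hg
  smul_mem' c f hf := by simpa using! (holPart b a).smul_mem (conj c) hf

theorem mem_antiholPart {a b : ℤ} {f : ℍ → ℂ} :
    f ∈ antiholPart a b ↔ (fun z => conj (f z)) ∈ holPart b a := Iff.rfl

/-- `𝕃` and `𝕃⁻¹` have diagonal weights, so the weights `(a, b)` determine both the modular weight
`a - b` and the power `𝕃^(-b)`. -/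
theorem coeff_mem_holPart {F : Bigraded}
    (hF : F ∈ Subalgebra.toSubmodule holEll * Subalgebra.toSubmodule (Algebra.adjoin ℂ {EllInv}))
    (a b : ℤ) : F.coeff (a, b) ∈ holPart a b := by
  refine coeff_mem_of_mem_adjoin one_mem_holPart mul_mem_holPart
    (S := insert EllInv (insert Ell {F | ∃ (n : ℤ) (f : ModularForm 𝒮ℒ n), F = single n 0 f}))
    ?_ (F := F) ?_ a b
  · have h1 : ∀ n : ℤ, (fun z => ell z ^ n) ∈ holPart (-n) (-n) := fun n =>
      mem_holPart.mpr ⟨1, by simpa using one_mem_holForms, by simp⟩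
    rintro F (rfl | rfl | ⟨n, f, rfl⟩)
    · exact ⟨1, 1, _, by simpa using h1 (-1), rfl⟩
    · exact ⟨-1, -1, _, by simpa using h1 1, rfl⟩
    · exact ⟨n, 0, _, mem_holPart.mpr ⟨f, ⟨f.mcast (by simp), by rfl⟩, by ext; simp⟩, rfl⟩
  · refine Submodule.mul_le (P := Subalgebra.toSubmodule (Algebra.adjoin ℂ _)).mpr
      (fun x hx y hy => ?_) hF
    exact Subalgebra.mul_mem _ (Algebra.adjoin_mono (Set.subset_insert _ _) hx)
      (Algebra.adjoin_mono (by simp) hy)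

theorem coeff_mem_antiholPart {F : Bigraded}
    (hF : F ∈ Subalgebra.toSubmodule antiholEll *
      Subalgebra.toSubmodule (Algebra.adjoin ℂ {EllInv})) (a b : ℤ) :
    F.coeff (a, b) ∈ antiholPart a b := by
  refine coeff_mem_of_mem_adjoin (P := antiholPart) ?_ ?_
    (S := insert EllInv (insert Ell
      {F | ∃ (n : ℤ) (f : ModularForm 𝒮ℒ n), F = single 0 n (fun z => conj (f z))}))
    ?_ (F := F) ?_ a b
  · simpa [mem_antiholPart] using! one_mem_holPart
  · intro a b c d f g hf hg
    simpa [mem_antiholPart] using! mul_mem_holPart hf hg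
  · have h1 : ∀ n : ℤ, (fun z => ell z ^ n) ∈ antiholPart (-n) (-n) := fun n =>
      mem_antiholPart.mpr (mem_holPart.mpr ⟨1, by simpa using one_mem_holForms, by simp [conj_ell]⟩)
    rintro F (rfl | rfl | ⟨n, f, rfl⟩)
    · exact ⟨1, 1, _, by simpa using h1 (-1), rfl⟩
    · exact ⟨-1, -1, _, by simpa using h1 1, rfl⟩
    · exact ⟨0, n, _, mem_antiholPart.mpr (mem_holPart.mpr
        ⟨f, ⟨f.mcast (by simp), by rfl⟩, by ext; simp⟩), rfl⟩
  · refine Submodule.mul_le (P := Subalgebra.toSubmodule (Algebra.adjoin ℂ _)).mpr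
      (fun x hx y hy => ?_) hF
    exact Subalgebra.mul_mem _ (Algebra.adjoin_mono (Set.subset_insert _ _) hx)
      (Algebra.adjoin_mono (by simp) hy)

theorem EllInv_pow (n : ℕ) : EllInv ^ n = single n n (fun z => ell z ^ (-n : ℤ)) := by
  rw [EllInv, AddMonoidAlgebra.single_pow]
  congr 1
  · simp
  · ext z; simp

end ModIter
end

open scoped UpperHalfPlane MatrixGroups TensorProduct DirectSum ComplexConjugate

noncomputable section

namespace ModIter

open UpperHalfPlane

/-! ### The operator `∂̄` on Eisenstein series -/

theorem maassBar_ell_zpow (n : ℕ) : maassBar n (fun z => ell z ^ (-n : ℤ)) = 0 := by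
  ext z
  have := congrFun (maass_ell_zpow n) z
  rw [maassBar_eq_conj]
  simp only [map_zpow₀, conj_ell]
  rw [this]
  simp

theorem conj_ell_zpow_mul_eisFn (n a b : ℕ) :
    (fun z => conj (ell z ^ (-n : ℤ) * eisFn a b z)) =
      ((-1) ^ (a + b) : ℂ) • fun z => ell z ^ (-n : ℤ) * eisFn b a z := by
  ext z
  simp only [map_mul, map_zpow₀, conj_ell, conj_eisFn, Pi.smul_apply, smul_eq_mul]
  ring

theorem maassBar_ell_zpow_mul_eisFn (n : ℕ) {a b : ℕ} (h : 2 ≤ a + b) (z : ℍ) :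
    maassBar (b + n : ℕ) (fun z => ell z ^ (-n : ℤ) * eisFn a b z) z =
      (-1) ^ (a + b) * (ell z ^ (-n : ℤ) * conj (maass b (eisFn b a) z)) := by
  rw [maassBar_eq_conj, conj_ell_zpow_mul_eisFn, maass_smul,
    maass_ell_zpow_mul_eisFn n (by lia : 2 ≤ b + a)]
  simp [conj_ell]

theorem maassBar_ell_zpow_mul_eisFn_succ (n : ℕ) {a b : ℕ} (h : 2 ≤ a + 1 + b) :
    maassBar (b + n : ℕ) (fun z => ell z ^ (-n : ℤ) * eisFn (a + 1) b z) =
      ((b + 1 : ℕ) : ℂ) • fun z => ell z ^ (-n : ℤ) * eisFn a (b + 1) z := by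
  ext z
  rw [maassBar_ell_zpow_mul_eisFn n h, maass_eisFn_succ b a (by lia)]
  simp only [Pi.smul_apply, smul_eq_mul, map_mul, map_natCast, conj_eisFn]
  rw [show b + 1 + a = a + 1 + b by ring]
  have : ((-1 : ℂ) ^ (a + 1 + b)) * (-1) ^ (a + 1 + b) = 1 := by
    rw [← mul_pow]; simp
  linear_combination (ell z ^ (-n : ℤ) * (b + 1 : ℕ) * eisFn a (b + 1) z) * this

theorem maassBar_ell_zpow_mul_eisFn_zero (n : ℕ) {b : ℕ} (h : 2 ≤ b) :
    ∃ g : ModularForm 𝒮ℒ (b + 2 : ℕ),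
      maassBar (b + n : ℕ) (fun z => ell z ^ (-n : ℤ) * eisFn 0 b z) =
        fun z => ell z ^ (1 - n : ℤ) * conj (g z) := by
  obtain ⟨c, -, hc⟩ := maass_eisFn_zero h
  refine ⟨((-1) ^ b : ℂ) • (c • ModularForm.E (show 3 ≤ b + 2 by lia)), ?_⟩
  ext z
  rw [maassBar_ell_zpow_mul_eisFn n (by lia), hc, sub_eq_add_neg, zpow_add₀ (ell_ne_zero z),
    FunLike.coe_smul ((-1) ^ b : ℂ)]
  simp only [map_mul, conj_ell, zero_add, zpow_one, Pi.smul_apply, smul_eq_mul, map_pow, map_neg,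
    map_one]
  ring

theorem maass_ell_zpow_mul_eisFn_zero (n : ℕ) {a : ℕ} (h : 2 ≤ a) :
    ∃ g : ModularForm 𝒮ℒ (a + 2 : ℕ),
      maass (a + n : ℕ) (fun z => ell z ^ (-n : ℤ) * eisFn a 0 z) =
        fun z => ell z ^ (1 - n : ℤ) * g z := by
  obtain ⟨c, -, hc⟩ := maass_eisFn_zero h
  refine ⟨c • ModularForm.E (show 3 ≤ a + 2 by lia), ?_⟩
  ext z
  rw [maass_ell_zpow_mul_eisFn n (by lia), hc, sub_eq_add_neg, zpow_add₀ (ell_ne_zero z),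
    zpow_one]
  ring

/-! ### The filtration spanned by Eisenstein series -/

theorem single_congr {r r' s s' : ℤ} {f f' : ℍ → ℂ} (hr : r = r') (hs : s = s') (hf : f = f') :
    single r s f = single r' s' f' := by
  rw [hr, hs, hf]

theorem smul_single (c : ℂ) (r s : ℤ) (f : ℍ → ℂ) : c • single r s f = single r s (c • f) :=
  AddMonoidAlgebra.smul_single ..

theorem single_mul_single (r s r' s' : ℤ) (f f' : ℍ → ℂ) :
    single r s f * single r' s' f' = single (r + r') (s + s') (f * f') :=
  AddMonoidAlgebra.single_mul_single ..

/-- The filtration spanned by the powers of `𝕃⁻¹` (in length zero) and their products with real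
analytic Eisenstein series (in length one). -/
def eisFiltration (k : ℤ) : Submodule ℂ Bigraded :=
  Submodule.span ℂ ({F | 0 ≤ k ∧ ∃ n : ℕ, F = single n n (fun z => ell z ^ (-n : ℤ))} ∪
    {F | 1 ≤ k ∧ ∃ n a b : ℕ, 2 ≤ a + b ∧
      F = single (a + n : ℕ) (b + n : ℕ) (fun z => ell z ^ (-n : ℤ) * eisFn a b z)})

theorem single_ell_zpow_mem_eisFiltration {k : ℤ} (hk : 0 ≤ k) (n : ℕ) :
    single n n (fun z => ell z ^ (-n : ℤ)) ∈ eisFiltration k :=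
  Submodule.subset_span (Or.inl ⟨hk, n, rfl⟩)

theorem single_eisFn_mem_eisFiltration {k : ℤ} (hk : 1 ≤ k) (n : ℕ) {a b : ℕ} (h : 2 ≤ a + b) :
    single (a + n : ℕ) (b + n : ℕ) (fun z => ell z ^ (-n : ℤ) * eisFn a b z) ∈ eisFiltration k :=
  Submodule.subset_span (Or.inr ⟨hk, n, a, b, h, rfl⟩)

theorem single_mem_quadrant {r s : ℕ} {f : ℍ → ℂ} (hf : f ∈ PM (-r - s) r s) :
    single r s f ∈ quadrant := by
  intro a b
  rw [AddMonoidAlgebra.coeff_single]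
  by_cases h : ((r : ℤ), (s : ℤ)) = (a, b)
  · rw [h, Finsupp.single_eq_same]
    simp only [Prod.mk.injEq] at h
    rw [← h.1, ← h.2]
    exact ⟨hf, fun h => absurd ⟨by simp, by simp⟩ h⟩
  · rw [Finsupp.single_eq_of_ne (Ne.symm h)]
    exact ⟨zero_mem _, fun _ => rfl⟩

theorem eisFiltration_le_quadrant (k : ℤ) : eisFiltration k ≤ quadrant := by
  refine Submodule.span_le.mpr ?_
  rintro F (⟨-, n, rfl⟩ | ⟨-, n, a, b, h, rfl⟩)
  · exact single_mem_quadrant (ell_zpow_neg_mem_PM n)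
  · exact single_mem_quadrant (ell_zpow_mul_eisFn_mem_PM n h)

theorem del_mem_of_mem_span {S : Set Bigraded} {T : Submodule ℂ Bigraded}
    (hS : Submodule.span ℂ S ≤ quadrant) (h : ∀ F ∈ S, del F ∈ T) {F : Bigraded}
    (hF : F ∈ Submodule.span ℂ S) : del F ∈ T := by
  induction hF using Submodule.span_induction with
  | mem F hF => exact h F hF
  | zero => simp [del]
  | add F G hF hG h1 h2 => rw [del_add (hS hF) (hS hG)]; exact add_mem h1 h2
  | smul c F _ h1 => rw [del_smul]; exact T.smul_mem c h1

theorem delBar_mem_of_mem_span {S : Set Bigraded} {T : Submodule ℂ Bigraded}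
    (hS : Submodule.span ℂ S ≤ quadrant) (h : ∀ F ∈ S, delBar F ∈ T) {F : Bigraded}
    (hF : F ∈ Submodule.span ℂ S) : delBar F ∈ T := by
  induction hF using Submodule.span_induction with
  | mem F hF => exact h F hF
  | zero => simp [delBar]
  | add F G hF hG h1 h2 => rw [delBar_add (hS hF) (hS hG)]; exact add_mem h1 h2
  | smul c F _ h1 => rw [delBar_smul]; exact T.smul_mem c h1

/-- `∂` moves along the ladder within length one and drops to length zero only at its end `b = 0`,
where it gives `𝕃` times a holomorphic form times `𝕃^(-n)`. For `∂̄` the end is `a = 0`. -/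
theorem isAdmissible_eisFiltration : IsAdmissible eisFiltration where
  mono k l h := Submodule.span_mono (Set.union_subset_union
    (fun _ ⟨hk, hF⟩ => ⟨hk.trans h, hF⟩) (fun _ ⟨hk, hF⟩ => ⟨hk.trans h, hF⟩))
  le_quadrant := eisFiltration_le_quadrant
  eq_bot k hk := by
    rw [eisFiltration, Submodule.span_eq_bot]
    rintro F (⟨h, -⟩ | ⟨h, -⟩) <;> lia
  del_mem k F hF := by
    refine del_mem_of_mem_span (eisFiltration_le_quadrant k) ?_ hF
    rintro F (⟨-, n, rfl⟩ | ⟨hk, n, a, b, h, rfl⟩)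
    · rw [del_single, maass_ell_zpow]
      simp
    rw [del_single]
    rcases b with _ | b
    · obtain ⟨g, hg⟩ := maass_ell_zpow_mul_eisFn_zero n (by lia : 2 ≤ a)
      have e : single ((a + n : ℕ) + 1) ((0 + n : ℕ) - 1)
          (maass (a + n : ℕ) (fun z => ell z ^ (-n : ℤ) * eisFn a 0 z)) =
          (Ell * single (a + 2 : ℕ) 0 g) * single n n (fun z => ell z ^ (-n : ℤ)) := by
        rw [hg, Ell, single_mul_single, single_mul_single]
        refine single_congr (by push_cast; ring) (by push_cast; ring) ?_
        ext z
        simp only [Pi.mul_apply]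
        rw [sub_eq_add_neg, zpow_add₀ (ell_ne_zero z), zpow_one]
        ring
      rw [e]
      refine Submodule.mem_sup_right (Submodule.mul_mem_mul (mul_mem ?_ ?_ : _ ∈ holEll)
        (single_ell_zpow_mem_eisFiltration (by lia) n))
      · exact Algebra.subset_adjoin (Set.mem_insert _ _)
      · exact Algebra.subset_adjoin (Or.inr ⟨_, g, rfl⟩)
    · rw [maass_ell_zpow_mul_eisFn n h, maass_eisFn_succ a b h]
      have := (eisFiltration k).smul_mem ((a + 1 : ℕ) : ℂ)
        (single_eisFn_mem_eisFiltration hk n (by lia : 2 ≤ a + 1 + b))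
      refine Submodule.mem_sup_left ?_
      convert! this using 1
      rw [smul_single]
      refine single_congr (by push_cast; ring) (by push_cast; ring) ?_
      ext z
      simp only [Pi.smul_apply, smul_eq_mul]
      ring
  delBar_mem k F hF := by
    refine delBar_mem_of_mem_span (eisFiltration_le_quadrant k) ?_ hF
    rintro F (⟨-, n, rfl⟩ | ⟨hk, n, a, b, h, rfl⟩)
    · rw [delBar_single, maassBar_ell_zpow]
      simp
    rw [delBar_single]
    rcases a with _ | a
    · obtain ⟨g, hg⟩ := maassBar_ell_zpow_mul_eisFn_zero n (by lia : 2 ≤ b)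
      have e : single ((0 + n : ℕ) - 1) ((b + n : ℕ) + 1)
          (maassBar (b + n : ℕ) (fun z => ell z ^ (-n : ℤ) * eisFn 0 b z)) =
          (Ell * single 0 (b + 2 : ℕ) (fun z => conj (g z))) *
            single n n (fun z => ell z ^ (-n : ℤ)) := by
        rw [hg, Ell, single_mul_single, single_mul_single]
        refine single_congr (by push_cast; ring) (by push_cast; ring) ?_
        ext z
        simp only [Pi.mul_apply]
        rw [sub_eq_add_neg, zpow_add₀ (ell_ne_zero z), zpow_one]
        ring
      rw [e]
      refine Submodule.mem_sup_right (Submodule.mul_mem_mul (mul_mem ?_ ?_ : _ ∈ antiholEll)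
        (single_ell_zpow_mem_eisFiltration (by lia) n))
      · exact Algebra.subset_adjoin (Set.mem_insert _ _)
      · exact Algebra.subset_adjoin (Or.inr ⟨_, g, rfl⟩)
    · rw [maassBar_ell_zpow_mul_eisFn_succ n h]
      have := (eisFiltration k).smul_mem ((b + 1 : ℕ) : ℂ)
        (single_eisFn_mem_eisFiltration hk n (by lia : 2 ≤ a + (b + 1)))
      refine Submodule.mem_sup_left ?_
      convert! this using 1
      rw [smul_single]
      exact single_congr (by push_cast; ring) (by push_cast; ring) rfl

theorem eisFiltration_le_MI (k : ℤ) : eisFiltration k ≤ MI k :=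
  le_iSup (fun V : {V // IsAdmissible V} => V.1 k) ⟨_, isAdmissible_eisFiltration⟩

theorem eisFiltration_zero :
    eisFiltration 0 = Subalgebra.toSubmodule (Algebra.adjoin ℂ {EllInv}) := by
  rw [Algebra.adjoin_eq_span, eisFiltration]
  congr 1
  ext F
  simp only [le_refl, true_and, Int.reduceLE, false_and, SetLike.mem_coe,
    Submonoid.mem_closure_singleton, EllInv_pow]
  constructor
  · rintro (⟨n, rfl⟩ | h)
    · exact ⟨n, rfl⟩
    · exact h.elim
  · rintro ⟨n, rfl⟩
    exact Or.inl ⟨n, rfl⟩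

theorem mem_of_coeff_mem {W : Submodule ℂ Bigraded} {F : Bigraded} (hF : F ∈ quadrant)
    (h : ∀ r s : ℕ, single r s (F.coeff (r, s)) ∈ W) : F ∈ W := by
  rw [← AddMonoidAlgebra.sum_coeff_single F]
  refine Submodule.sum_mem _ fun p _ => ?_
  obtain ⟨r, s⟩ := p
  by_cases hp : 0 ≤ r ∧ 0 ≤ s
  · obtain ⟨hr, hs⟩ := hp
    lift r to ℕ using hr
    lift s to ℕ using hs
    exact h r s
  · rw [(hF r s).2 hp]
    simp

/-- Length `-1` is zero, so `MI 0` is stable under both operators. -/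
theorem MI_zero_eq_eisFiltration : MI 0 = eisFiltration 0 := by
  refine le_antisymm (fun F hF => ?_) (eisFiltration_le_MI 0)
  have hbot : MI (0 - 1) = ⊥ := isAdmissible_MI.eq_bot _ (by lia)
  refine mem_of_coeff_mem (isAdmissible_MI.le_quadrant 0 hF) fun r s => ?_
  obtain ⟨h1, c, hc⟩ : (r ≠ s → F.coeff (r, s) = 0) ∧
      ∃ c : ℂ, F.coeff (r, s) = c • fun z => ell z ^ (-r : ℤ) := by
    refine mem_span_zpow_of_maass_mem (V := fun r s => {f | ∃ F ∈ MI 0, F.coeff (r, s) = f})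
      ?_ ?_ ?_ ?_ r s ⟨F, hF, rfl⟩
    · rintro r s _ ⟨F, hF, rfl⟩
      exact (isAdmissible_MI.le_quadrant 0 hF r s).1
    · rintro r s _ ⟨F, hF, rfl⟩
      exact (isAdmissible_MI.le_quadrant 0 hF r s).2
    · rintro r s _ ⟨F, hF, rfl⟩
      have := isAdmissible_MI.del_mem 0 F hF
      rw [hbot, Submodule.mul_bot, sup_bot_eq] at this
      exact ⟨del F, this, coeff_del F r s⟩
    · rintro r s _ ⟨F, hF, rfl⟩
      have := isAdmissible_MI.delBar_mem 0 F hF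
      rw [hbot, Submodule.mul_bot, sup_bot_eq] at this
      exact ⟨delBar F, this, coeff_delBar F r s⟩
  rcases eq_or_ne r s with rfl | hrs
  · rw [hc, ← smul_single]
    exact Submodule.smul_mem _ c (single_ell_zpow_mem_eisFiltration le_rfl r)
  · rw [h1 hrs]
    simp

theorem single_mem_eisFiltration_one {r s : ℕ} {f : ℍ → ℂ} (hf : f ∈ eisSpan r s) :
    single r s f ∈ eisFiltration 1 := by
  induction hf using Submodule.span_induction with
  | mem f hf =>
    rcases hf with ⟨rfl, rfl⟩ | ⟨n, a, b, rfl, rfl, h, rfl⟩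
    · exact single_ell_zpow_mem_eisFiltration zero_le_one r
    · exact single_eisFn_mem_eisFiltration le_rfl n h
  | zero => simp
  | add f g _ _ hf hg =>
    rw [single, AddMonoidAlgebra.single_add]
    exact add_mem hf hg
  | smul c f _ hf =>
    rw [← smul_single]
    exact Submodule.smul_mem _ c hf

/-- Since `MI 0` is `ℂ[𝕃⁻¹]`, the correction to `∂F` lies in `M[𝕃]` times `ℂ[𝕃⁻¹]`, whose components
are described by `coeff_mem_holPart`. -/
theorem MI_one_eq_eisFiltration : MI 1 = eisFiltration 1 := by
  refine le_antisymm (fun F hF => ?_) (eisFiltration_le_MI 1)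
  have hzero : MI (1 - 1) = Subalgebra.toSubmodule (Algebra.adjoin ℂ {EllInv}) := by
    rw [sub_self, MI_zero_eq_eisFiltration, eisFiltration_zero]
  refine mem_of_coeff_mem (isAdmissible_MI.le_quadrant 1 hF) fun r s => ?_
  refine single_mem_eisFiltration_one (mem_eisSpan_of_maass_mem
    (V := fun r s => {f | ∃ F ∈ MI 1, F.coeff (r, s) = f}) ?_ ?_ ?_ ?_ r s ⟨F, hF, rfl⟩)
  · rintro r s _ ⟨F, hF, rfl⟩
    exact (isAdmissible_MI.le_quadrant 1 hF r s).1
  · rintro r s _ ⟨F, hF, rfl⟩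
    exact (isAdmissible_MI.le_quadrant 1 hF r s).2
  · rintro r s _ ⟨F, hF, rfl⟩
    have := isAdmissible_MI.del_mem 1 F hF
    rw [hzero] at this
    obtain ⟨G, hG, H, hH, e⟩ := Submodule.mem_sup.mp this
    obtain ⟨g, hg, hg'⟩ := mem_holPart.mp (coeff_mem_holPart hH (r + 1) (s - 1))
    refine ⟨G.coeff (r + 1, s - 1), ⟨G, hG, rfl⟩, g, ?_, ?_⟩
    · rwa [show r + 1 - (s - 1) = r - s + 2 by ring] at hg
    · rw [← coeff_del, ← e, AddMonoidAlgebra.coeff_add, Finsupp.add_apply, hg', neg_sub]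
  · rintro r s _ ⟨F, hF, rfl⟩
    have := isAdmissible_MI.delBar_mem 1 F hF
    rw [hzero] at this
    obtain ⟨G, hG, H, hH, e⟩ := Submodule.mem_sup.mp this
    obtain ⟨g, hg, hg'⟩ := mem_holPart.mp
      (mem_antiholPart.mp (coeff_mem_antiholPart hH (r - 1) (s + 1)))
    refine ⟨G.coeff (r - 1, s + 1), ⟨G, hG, rfl⟩, g, ?_, ?_⟩
    · rwa [show s + 1 - (r - 1) = s - r + 2 by ring] at hg
    · rw [← coeff_delBar, ← e, AddMonoidAlgebra.coeff_add, Finsupp.add_apply]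
      congr 1
      ext z
      have := congrArg conj (congrFun hg' z)
      rw [Complex.conj_conj] at this
      rw [this]
      simp [conj_ell]

end ModIter
end

open scoped UpperHalfPlane MatrixGroups TensorProduct DirectSum ComplexConjugate

noncomputable section

namespace ModIter

open UpperHalfPlane Filter Topology

/-! ### Linear independence -/

/-- The indices of the non-vanishing Eisenstein series. -/
abbrev EvenIndex : Type := {p : EisIndex // Even (p.1.1 + p.1.2)}

/-- The weights of `𝕃 ^ (-n)` and of `𝕃 ^ (-n) 𝓔_{r,s}`. -/
def eisWeight : ℕ ⊕ (ℕ × EvenIndex) → ℤ × ℤ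
  | .inl n => (n, n)
  | .inr (n, p) => ((p.1.1.1 + n : ℕ), (p.1.1.2 + n : ℕ))

/-- The functions `𝕃 ^ (-n)` and `𝕃 ^ (-n) 𝓔_{r,s}`. -/
def eisBasisFn : ℕ ⊕ (ℕ × EvenIndex) → ℍ → ℂ
  | .inl n => fun z => ell z ^ (-n : ℤ)
  | .inr (n, p) => fun z => ell z ^ (-n : ℤ) * eisFn p.1.1.1 p.1.1.2 z

/-- The order of growth of `eisBasisFn i` at the cusp. -/
def eisOrder : ℕ ⊕ (ℕ × EvenIndex) → ℤ
  | .inl n => -n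
  | .inr (n, _) => 1 - n

/-- The elements `𝕃 ^ (-n)` and `𝕃 ^ (-n) 𝓔_{r,s}` of the bigraded algebra. -/
def eisBasis (i : ℕ ⊕ (ℕ × EvenIndex)) : Bigraded :=
  single (eisWeight i).1 (eisWeight i).2 (eisBasisFn i)

theorem exists_tendsto_eisBasisFn (i : ℕ ⊕ (ℕ × EvenIndex)) : ∃ c : ℂ, c ≠ 0 ∧
    Tendsto (fun n => eisBasisFn i (cuspSeq n) * ell (cuspSeq n) ^ (-eisOrder i)) atTop (𝓝 c) := by
  rcases i with m | ⟨m, p⟩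
  · refine ⟨1, one_ne_zero, tendsto_const_nhds.congr fun n => ?_⟩
    simp only [eisBasisFn, eisOrder]
    rw [← zpow_add₀ (ell_ne_zero _), add_neg_cancel, zpow_zero]
  · obtain ⟨c, hc, ht⟩ := exists_tendsto_eisFn p.1.2 p.2
    refine ⟨c, hc, ht.congr fun n => ?_⟩
    simp only [eisBasisFn, eisOrder]
    rw [mul_right_comm, ← zpow_add₀ (ell_ne_zero _), show -(m : ℤ) + -(1 - m) = -1 by ring,
      zpow_neg_one, mul_comm, div_eq_mul_inv]

/-- The order of `𝕃^(-n) 𝓔_{a,b}` gives `n`, and the weights then give `a` and `b`. In weights `(R,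
R)` such products have `n ≤ R`, hence order at least `1 - R`, while `𝕃^(-R)` has order `-R`. -/
theorem eq_of_eisWeight_eq_of_eisOrder_eq {i j : ℕ ⊕ (ℕ × EvenIndex)}
    (hw : eisWeight i = eisWeight j) (ho : eisOrder i = eisOrder j) : i = j := by
  rcases i with m | ⟨m, ⟨⟨⟨a, b⟩, hp⟩, hp'⟩⟩ <;> rcases j with n | ⟨n, ⟨⟨⟨c, d⟩, hq⟩, hq'⟩⟩ <;>
    simp only [eisWeight, eisOrder, Prod.mk.injEq] at hw ho
  · obtain rfl : m = n := by lia
    rfl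
  · lia
  · lia
  · obtain rfl : m = n := by lia
    obtain rfl : a = c := by lia
    obtain rfl : b = d := by lia
    rfl

/-- A relation splits according to weights, and within one weight the orders of growth are distinct.
-/
theorem linearIndependent_eisBasis : LinearIndependent ℂ eisBasis := by
  classical
  rw [linearIndependent_iff']
  intro S a h i hi
  have h1 : ∀ z, ∑ j ∈ S.filter fun j => eisWeight j = eisWeight i, a j * eisBasisFn j z = 0 := by
    intro z
    have h2 := congrFun (congrArg (fun F : Bigraded => F.coeff (eisWeight i)) h) z
    rw [AddMonoidAlgebra.coeff_sum, Finsupp.finsetSum_apply, Finset.sum_apply] at h2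
    rw [Finset.sum_filter]
    refine Eq.trans (Finset.sum_congr rfl fun j _ => ?_) h2
    rw [eisBasis, smul_single, AddMonoidAlgebra.coeff_single, Finsupp.single_apply]
    simp only [Prod.mk.eta]
    split_ifs <;> simp
  exact eq_zero_of_sum_zpow_mul_eq_zero _ eisOrder (fun j hj k hk hjk =>
    eq_of_eisWeight_eq_of_eisOrder_eq (by simp at hj hk; rw [hj.2, hk.2]) hjk) eisBasisFn
    (fun j _ => exists_tendsto_eisBasisFn j) a h1 i (by simp [hi])

/-! ### The multiplication map -/

theorem eisFiltration_zero_eq_span :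
    eisFiltration 0 = Submodule.span ℂ (Set.range fun n => eisBasis (.inl n)) := by
  rw [eisFiltration]
  congr 1
  ext F
  simp [eisBasis, eisWeight, eisBasisFn, eq_comm]

theorem eisFiltration_one_eq_sup : eisFiltration 1 =
    eisFiltration 0 ⊔ Submodule.span ℂ (Set.range fun i => eisBasis (.inr i)) := by
  rw [eisFiltration_zero_eq_span]
  refine le_antisymm (Submodule.span_le.mpr ?_) (sup_le ?_ ?_)
  · rintro F (⟨-, n, rfl⟩ | ⟨-, n, a, b, h, rfl⟩)
    · exact Submodule.mem_sup_left (Submodule.subset_span ⟨n, rfl⟩)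
    · rcases Nat.even_or_odd (a + b) with hev | hodd
      · exact Submodule.mem_sup_right (Submodule.subset_span ⟨(n, ⟨⟨(a, b), h⟩, hev⟩), rfl⟩)
      · rw [eisFn_eq_zero_of_odd hodd, show (fun z => ell z ^ (-n : ℤ) * (0 : ℍ → ℂ) z) = 0 by
          ext; simp]
        simp
  · refine Submodule.span_le.mpr ?_
    rintro _ ⟨n, rfl⟩
    exact single_ell_zpow_mem_eisFiltration zero_le_one n
  · refine Submodule.span_le.mpr ?_
    rintro _ ⟨⟨n, p⟩, rfl⟩
    exact single_eisFn_mem_eisFiltration le_rfl n p.1.2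

theorem eisBasis_inl_mem_MI (n : ℕ) : eisBasis (.inl n) ∈ MI 0 := by
  rw [MI_zero_eq_eisFiltration, eisFiltration_zero_eq_span]
  exact Submodule.subset_span ⟨n, rfl⟩

/-- The elements `𝕃 ^ (-n) ⊗ 𝓔_{r,s}`. -/
def eisTensor (i : ℕ × EvenIndex) : MI 0 ⊗[ℂ] EisSum :=
  ⟨eisBasis (.inl i.1), eisBasis_inl_mem_MI i.1⟩ ⊗ₜ
    DirectSum.of (fun p : EisIndex => (Submodule.span ℂ {eis p.1.1 p.1.2} : Submodule ℂ Bigraded))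
      i.2.1 ⟨eis i.2.1.1.1 i.2.1.1.2, Submodule.mem_span_singleton_self _⟩

theorem eisMul_eisTensor (i : ℕ × EvenIndex) : eisMul (eisTensor i) = eisBasis (.inr i) := by
  simp only [eisMul, eisTensor, TensorProduct.lift.tmul, LinearMap.compl₁₂_apply,
    Submodule.subtype_apply, LinearMap.mul_apply']
  erw [DirectSum.coeLinearMap_of]
  simp only [eisBasis, eis, eisWeight, eisBasisFn]
  rw [single_mul_single]
  exact single_congr (by push_cast; ring) (by push_cast; ring) rfl

/-- Summands with `r + s` odd are zero, so the even indices suffice. -/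
theorem span_range_eisTensor : Submodule.span ℂ (Set.range eisTensor) = ⊤ := by
  rw [eq_top_iff]
  rintro t -
  induction t using TensorProduct.induction_on with
  | zero => exact zero_mem _
  | add x y hx hy => exact add_mem hx hy
  | tmul x y =>
    induction y using DirectSum.induction_on with
    | zero => simp
    | add y y' hy hy' => rw [TensorProduct.tmul_add]; exact add_mem hy hy'
    | of p y =>
      obtain ⟨c, rfl⟩ : ∃ c : ℂ, y = c • ⟨eis p.1.1 p.1.2, Submodule.mem_span_singleton_self _⟩ := by
        obtain ⟨c, hc⟩ := Submodule.mem_span_singleton.mp y.2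
        exact ⟨c, Subtype.ext hc.symm⟩
      rw [← DirectSum.lof_eq_of ℂ, map_smul, TensorProduct.tmul_smul, DirectSum.lof_eq_of]
      refine Submodule.smul_mem _ c ?_
      have hle : ∀ {x}, x ∈ Submodule.span ℂ (Set.range fun n => eisBasis (.inl n)) → x ∈ MI 0 :=
        fun h => by rwa [MI_zero_eq_eisFiltration, eisFiltration_zero_eq_span]
      have key : ∀ x (hx : x ∈ Submodule.span ℂ (Set.range fun n => eisBasis (.inl n))),
          (⟨x, hle hx⟩ : MI 0) ⊗ₜ[ℂ] DirectSum.of (fun p : EisIndex =>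
            (Submodule.span ℂ {eis p.1.1 p.1.2} : Submodule ℂ Bigraded)) p
            ⟨eis p.1.1 p.1.2, Submodule.mem_span_singleton_self _⟩ ∈
            Submodule.span ℂ (Set.range eisTensor) := by
        intro x hx
        induction hx using Submodule.span_induction with
        | mem x hx =>
          obtain ⟨n, rfl⟩ := hx
          rcases Nat.even_or_odd (p.1.1 + p.1.2) with hev | hodd
          · exact Submodule.subset_span ⟨(n, ⟨p, hev⟩), rfl⟩
          · have h0 : (⟨eis p.1.1 p.1.2, Submodule.mem_span_singleton_self _⟩ :
                (Submodule.span ℂ {eis p.1.1 p.1.2} : Submodule ℂ Bigraded)) = 0 := by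
              refine Subtype.ext ?_
              simp [eis, eisFn_eq_zero_of_odd hodd]
            rw [h0, map_zero, TensorProduct.tmul_zero]
            exact zero_mem _
        | zero =>
          have h0 : (⟨0, hle (zero_mem _)⟩ : MI 0) = 0 := rfl
          rw [h0, TensorProduct.zero_tmul]
          exact zero_mem _
        | add x x' h h' hx hx' =>
          have := add_mem hx hx'
          rwa [← TensorProduct.add_tmul] at this
        | smul a x h hx =>
          have := Submodule.smul_mem _ a hx
          rwa [TensorProduct.smul_tmul'] at this
      exact key x (by rw [← eisFiltration_zero_eq_span, ← MI_zero_eq_eisFiltration]; exact x.2)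

/-- The map carries a spanning family to a linearly independent one. -/
theorem injective_eisMul : Function.Injective eisMul := by
  have hli := linearIndependent_eisBasis.comp _ Sum.inr_injective
  have hex : ∀ t, ∃ a : ℕ × EvenIndex →₀ ℂ, (Finsupp.linearCombination ℂ eisTensor) a = t :=
    fun t => by
      rw [← LinearMap.mem_range, Finsupp.range_linearCombination, span_range_eisTensor]
      trivial
  have hmap : ∀ a, eisMul (Finsupp.linearCombination ℂ eisTensor a) =
      Finsupp.linearCombination ℂ (eisBasis ∘ Sum.inr) a := fun a => by
    simp [Finsupp.linearCombination_apply, Finsupp.sum, eisMul_eisTensor]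
  intro t t' h
  obtain ⟨a, rfl⟩ := hex t
  obtain ⟨a', rfl⟩ := hex t'
  rw [hmap, hmap] at h
  rw [hli h]

theorem range_eisMul :
    LinearMap.range eisMul = Submodule.span ℂ (Set.range fun i => eisBasis (.inr i)) := by
  rw [LinearMap.range_eq_map, ← span_range_eisTensor, Submodule.map_span, ← Set.range_comp]
  congr 2
  ext i : 1
  exact eisMul_eisTensor i

end ModIter
end

/-! ### The main theorem -/

theorem mainTheorem7 :
    ModIter.MI 0 = Subalgebra.toSubmodule (Algebra.adjoin ℂ {ModIter.EllInv}) ∧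
    (∀ p : ModIter.EisIndex, ModIter.eis p.1.1 p.1.2 ≠ 0 ↔ Even (p.1.1 + p.1.2)) ∧
    Function.Injective ModIter.eisMul ∧
    Disjoint (ModIter.MI 0) (LinearMap.range ModIter.eisMul) ∧
    ModIter.MI 1 = ModIter.MI 0 ⊔ LinearMap.range ModIter.eisMul := by
  refine ⟨ModIter.MI_zero_eq_eisFiltration.trans ModIter.eisFiltration_zero,
    fun p => ModIter.eis_ne_zero_iff p.2, ModIter.injective_eisMul, ?_, ?_⟩
  -- Independence of the joint family of `𝕃^(-n)` and `𝕃^(-n) 𝓔_{r,s}` contains the disjointness of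
  -- the two spans.
  · have h := ModIter.linearIndependent_eisBasis
    rw [← Sum.elim_comp_inl_inr ModIter.eisBasis, linearIndependent_sum] at h
    rw [ModIter.range_eisMul]
    refine (ModIter.MI_zero_eq_eisFiltration.trans ModIter.eisFiltration_zero_eq_span).symm ▸ h.2.2
  · rw [ModIter.range_eisMul, ModIter.MI_zero_eq_eisFiltration, ModIter.MI_one_eq_eisFiltration,
      ModIter.eisFiltration_one_eq_sup]
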